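/- Let $A=(a_{ij})_{i,j\in I}$ be an integral Cartan matrix on a finite set $I$ with parity $p:I\to\mathbb Z/2$ ($a_{ii}=2$ if $p(i)=0$, $a_{ii}\in\{0,2\}$ if $p(i)=1$) and nonzero integers $d_i$ with $d_ia_{ij}=d_ja_{ji}$ and $\gcd(d_i)=1$. Let $\mathfrak g$ be the associated contragredient complex Lie superalgebra, assumed finite-dimensional (this covers the basic Lie superalgebras of types A–G): it has a Cartan subalgebra $\mathfrak h$, simple roots $\alpha_i$, nonzero simple coroots $h_i\in\mathfrak h$ with $\alpha_j(h_i)=a_{ij}$, is generated by $\mathfrak h$ and Chevalley generators $e_i,f_i$ of parity $p(i)$, is graded by the root lattice $\mathbb Z^I$ with root spaces $\mathfrak g_\alpha$ ($\mathfrak g_0=\mathfrak h$), and has no nonzero graded ideal meeting $\mathfrak h$ trivially; $\mathfrak h$ is such that the $h_i$ and the $\alpha_i$ are both linearly independent (as for $\mathfrak{gl}(m|n)$), or the $h_i$ form a basis of $\mathfrak h$ (as for $\mathfrak{sl}(m|n)$), or the $h_i$ span $\mathfrak h$ and $\bigcap_i\ker\alpha_i=0$ (as for $\mathfrak{psl}(n|n)$).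 Let $I_\bullet\subsetneq I$ be a proper subset consisting of even nodes, $I_\circ=I\setminus I_\bullet$, let $w_\bullet=r_{i_1}\cdots r_{i_k}$ be a reduced expression of the longest element of the Weyl group generated by the reflections $r_i(h)=h-\alpha_i(h)h_i$, $i\in I_\bullet$, and let $2\rho_\bullet^\vee$ be the sum of the positive coroots of the subdiagram $I_\bullet$. Let $\tau$ be a parity-preserving permutation of $I$ with $d_ia_{ij}=d_{\tau i}a_{\tau i,\tau j}$ and $\tau(I_\bullet)=I_\bullet$. Assume that $(I=I_\circ\cup I_\bullet,\tau)$ is super admissible: (1) $\tau^2=\mathrm{id}$; (2) $\tau$ acts on $I_\bullet$ as $-w_\bullet$; (3) $\alpha_j(\rho_\bullet^\vee)\in\mathbb Z$ for every $j\in I_\circ$ with $\tau j=j$ that is even or satisfies $a_{jj}\ne0$; (4) $\alpha_j(\rho_\bullet^\vee)\ne0$ for every odd $j\in I_\circ$ with $\tau j=j$ and $a_{jj}=0$. Assume also that $A$ is normalized so that $d_{\tau i}=-d_i$ for every odd $i$ with $\tau i\neq i$. Let $\mathrm{Ad}(m_\bullet)=\mathrm{Ad}(m_{i_1})\cdots\mathrm{Ad}(m_{i_k})$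 with $\mathrm{Ad}(m_i)=\exp(\mathrm{ad}\,e_i)\exp(-\mathrm{ad}\,f_i)\exp(\mathrm{ad}\,e_i)$; let $\omega$ be the automorphism of $\mathfrak g$ with $\omega(e_i)=-f_i$, $\omega(f_i)=-(-1)^{p(i)}e_i$, $\omega|_{\mathfrak h}=-1$; let $\tau$ also denote an automorphism of $\mathfrak g$ preserving $\mathfrak h$, with $\tau^2|_{\mathfrak h}=1$, $\tau(f_i)=f_{\tau i}$, $\tau(e_i)=\epsilon_ie_{\tau i}$, $\tau(h_i)=\epsilon_ih_{\tau i}$, where $\epsilon_i=1$ if $\tau i=i$ and $\epsilon_i=(-1)^{p(i)}$ otherwise; let $s\in\mathrm{Hom}(\mathbb Z^I,\mathbb C^*)$ satisfy $s(\alpha_i)=1$ if $i\in I_\bullet$ or $\tau i=i\in I_\circ$, and $s(\alpha_i)/s(\alpha_{\tau i})=(-1)^{\alpha_i(2\rho_\bullet^\vee)}$ if $\tau i\ne i\in I_\circ$; and let $\mathrm{Ad}(s)$ act on $\mathfrak g_\alpha$ as $s(\alpha)$. Such $w_\bullet$ (with a reduced expression), $\omega$, $\tau$ and $s$ exist, and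 for every choice of them, $\theta(I,\tau)=\mathrm{Ad}(s)\circ\tau\circ\omega\circ\mathrm{Ad}(m_\bullet)$ satisfies: (1) $\theta(I,\tau)$ is an automorphism of the Lie superalgebra $\mathfrak g$ of order $2$ or $4$; (2) $\theta(I,\tau)$ has order $2$ if and only if $\alpha_i(2\rho_\bullet^\vee)\equiv1\pmod 2$ for all odd $i\in I_\circ$ with $\tau i=i$. -/

import Mathlib

/-- A complex Lie superalgebra structure on a complex vector space: a `ℤ/2`-grading together with
an even bilinear bracket which is super skew-symmetric and satisfies the super Jacobi identity. -/
class LieSuperalgebra (g : Type*) [AddCommGroup g] [Module ℂ g] where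
  /-- the homogeneous part of given parity -/
  part : ZMod 2 → Submodule ℂ g
  /-- the super bracket -/
  br : g →ₗ[ℂ] g →ₗ[ℂ] g
  part_isInternal : DirectSum.IsInternal part
  br_mem : ∀ (a b : ZMod 2) (x y : g), x ∈ part a → y ∈ part b → br x y ∈ part (a + b)
  br_skew : ∀ (a b : ZMod 2) (x y : g), x ∈ part a → y ∈ part b →
    br x y = -((-1 : ℂ) ^ (a.val * b.val)) • br y x
  br_jacobi : ∀ (a b : ZMod 2) (x y z : g), x ∈ part a → y ∈ part b →
    br x (br y z) = br (br x y) z + ((-1 : ℂ) ^ (a.val * b.val)) • br y (br x z)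

namespace SuperSatake

open LieSuperalgebra

/-- A linear endomorphism is an automorphism of the Lie superalgebra: bijective, even, and
compatible with the bracket. -/
structure IsAut {g : Type*} [AddCommGroup g] [Module ℂ g] [LieSuperalgebra g]
    (φ : Module.End ℂ g) : Prop where
  bijective : Function.Bijective φ
  even : ∀ (a : ZMod 2) (x : g), x ∈ part a → φ x ∈ part a
  map_br : ∀ x y : g, φ (br x y) = br (φ x) (φ y)

/-- Exponential of a nilpotent endomorphism. -/
noncomputable def nilExp {g : Type*} [AddCommGroup g] [Module ℂ g] (a : Module.End ℂ g) :
    Module.End ℂ g :=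
  ∑ n ∈ Finset.range (nilpotencyClass a), ((n.factorial : ℂ)⁻¹) • a ^ n

/-- A symmetrizable integral Cartan matrix `A` with parities `p` and symmetrizer `d`. -/
structure CartanDatum (I : Type*) [Fintype I] where
  A : Matrix I I ℤ
  p : I → ZMod 2
  d : I → ℤ
  d_ne_zero : ∀ i, d i ≠ 0
  symm : ∀ i j, d i * A i j = d j * A j i
  gcd_d : Finset.univ.gcd d = 1
  diag_even : ∀ i, p i = 0 → A i i = 2
  diag_odd : ∀ i, p i = 1 → A i i = 0 ∨ A i i = 2

section Combinatorics

variable {I : Type*} [Fintype I] [DecidableEq I]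

/-- The value `α_i(y)` for `y = ∑ j, y j • h_j` in the coroot lattice, using `α_i(h_j) = a_{ji}`. -/
def rootEval (A : Matrix I I ℤ) (i : I) : (I → ℤ) →ₗ[ℤ] ℤ :=
  ∑ j, A j i • LinearMap.proj j

/-- The reflection `r_i(y) = y - α_i(y) h_i` on the coroot lattice `Y = ℤ^I`. -/
def reflection (A : Matrix I I ℤ) (i : I) : Module.End ℤ (I → ℤ) :=
  LinearMap.id - (rootEval A i).smulRight (Pi.single i 1)

/-- The element `r_{i₁} ⋯ r_{iₖ}` of the Weyl group given by a word `[i₁, …, iₖ]`. -/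
def wordProd (A : Matrix I I ℤ) (l : List I) : Module.End ℤ (I → ℤ) :=
  (l.map (reflection A)).prod

/-- The word `l` in the letters `B` is a reduced expression in the Weyl group `W_B`. -/
def IsReducedWord (A : Matrix I I ℤ) (B : Set I) (l : List I) : Prop :=
  (∀ i ∈ l, i ∈ B) ∧
    ∀ l' : List I, (∀ i ∈ l', i ∈ B) → wordProd A l' = wordProd A l → l.length ≤ l'.length

/-- The word `l` is a reduced expression of the longest element of the Weyl group `W_B`. -/
def IsLongestWord (A : Matrix I I ℤ) (B : Set I) (l : List I) : Prop :=
  IsReducedWord A B l ∧ ∀ l' : List I, IsReducedWord A B l' → l'.length ≤ l.length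

/-- The positive coroots of the subdiagram `B`: the elements `w(h_i)`, `w ∈ W_B`, `i ∈ B`, whose
coefficients in the simple coroots are nonnegative. -/
def posCoroots (A : Matrix I I ℤ) (B : Set I) : Set (I → ℤ) :=
  {y | (∃ l : List I, (∀ i ∈ l, i ∈ B) ∧ ∃ i ∈ B, y = wordProd A l (Pi.single i 1)) ∧
    ∀ j, 0 ≤ y j}

/-- `2ρ_B^∨`, the sum of the positive coroots of the (finite type) subdiagram `B`. -/
noncomputable def twoRho (A : Matrix I I ℤ) (B : Set I) : I → ℤ :=
  ∑ᶠ y ∈ posCoroots A B, y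

/-- The diagram `I = I_∘ ∪ I_•` with set `B = I_•` of black nodes, together with the
permutation `τ`, is a super admissible pair. -/
structure IsSuperAdmissible (C : CartanDatum I) (B : Set I) (τ : Equiv.Perm I) : Prop where
  black_even : ∀ i ∈ B, C.p i = 0
  parity : ∀ i, C.p (τ i) = C.p i
  form : ∀ i j, C.d i * C.A i j = C.d (τ i) * C.A (τ i) (τ j)
  stable : τ '' B = B
  invol : ∀ i, τ (τ i) = i
  /-- `τ` acts on the black nodes as `-w_•`, where `w_•` is the longest element -/
  neg_longest : ∀ l, IsLongestWord C.A B l → ∀ i ∈ B,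
    wordProd C.A l (Pi.single i 1) = -Pi.single (τ i) 1
  /-- even and non-isotropic odd white nodes fixed by `τ`: `α_j(ρ_•^∨) ∈ ℤ` -/
  integral : ∀ j, j ∉ B → (C.p j = 0 ∨ (C.p j = 1 ∧ C.A j j ≠ 0)) → τ j = j →
    ∃ n : ℤ, (rootEval C.A j (twoRho C.A B) : ℚ) / 2 = n
  /-- isotropic odd white nodes fixed by `τ`: `α_j(ρ_•^∨) ≠ 0` -/
  nonzero : ∀ j, j ∉ B → (C.p j = 1 ∧ C.A j j = 0) → τ j = j →
    (rootEval C.A j (twoRho C.A B) : ℚ) / 2 ≠ 0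

/-- The conditions on `s ∈ Hom(ℤΠ, ℂˣ)`; the root lattice `ℤΠ` is `ℤ^I`, and a homomorphism from
it to `ℂˣ` is an additive character with values in `ℂ`. -/
structure IsTwist (C : CartanDatum I) (B : Set I) (τ : Equiv.Perm I)
    (s : AddChar (I → ℤ) ℂ) : Prop where
  one_of_black : ∀ i ∈ B, s (Pi.single i 1) = 1
  one_of_fixed : ∀ i, i ∉ B → τ i = i → s (Pi.single i 1) = 1
  ratio : ∀ i, i ∉ B → τ i ≠ i →
    s (Pi.single i 1) / s (Pi.single (τ i) 1) = (-1 : ℂ) ^ (rootEval C.A i (twoRho C.A B))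

end Combinatorics

/-- Presentation of a Lie superalgebra `g` as the contragredient Lie superalgebra of a Cartan
datum: Cartan subalgebra, simple roots and coroots, Chevalley generators and root spaces.
The last two fields say that `g` has no superfluous ideals, and that the Cartan subalgebra is of
one of the usual sizes, as in `gl(m|n)`, `sl(m|n)` or `psl(n|n)`. When `A` is
invertible, the three coincide (up to enlarging the centre in the first). -/
structure Realization {I : Type*} [Fintype I] [DecidableEq I] (C : CartanDatum I)
    (g : Type*) [AddCommGroup g] [Module ℂ g] [LieSuperalgebra g] where
  /-- the Cartan subalgebra -/
  cartan : Submodule ℂ g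
  /-- the simple roots -/
  root : I → Module.Dual ℂ cartan
  /-- the simple coroots -/
  coroot : I → cartan
  e : I → g
  f : I → g
  /-- the root space of an element of the root lattice `ℤ^I`; at `0` it is the Cartan subalgebra -/
  rootSpace : (I → ℤ) → Submodule ℂ g
  root_coroot : ∀ i j, root j (coroot i) = C.A i j
  coroot_ne_zero : ∀ i, coroot i ≠ 0
  cartan_even : cartan ≤ part 0
  e_mem : ∀ i, e i ∈ part (C.p i)
  f_mem : ∀ i, f i ∈ part (C.p i)
  cartan_comm : ∀ h k : cartan, br (h : g) (k : g) = 0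
  cartan_e : ∀ (h : cartan) (i : I), br (h : g) (e i) = root i h • e i
  cartan_f : ∀ (h : cartan) (i : I), br (h : g) (f i) = -(root i h • f i)
  e_f : ∀ i j, br (e i) (f j) = if i = j then (coroot i : g) else 0
  generated : ∀ K : Submodule ℂ g, (∀ x ∈ K, ∀ y ∈ K, br x y ∈ K) → cartan ≤ K →
    (∀ i, e i ∈ K) → (∀ i, f i ∈ K) → K = ⊤
  rootSpace_isInternal : DirectSum.IsInternal rootSpace
  rootSpace_br : ∀ (a b : I → ℤ) (x y : g), x ∈ rootSpace a → y ∈ rootSpace b →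
    br x y ∈ rootSpace (a + b)
  rootSpace_zero : rootSpace 0 = cartan
  e_mem_rootSpace : ∀ i, e i ∈ rootSpace (Pi.single i 1)
  f_mem_rootSpace : ∀ i, f i ∈ rootSpace (-Pi.single i 1)
  /-- a nonzero graded ideal meets the Cartan subalgebra nontrivially -/
  ideal_eq_bot : ∀ J : Submodule ℂ g, (∀ x, ∀ y ∈ J, br x y ∈ J) →
    J ≤ ⨆ a, J ⊓ rootSpace a → J ⊓ cartan = ⊥ → J = ⊥
  cartan_size : (LinearIndependent ℂ coroot ∧ LinearIndependent ℂ root) ∨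
    (LinearIndependent ℂ coroot ∧ Submodule.span ℂ (Set.range coroot) = ⊤) ∨
    (Submodule.span ℂ (Set.range coroot) = ⊤ ∧ ∀ h : cartan, (∀ i, root i h = 0) → h = 0)

namespace Realization

variable {I : Type*} [Fintype I] [DecidableEq I] {C : CartanDatum I}
  {g : Type*} [AddCommGroup g] [Module ℂ g] [LieSuperalgebra g]

/-- `Ad(m_i) = exp(ad e_i) exp(-ad f_i) exp(ad e_i)`. -/
noncomputable def adM (R : Realization C g) (i : I) : Module.End ℂ g :=
  nilExp (br (R.e i)) * nilExp (-br (R.f i)) * nilExp (br (R.e i))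

/-- `Ad(m_{i₁} ⋯ m_{iₖ})` for a word `[i₁, …, iₖ]`. -/
noncomputable def adWord (R : Realization C g) (l : List I) : Module.End ℂ g :=
  (l.map R.adM).prod

/-- `Ad(s)`: multiplication by `s(α)` on the root space of `α`, the identity on the Cartan
subalgebra. -/
noncomputable def adTorus (R : Realization C g) (s : AddChar (I → ℤ) ℂ) : Module.End ℂ g :=
  (DirectSum.toModule ℂ (I → ℤ) g (fun a => s a • (R.rootSpace a).subtype)) ∘ₗ
    (LinearEquiv.ofBijective (DirectSum.coeLinearMap R.rootSpace)
      R.rootSpace_isInternal).symm.toLinearMap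

/-- `ω` is the Chevalley involution. -/
structure IsChevalley (R : Realization C g) (ω : Module.End ℂ g) : Prop where
  isAut : IsAut ω
  map_e : ∀ i, ω (R.e i) = -R.f i
  map_f : ∀ i, ω (R.f i) = -(((-1 : ℂ) ^ (C.p i).val) • R.e i)
  map_cartan : ∀ h : R.cartan, ω (h : g) = -(h : g)

/-- `φ` is an automorphism of `g` induced by the diagram involution `τ`; the last two conditions
concern only the part of the Cartan subalgebra outside the span of the simple coroots. -/
structure IsDiagramAut (R : Realization C g) (τ : Equiv.Perm I) (φ : Module.End ℂ g) : Prop where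
  isAut : IsAut φ
  map_e : ∀ i, φ (R.e i) = if τ i = i then R.e i else ((-1 : ℂ) ^ (C.p i).val) • R.e (τ i)
  map_f : ∀ i, φ (R.f i) = R.f (τ i)
  map_coroot : ∀ i, φ (R.coroot i : g) =
    if τ i = i then (R.coroot i : g) else ((-1 : ℂ) ^ (C.p i).val) • (R.coroot (τ i) : g)
  map_cartan : ∀ h : R.cartan, φ (h : g) ∈ R.cartan
  invol_cartan : ∀ h : R.cartan, φ (φ (h : g)) = h

/-- `θ = Ad(s) ∘ τ ∘ ω ∘ Ad(m_•)`, where `m_•` is given by the word `l`. -/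
noncomputable def theta (R : Realization C g) (s : AddChar (I → ℤ) ℂ)
    (φ ω : Module.End ℂ g) (l : List I) : Module.End ℂ g :=
  R.adTorus s ∘ₗ φ ∘ₗ ω ∘ₗ R.adWord l

end Realization

end SuperSatake

/-! Everything follows from a formula for θ². Put X = τω and m = Ad(m_•). Two facts about the
longest element carry it. First, m² acts on the root space of α by the sign (-1)^{α(2ρ_•^∨)}
(`adWord_mul_self`). Second, m sends e_i to -f_{τi} and f_i to -e_{τi} for black i
(`adWord_longest_e`, `adWord_longest_f`). By the second fact Xm fixes the black Chevalley
generators, so it commutes with every black Ad(m_i), hence with m; cancelling m, X itself commutes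
with m (`comp_mul_adWord`). Since s is trivial on black roots, Ad(s) commutes with m as well, and θ²
becomes X² times the torus element of s · (s∘τ)⁻¹ · (-1)^{2ρ_•^∨} (`theta_mul_self`).

X² is the identity on the Cartan subalgebra and multiplies e_i and f_i by (-1)^{p(i)} ε_i. So θ²
acts by one scalar on both generators of each node (`exists_theta_theta`): 1 at black nodes, 1 at
nodes moved by τ, where the ratio of the values of s cancels the sign of 2ρ_•^∨, and (-1)^{p(i)}
(-1)^{α_i(2ρ_•^∨)} at fixed white nodes. The scalar is always a sign, so θ⁴ = 1. At even fixed white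
nodes integrality of α_i(ρ_•^∨) makes it 1, and the odd ones give the parity criterion. Finally θ ≠
1, because for white i the degree of θ(e_i) has coefficient -1 at τi (`theta_ne_one`).

The two facts about m rest on Tits' theorem that Ad(m_w) does not depend on the reduced word of w,
and on the companion statement that Ad(m_w) e_i = e_j whenever wα_i = α_j. They are proved by one
induction on length (`adWord_reduced`). The exchange and deletion conditions come from positivity of
roots, since Ad(m_i) permutes the root spaces through r_i. A factorization w = uv with v a word in
two letters reduces the companion statement to rank two, where it is an sl₂ computation
(`adWord_alternatingWord`).

The existence of ω and τ is an instance of the isomorphism theorem (`exists_isAut`): in g × g, the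
brackets of pairs (generator, prescribed image) span the graph of an automorphism, because the
kernels of both projections are graded ideals meeting the Cartan subalgebra trivially. For τ one
first needs a compatible involution of the Cartan subalgebra (`exists_cartan_involution`). -/

namespace SuperSatake

open LieSuperalgebra

/-! ### Generation by homogeneous elements -/

section Generation

variable {g : Type*} [AddCommGroup g] [Module ℂ g] [LieSuperalgebra g]

/-- The subset `S` consists of homogeneous elements and generates the Lie superalgebra `g`. -/
structure Generates (S : Set g) : Prop where
  homogeneous : ∀ x ∈ S, ∃ a, x ∈ part (g := g) a
  eq_top : ∀ K : Submodule ℂ g, (∀ x ∈ K, ∀ y ∈ K, br x y ∈ K) → S ⊆ K → K = ⊤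

/-- To show that a subspace is everything it suffices to show that it contains the generators and
that it is closed under brackets of homogeneous elements. -/
theorem Generates.eq_top_of_homogeneous {S : Set g} (hS : Generates S) (P : Submodule ℂ g)
    (hSP : S ⊆ P)
    (hbr : ∀ a b x y, x ∈ part a → y ∈ part b → x ∈ P → y ∈ P → br x y ∈ P) : P = ⊤ := by
  -- `P` need not be graded, and closure is only known for homogeneous brackets, so the largest
  -- graded subspace of `P` is used instead.
  set K : Submodule ℂ g := ⨆ a, P ⊓ part a with hK
  have hKP : K ≤ P := iSup_le fun a => inf_le_left
  have hmem : ∀ a x, x ∈ P → x ∈ part a → x ∈ K := fun a x h1 h2 =>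
    (le_iSup (fun a => P ⊓ part a) a) ⟨h1, h2⟩
  refine top_le_iff.1 ((hS.eq_top K ?_ ?_).ge.trans hKP)
  · intro x hx y hy
    refine Submodule.iSup_induction _ (motive := fun x => br x y ∈ K) hx ?_ (by simp) ?_
    · intro a x hxa
      refine Submodule.iSup_induction _ (motive := fun y => br x y ∈ K) hy ?_ (by simp) ?_
      · intro b y hyb
        exact hmem (a + b) _ (hbr a b x y hxa.2 hyb.2 hxa.1 hyb.1) (br_mem a b x y hxa.2 hyb.2)
      · intro y z hy hz
        rw [map_add]; exact K.add_mem hy hz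
    · intro x z hx hz
      rw [map_add, LinearMap.add_apply]; exact K.add_mem hx hz
  · intro x hx
    obtain ⟨a, ha⟩ := hS.homogeneous x hx
    exact hmem a x (hSP hx) ha

/-- By the super Jacobi identity the elements whose adjoint action preserves `M` are closed under
homogeneous brackets, so testing generators suffices. -/
theorem Generates.br_mem_of_stable {S : Set g} (hS : Generates S) (M : Submodule ℂ g)
    (hM : ∀ x ∈ S, ∀ y ∈ M, br x y ∈ M) (x y : g) (hy : y ∈ M) : br x y ∈ M := by
  let P : Submodule ℂ g :=
    { carrier := {x | ∀ y ∈ M, br x y ∈ M}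
      add_mem' := fun {a b} ha hb y hy => by
        rw [map_add, LinearMap.add_apply]; exact M.add_mem (ha y hy) (hb y hy)
      zero_mem' := fun y _ => by simp
      smul_mem' := fun c x hx y hy => by
        rw [map_smul, LinearMap.smul_apply]; exact M.smul_mem _ (hx y hy) }
  have hP : P = ⊤ := by
    refine hS.eq_top_of_homogeneous P (fun x hx => hM x hx) ?_
    intro a b x y hx hy hxP hyP z hz
    have h := br_jacobi a b x y z hx hy
    rw [← sub_eq_iff_eq_add] at h
    rw [← h]
    exact M.sub_mem (hxP _ (hyP _ hz)) (M.smul_mem _ (hyP _ (hxP _ hz)))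
  have : x ∈ P := hP ▸ Submodule.mem_top
  exact this y hy

end Generation

/-! ### Triangular decomposition for abstract Chevalley operators -/

section Triangular

/-- Operators `E i`, `F i`, `H h` on a space `V` together with vectors `e i`, `f i`, `η h`,
which satisfy the commutation rules of Chevalley generators acting on themselves. -/
structure TriangularSystem {I : Type*} [DecidableEq I] {H : Type*} [AddCommGroup H] [Module ℂ H]
    (root : I → Module.Dual ℂ H) (cE cF : I → H) (κ : I → I → ℂ)
    (V : Type*) [AddCommGroup V] [Module ℂ V] where
  opE : I → Module.End ℂ V
  opF : I → Module.End ℂ V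
  opH : H → Module.End ℂ V
  e : I → V
  f : I → V
  η : H →ₗ[ℂ] V
  H_e : ∀ h i, opH h (e i) = root i h • e i
  H_f : ∀ h i, opH h (f i) = -(root i h • f i)
  H_η : ∀ h k, opH h (η k) = 0
  E_η : ∀ i h, opE i (η h) = -(root i h • e i)
  F_η : ∀ i h, opF i (η h) = root i h • f i
  H_E : ∀ h i x, opH h (opE i x) = opE i (opH h x) + root i h • opE i x
  H_F : ∀ h i x, opH h (opF i x) = opF i (opH h x) - root i h • opF i x
  E_f : ∀ i j, opE i (f j) = if i = j then η (cE i) else 0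
  F_e : ∀ i j, opF i (e j) = if i = j then η (cF i) else 0
  E_F : ∀ i j x, opE i (opF j x) = κ i j • opF j (opE i x) + if i = j then opH (cE i) x else 0
  F_E : ∀ i j x, opF i (opE j x) = κ i j • opE j (opF i x) + if i = j then opH (cF i) x else 0

namespace TriangularSystem

variable {I : Type*} [DecidableEq I] {H : Type*} [AddCommGroup H] [Module ℂ H]
  {root : I → Module.Dual ℂ H} {cE cF : I → H} {κ : I → I → ℂ}
  {V : Type*} [AddCommGroup V] [Module ℂ V] {V' : Type*} [AddCommGroup V'] [Module ℂ V']

/-- Exchange the roles of the `E i` and the `F i`. -/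
def swap (T : TriangularSystem root cE cF κ V) :
    TriangularSystem (fun i => -root i) cF cE κ V where
  opE := T.opF
  opF := T.opE
  opH := T.opH
  e := T.f
  f := T.e
  η := T.η
  H_e h i := by simp [T.H_f]
  H_f h i := by simp [T.H_e]
  H_η := T.H_η
  E_η i h := by simp [T.F_η]
  F_η i h := by simp [T.E_η]
  H_E h i x := by simp [T.H_F, sub_eq_add_neg]
  H_F h i x := by simp [T.H_E]
  E_f := T.F_e
  F_e := T.E_f
  E_F := T.F_E
  F_E := T.E_F

/-- The iterated bracket `E i₁ ⋯ E iₖ (e i)`. -/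
def upperWord (T : TriangularSystem root cE cF κ V) (w : List I × I) : V :=
  (w.1.map T.opE).prod (T.e w.2)

/-- The span of all iterated brackets of the vectors `e i`. -/
def upper (T : TriangularSystem root cE cF κ V) : Submodule ℂ V :=
  Submodule.span ℂ (Set.range T.upperWord)

variable (T : TriangularSystem root cE cF κ V)

theorem e_mem_upper (i : I) : T.e i ∈ T.upper :=
  Submodule.subset_span ⟨([], i), by simp [upperWord]⟩

theorem opE_upperWord (i : I) (w : List I × I) :
    T.opE i (T.upperWord w) = T.upperWord (i :: w.1, w.2) := by
  simp [upperWord]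

theorem opE_mem_upper (i : I) {x : V} (hx : x ∈ T.upper) : T.opE i x ∈ T.upper := by
  have : T.upper ≤ T.upper.comap (T.opE i) := by
    refine Submodule.span_le.2 ?_
    rintro _ ⟨w, rfl⟩
    exact Submodule.subset_span ⟨_, (T.opE_upperWord i w).symm⟩
  exact this hx

theorem opH_upperWord (h : H) (w : List I × I) :
    ∃ c : ℂ, T.opH h (T.upperWord w) = c • T.upperWord w := by
  obtain ⟨l, i⟩ := w
  induction l with
  | nil => exact ⟨root i h, by simp [upperWord, T.H_e]⟩
  | cons j l ih =>
    obtain ⟨c, hc⟩ := ih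
    refine ⟨c + root j h, ?_⟩
    rw [← T.opE_upperWord j (l, i), T.H_E, hc, map_smul, add_smul]

theorem opH_mem_upper (h : H) {x : V} (hx : x ∈ T.upper) : T.opH h x ∈ T.upper := by
  have : T.upper ≤ T.upper.comap (T.opH h) := by
    refine Submodule.span_le.2 ?_
    rintro _ ⟨w, rfl⟩
    obtain ⟨c, hc⟩ := T.opH_upperWord h w
    change T.opH h _ ∈ T.upper
    rw [hc]
    exact T.upper.smul_mem c (Submodule.subset_span ⟨w, rfl⟩)
  exact this hx

theorem opE_η_mem_upper (i : I) (h : H) : T.opE i (T.η h) ∈ T.upper := by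
  rw [T.E_η]
  exact T.upper.neg_mem (T.upper.smul_mem _ (T.e_mem_upper i))

/-- Moving `F i` to the right past each `E k` leaves a Cartan operator, which acts on words by a
scalar; when it reaches the last vector it produces a diagonal element. -/
theorem opF_mem_sup (i : I) {x : V} (hx : x ∈ T.upper) :
    T.opF i x ∈ LinearMap.range T.η ⊔ T.upper := by
  have : T.upper ≤ (LinearMap.range T.η ⊔ T.upper).comap (T.opF i) := by
    refine Submodule.span_le.2 ?_
    rintro _ ⟨⟨l, j⟩, rfl⟩
    change T.opF i _ ∈ LinearMap.range T.η ⊔ T.upper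
    induction l with
    | nil =>
      simp only [upperWord, List.map_nil, List.prod_nil, Module.End.one_apply, T.F_e]
      split_ifs
      · exact Submodule.mem_sup_left ⟨_, rfl⟩
      · exact Submodule.zero_mem _
    | cons k l ih =>
      rw [← T.opE_upperWord k (l, j), T.F_E]
      refine Submodule.add_mem _ (Submodule.smul_mem _ _ (Submodule.mem_sup_right ?_)) ?_
      · obtain ⟨_, ⟨h, rfl⟩, z, hz, hyz⟩ := Submodule.mem_sup.1 ih
        rw [← hyz, map_add]
        exact T.upper.add_mem (T.opE_η_mem_upper k h) (T.opE_mem_upper k hz)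
      · split_ifs
        · exact Submodule.mem_sup_right (T.opH_mem_upper _ (Submodule.subset_span ⟨_, rfl⟩))
        · exact Submodule.zero_mem _
  exact this hx

/-- The sum of the lower, the diagonal and the upper part. -/
def total : Submodule ℂ V := T.swap.upper ⊔ LinearMap.range T.η ⊔ T.upper

theorem total_swap : T.swap.total = T.total := by
  change T.swap.swap.upper ⊔ LinearMap.range T.η ⊔ T.swap.upper =
    T.swap.upper ⊔ LinearMap.range T.η ⊔ T.upper
  rw [sup_comm, ← sup_assoc, sup_right_comm]
  rfl

theorem upper_le_total : T.upper ≤ T.total := le_sup_right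

theorem lower_le_total : T.swap.upper ≤ T.total := le_sup_left.trans le_sup_left

theorem range_le_total : LinearMap.range T.η ≤ T.total := le_sup_right.trans le_sup_left

/-- On the lower part `E i` plays the role of an `F`, so `opF_mem_sup` for the swapped system
applies. -/
theorem opE_mem_total (i : I) {x : V} (hx : x ∈ T.total) : T.opE i x ∈ T.total := by
  obtain ⟨y, hy, z, hz, rfl⟩ := Submodule.mem_sup.1 hx
  obtain ⟨u, hu, _, ⟨h, rfl⟩, rfl⟩ := Submodule.mem_sup.1 hy
  rw [map_add, map_add]
  refine Submodule.add_mem _ (Submodule.add_mem _ ?_ ?_) ?_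
  · have := T.swap.opF_mem_sup i hu
    exact (sup_le T.range_le_total T.lower_le_total) this
  · exact T.upper_le_total (T.opE_η_mem_upper i h)
  · exact T.upper_le_total (T.opE_mem_upper i hz)

theorem opF_mem_total (i : I) {x : V} (hx : x ∈ T.total) : T.opF i x ∈ T.total := by
  rw [← total_swap] at hx ⊢
  exact T.swap.opE_mem_total i hx

theorem opH_mem_total (h : H) {x : V} (hx : x ∈ T.total) : T.opH h x ∈ T.total := by
  obtain ⟨y, hy, z, hz, rfl⟩ := Submodule.mem_sup.1 hx
  obtain ⟨u, hu, _, ⟨k, rfl⟩, rfl⟩ := Submodule.mem_sup.1 hy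
  rw [map_add, map_add, T.H_η]
  refine Submodule.add_mem _ (Submodule.add_mem _ ?_ (Submodule.zero_mem _)) ?_
  · exact T.lower_le_total (T.swap.opH_mem_upper h hu)
  · exact T.upper_le_total (T.opH_mem_upper h hz)

/-- The product of two systems with the same structure constants. -/
def prod (T : TriangularSystem root cE cF κ V) (T' : TriangularSystem root cE cF κ V') :
    TriangularSystem root cE cF κ (V × V') where
  opE i := (T.opE i).prodMap (T'.opE i)
  opF i := (T.opF i).prodMap (T'.opF i)
  opH h := (T.opH h).prodMap (T'.opH h)
  e i := (T.e i, T'.e i)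
  f i := (T.f i, T'.f i)
  η := T.η.prod T'.η
  H_e h i := by simp [T.H_e, T'.H_e]
  H_f h i := by simp [T.H_f, T'.H_f]
  H_η h k := by simp [T.H_η, T'.H_η]
  E_η i h := by simp [T.E_η, T'.E_η]
  F_η i h := by simp [T.F_η, T'.F_η]
  H_E h i x := by simp [T.H_E, T'.H_E]
  H_F h i x := by simp [T.H_F, T'.H_F]
  E_f i j := by by_cases h : i = j <;> simp [T.E_f, T'.E_f, h]
  F_e i j := by by_cases h : i = j <;> simp [T.F_e, T'.F_e, h]
  E_F i j x := by
    have h1 := T.E_F i j x.1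
    have h2 := T'.E_F i j x.2
    by_cases h : i = j
    · rw [if_pos h] at h1 h2 ⊢
      exact Prod.ext h1 h2
    · rw [if_neg h] at h1 h2 ⊢
      exact Prod.ext h1 h2
  F_E i j x := by
    have h1 := T.F_E i j x.1
    have h2 := T'.F_E i j x.2
    by_cases h : i = j
    · rw [if_pos h] at h1 h2 ⊢
      exact Prod.ext h1 h2
    · rw [if_neg h] at h1 h2 ⊢
      exact Prod.ext h1 h2

/-- The degree of an iterated bracket in the root lattice. -/
def deg (w : List I × I) : I → ℤ :=
  (w.1.map fun i => Pi.single i (1 : ℤ)).sum + Pi.single w.2 1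

theorem deg_cons (i : I) (w : List I × I) : deg (i :: w.1, w.2) = Pi.single i 1 + deg w := by
  simp [deg, add_assoc]

theorem deg_nonneg (w : List I × I) : 0 ≤ deg w := by
  obtain ⟨l, i⟩ := w
  induction l with
  | nil => simp [deg]
  | cons j l ih =>
    rw [deg_cons j (l, i)]
    exact add_nonneg (by simp) ih

theorem sum_deg [Fintype I] (w : List I × I) : ∑ j, deg w j = w.1.length + 1 := by
  obtain ⟨l, i⟩ := w
  induction l with
  | nil => simp [deg]
  | cons j l ih =>
    have := deg_cons j (l, i)
    dsimp only at this ih ⊢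
    simp only [this, Pi.add_apply, Finset.sum_add_distrib, ih]
    simp
    ring

/-- This separates upper and lower words from the Cartan part in any grading. -/
theorem deg_ne_zero [Fintype I] (w : List I × I) : deg w ≠ 0 := by
  intro h
  have := sum_deg w
  rw [h] at this
  simp at this
  omega

theorem upperWord_mem (G : (I → ℤ) → Submodule ℂ V)
    (he : ∀ i, T.e i ∈ G (Pi.single i 1))
    (hE : ∀ i a x, x ∈ G a → T.opE i x ∈ G (Pi.single i 1 + a)) (w : List I × I) :
    T.upperWord w ∈ G (deg w) := by
  obtain ⟨l, i⟩ := w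
  induction l with
  | nil => simpa [upperWord, deg] using he i
  | cons j l ih =>
    rw [deg_cons j (l, i), ← T.opE_upperWord j (l, i)]
    exact hE j _ _ ih

end TriangularSystem

end Triangular

end SuperSatake

namespace SuperSatake

open LieSuperalgebra

/-! ### Systems of Chevalley generators in a realization -/

namespace Realization

variable {I : Type*} [Fintype I] [DecidableEq I] {C : CartanDatum I}
  {g : Type*} [AddCommGroup g] [Module ℂ g] [LieSuperalgebra g]

/-- The Chevalley generators together with the Cartan subalgebra. -/
def generators (R : Realization C g) : Set g :=
  {x | x ∈ R.cartan ∨ (∃ i, x = R.e i) ∨ ∃ i, x = R.f i}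

theorem generates (R : Realization C g) : Generates R.generators where
  homogeneous := by
    rintro x (hx | ⟨i, rfl⟩ | ⟨i, rfl⟩)
    · exact ⟨0, R.cartan_even hx⟩
    · exact ⟨_, R.e_mem i⟩
    · exact ⟨_, R.f_mem i⟩
  eq_top K hK hS := R.generated K hK (fun x hx => hS (Or.inl hx))
    (fun i => hS (Or.inr (Or.inl ⟨i, rfl⟩))) (fun i => hS (Or.inr (Or.inr ⟨i, rfl⟩)))

/-- A second system of Chevalley generators, graded by means of the endomorphism `π` of the root
lattice. -/
structure IsGeneratorSystem (R : Realization C g) (e f : I → g) (η : R.cartan →ₗ[ℂ] g)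
    (π : (I → ℤ) →+ (I → ℤ)) : Prop where
  π_injective : Function.Injective π
  η_injective : Function.Injective η
  η_mem : ∀ h, η h ∈ R.cartan
  e_mem : ∀ i, e i ∈ part (C.p i)
  f_mem : ∀ i, f i ∈ part (C.p i)
  η_e : ∀ h i, br (η h) (e i) = R.root i h • e i
  η_f : ∀ h i, br (η h) (f i) = -(R.root i h • f i)
  e_f : ∀ i j, br (e i) (f j) = if i = j then η (R.coroot i) else 0
  e_mem_rootSpace : ∀ i, e i ∈ R.rootSpace (π (Pi.single i 1))
  f_mem_rootSpace : ∀ i, f i ∈ R.rootSpace (π (-Pi.single i 1))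
  generates : Generates {x : g | (∃ h, x = η h) ∨ (∃ i, x = e i) ∨ ∃ i, x = f i}

theorem isGeneratorSystem_self (R : Realization C g) :
    R.IsGeneratorSystem R.e R.f R.cartan.subtype (AddMonoidHom.id _) where
  π_injective := Function.injective_id
  η_injective := R.cartan.injective_subtype
  η_mem h := h.2
  e_mem := R.e_mem
  f_mem := R.f_mem
  η_e := R.cartan_e
  η_f := R.cartan_f
  e_f := R.e_f
  e_mem_rootSpace := R.e_mem_rootSpace
  f_mem_rootSpace := R.f_mem_rootSpace
  generates := by
    convert R.generates using 1
    ext x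
    simp [generators]

theorem br_swap_of_even (x y : g) (a : ZMod 2) (hx : x ∈ part 0) (hy : y ∈ part a) :
    br y x = -br x y := by
  simpa using br_skew a 0 y x hy hx

/-- The Chevalley generators acting on `g`. -/
noncomputable def IsGeneratorSystem.system {R : Realization C g} {e f : I → g}
    {η : R.cartan →ₗ[ℂ] g} {π : (I → ℤ) →+ (I → ℤ)} (S : R.IsGeneratorSystem e f η π) :
    TriangularSystem R.root R.coroot
      (fun i => -((-1 : ℂ) ^ ((C.p i).val * (C.p i).val)) • R.coroot i)
      (fun i j => (-1 : ℂ) ^ ((C.p i).val * (C.p j).val)) g where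
  opE i := br (e i)
  opF i := br (f i)
  opH h := br (η h)
  e := e
  f := f
  η := η
  H_e := S.η_e
  H_f := S.η_f
  H_η h k := R.cartan_comm ⟨_, S.η_mem h⟩ ⟨_, S.η_mem k⟩
  E_η i h := by
    rw [br_swap_of_even _ _ _ (R.cartan_even (S.η_mem h)) (S.e_mem i), S.η_e]
  F_η i h := by
    rw [br_swap_of_even _ _ _ (R.cartan_even (S.η_mem h)) (S.f_mem i), S.η_f, neg_neg]
  H_E h i x := by
    have := br_jacobi 0 _ (η h) (e i) x (R.cartan_even (S.η_mem h)) (S.e_mem i)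
    rw [this, S.η_e]
    simp [add_comm]
  H_F h i x := by
    have := br_jacobi 0 _ (η h) (f i) x (R.cartan_even (S.η_mem h)) (S.f_mem i)
    rw [this, S.η_f]
    simp [sub_eq_add_neg, add_comm]
  E_f := S.e_f
  -- Super skew-symmetry turns [e_i, f_i] = η(h_i) into [f_i, e_i] = -(-1)^{p(i)p(i)} η(h_i), which
  -- is where the coefficient of the lower coroots comes from.
  F_e i j := by
    rw [br_skew _ _ _ _ (S.f_mem i) (S.e_mem j), S.e_f]
    by_cases h : i = j
    · subst h; simp
    · simp [h, Ne.symm h]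
  E_F i j x := by
    rw [br_jacobi _ _ _ _ x (S.e_mem i) (S.f_mem j), S.e_f, add_comm]
    by_cases h : i = j
    · subst h; simp
    · simp [h]
  F_E i j x := by
    rw [br_jacobi _ _ _ _ x (S.f_mem i) (S.e_mem j), br_skew _ _ _ _ (S.f_mem i) (S.e_mem j),
      S.e_f, add_comm]
    by_cases h : i = j
    · subst h; simp
    · simp [h, Ne.symm h]

variable (R : Realization C g)

theorem iSupIndep_rootSpace : iSupIndep R.rootSpace :=
  (DirectSum.isInternal_submodule_iff_iSupIndep_and_iSup_eq_top _).1 R.rootSpace_isInternal |>.1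

theorem iSup_rootSpace : ⨆ a, R.rootSpace a = ⊤ :=
  (DirectSum.isInternal_submodule_iff_iSupIndep_and_iSup_eq_top _).1 R.rootSpace_isInternal |>.2

/-- A subspace closed under the action of the generators which contains them is everything. -/
theorem eq_top_of_stable (M : Submodule ℂ g) (hS : R.generators ⊆ M)
    (hM : ∀ x ∈ R.generators, ∀ y ∈ M, br x y ∈ M) : M = ⊤ :=
  R.generates.eq_top M (fun x _ y hy => R.generates.br_mem_of_stable M hM x y hy) hS

/-- The triangular decomposition of `g`: the total contains the generators and is stable under them.
-/
theorem total_eq_top : R.isGeneratorSystem_self.system.total = ⊤ := by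
  set T := R.isGeneratorSystem_self.system
  apply R.eq_top_of_stable
  · rintro x (hx | ⟨i, rfl⟩ | ⟨i, rfl⟩)
    · exact T.range_le_total ⟨⟨x, hx⟩, rfl⟩
    · exact T.upper_le_total (T.e_mem_upper i)
    · exact T.lower_le_total (T.swap.e_mem_upper i)
  · rintro x (hx | ⟨i, rfl⟩ | ⟨i, rfl⟩) y hy
    · exact T.opH_mem_total ⟨x, hx⟩ hy
    · exact T.opE_mem_total i hy
    · exact T.opF_mem_total i hy

end Realization

/-! ### Gradings of a product -/

section Graded

variable {ι V W : Type*} [AddCommGroup V] [Module ℂ V] [AddCommGroup W] [Module ℂ W]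

theorem iSupIndep_prod {p : ι → Submodule ℂ V} {q : ι → Submodule ℂ W}
    (hp : iSupIndep p) (hq : iSupIndep q) : iSupIndep fun a => (p a).prod (q a) := by
  intro a
  rw [Submodule.disjoint_def]
  rintro ⟨x, y⟩ hxy h
  have h1 : (⨆ b, ⨆ (_ : b ≠ a), (p b).prod (q b)) ≤
      (⨆ b, ⨆ (_ : b ≠ a), p b).prod (⨆ b, ⨆ (_ : b ≠ a), q b) := by
    refine iSup₂_le fun b hb => ?_
    exact Submodule.prod_mono (le_iSup₂_of_le b hb le_rfl) (le_iSup₂_of_le b hb le_rfl)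
  have h2 := h1 h
  have hx := Submodule.disjoint_def.1 (hp a) x hxy.1 h2.1
  have hy := Submodule.disjoint_def.1 (hq a) y hxy.2 h2.2
  simp [hx, hy]

/-- The second components of elements with vanishing first component form a graded subspace. -/
theorem comap_inr_le_iSup {p : ι → Submodule ℂ V} {q : ι → Submodule ℂ W} (hp : iSupIndep p)
    (K : Submodule ℂ (V × W)) (hK : K ≤ ⨆ a, K ⊓ (p a).prod (q a)) :
    K.comap (LinearMap.inr ℂ V W) ≤ ⨆ a, K.comap (LinearMap.inr ℂ V W) ⊓ q a := by
  classical
  intro y hy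
  obtain ⟨z, hz⟩ := (Submodule.mem_iSup_iff_exists_dfinsupp _ _).1 (hK hy)
  have hz' : ∑ a ∈ z.support, (z a : V × W) = (0, y) := by
    rw [DFinsupp.lsum_apply_apply, DFinsupp.sumAddHom_apply] at hz
    exact hz
  have h1 : ∑ a ∈ z.support, (z a : V × W).1 = 0 := by
    rw [← Prod.fst_sum, hz']
  have h2 : ∑ a ∈ z.support, (z a : V × W).2 = y := by
    rw [← Prod.snd_sum, hz']
  -- The first components add up to zero, so independence makes each homogeneous one vanish
  -- separately.
  have h3 := (iSupIndep_iff_finsetSum_eq_zero_imp_eq_zero p).1 hp z.support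
    (fun a => (z a : V × W).1) (fun a _ => (z a).2.2.1) h1
  rw [← h2]
  refine Submodule.sum_mem _ fun a ha => Submodule.mem_iSup_of_mem a ⟨?_, (z a).2.2.2⟩
  have : (0, (z a : V × W).2) = (z a : V × W) := Prod.ext (h3 a ha).symm rfl
  change (0, (z a : V × W).2) ∈ K
  rw [this]
  exact (z a).2.1

/-- The first components of elements with vanishing second component form a graded subspace. -/
theorem comap_inl_le_iSup {p : ι → Submodule ℂ V} {q : ι → Submodule ℂ W} (hq : iSupIndep q)
    (K : Submodule ℂ (V × W)) (hK : K ≤ ⨆ a, K ⊓ (p a).prod (q a)) :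
    K.comap (LinearMap.inl ℂ V W) ≤ ⨆ a, K.comap (LinearMap.inl ℂ V W) ⊓ p a := by
  classical
  intro y hy
  obtain ⟨z, hz⟩ := (Submodule.mem_iSup_iff_exists_dfinsupp _ _).1 (hK hy)
  have hz' : ∑ a ∈ z.support, (z a : V × W) = (y, 0) := by
    rw [DFinsupp.lsum_apply_apply, DFinsupp.sumAddHom_apply] at hz
    exact hz
  have h1 : ∑ a ∈ z.support, (z a : V × W).2 = 0 := by
    rw [← Prod.snd_sum, hz']
  have h2 : ∑ a ∈ z.support, (z a : V × W).1 = y := by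
    rw [← Prod.fst_sum, hz']
  have h3 := (iSupIndep_iff_finsetSum_eq_zero_imp_eq_zero q).1 hq z.support
    (fun a => (z a : V × W).2) (fun a _ => (z a).2.2.2) h1
  rw [← h2]
  refine Submodule.sum_mem _ fun a ha => Submodule.mem_iSup_of_mem a ⟨?_, (z a).2.2.1⟩
  have : ((z a : V × W).1, 0) = (z a : V × W) := Prod.ext rfl (h3 a ha).symm
  change ((z a : V × W).1, 0) ∈ K
  rw [this]
  exact (z a).2.1

end Graded

end SuperSatake

/-! ### The isomorphism theorem -/

namespace SuperSatake

open LieSuperalgebra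

/-- The pieces of an independent family cannot shrink and still span. This converts a generation
argument, which only shows that good elements span, into a statement about every element of each
graded piece. -/
theorem eq_of_le_of_iSup_eq_top {ι V : Type*} [AddCommGroup V] [Module ℂ V]
    {p q : ι → Submodule ℂ V} (hp : iSupIndep p) (hqp : ∀ a, q a ≤ p a) (hq : ⨆ a, q a = ⊤)
    (a : ι) : q a = p a := by
  refine le_antisymm (hqp a) fun x hx => ?_
  have h1 : x ∈ q a ⊔ ⨆ b, ⨆ (_ : b ≠ a), q b := by
    have : (⊤ : Submodule ℂ V) ≤ q a ⊔ ⨆ b, ⨆ (_ : b ≠ a), q b := by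
      rw [← hq]
      refine iSup_le fun b => ?_
      by_cases hb : b = a
      · subst hb; exact le_sup_left
      · exact (le_iSup₂ (f := fun b (_ : b ≠ a) => q b) b hb).trans le_sup_right
    exact this Submodule.mem_top
  obtain ⟨y, hy, z, hz, rfl⟩ := Submodule.mem_sup.1 h1
  have hz1 : z ∈ p a := by simpa using (p a).sub_mem hx (hqp a hy)
  have hz2 : z ∈ ⨆ b, ⨆ (_ : b ≠ a), p b := (iSup₂_mono fun b _ => hqp b) hz
  have := Submodule.disjoint_def.1 (hp a) z hz1 hz2
  rw [this, add_zero]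
  exact hy

theorem iSupIndep_part {g : Type*} [AddCommGroup g] [Module ℂ g] [LieSuperalgebra g] :
    iSupIndep (part (g := g)) :=
  (DirectSum.isInternal_submodule_iff_iSupIndep_and_iSup_eq_top _).1 part_isInternal |>.1

/-- A subspace spanned by the pieces of a multiplicatively closed family is closed under `br`. -/
theorem br_mem_iSup {g : Type*} [AddCommGroup g] [Module ℂ g] [LieSuperalgebra g]
    {ι : Type*} [Add ι] {Q : ι → Submodule ℂ g}
    (hQ : ∀ a b x y, x ∈ Q a → y ∈ Q b → br x y ∈ Q (a + b)) {x y : g}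
    (hx : x ∈ ⨆ a, Q a) (hy : y ∈ ⨆ a, Q a) : br x y ∈ ⨆ a, Q a := by
  refine Submodule.iSup_induction _ (motive := fun x => br x y ∈ ⨆ a, Q a) hx ?_ (by simp) ?_
  · intro a x hxa
    refine Submodule.iSup_induction _ (motive := fun y => br x y ∈ ⨆ a, Q a) hy ?_ (by simp) ?_
    · intro b y hyb
      exact Submodule.mem_iSup_of_mem (a + b) (hQ a b x y hxa hyb)
    · intro y z hy hz
      rw [map_add]; exact Submodule.add_mem _ hy hz
  · intro x z hx hz
    rw [map_add, LinearMap.add_apply]; exact Submodule.add_mem _ hx hz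

/-- An even linear map compatible with the action of the generators is compatible with the
bracket. -/
theorem Generates.map_br_of_generators {g : Type*} [AddCommGroup g] [Module ℂ g]
    [LieSuperalgebra g] {S : Set g} (hS : Generates S) (ψ : Module.End ℂ g)
    (heven : ∀ x ∈ S, ∃ a, x ∈ part a ∧ ψ x ∈ part a)
    (hbr : ∀ x ∈ S, ∀ z, ψ (br x z) = br (ψ x) (ψ z)) :
    (∀ (a : ZMod 2) (x : g), x ∈ part a → ψ x ∈ part a) ∧
      ∀ x z, ψ (br x z) = br (ψ x) (ψ z) := by
  let P : Submodule ℂ g :=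
    { carrier := {x | ∀ z, ψ (br x z) = br (ψ x) (ψ z)}
      add_mem' := fun {a b} ha hb z => by
        simp only [map_add, LinearMap.add_apply, ha z, hb z]
      zero_mem' := fun z => by simp
      smul_mem' := fun c x hx z => by
        simp only [map_smul, LinearMap.smul_apply, hx z] }
  -- The Jacobi identities for `x, y` and for their images carry the same signs only if `ψ` keeps
  -- parities, so evenness and multiplicativity are propagated together.
  let Q : ZMod 2 → Submodule ℂ g := fun a => part a ⊓ (part a).comap ψ ⊓ P
  have hQ : ⨆ a, Q a = ⊤ := by
    refine hS.eq_top _ (fun x hx y hy => br_mem_iSup ?_ hx hy) ?_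
    · rintro a b x y ⟨⟨hx1, hx2⟩, hx3⟩ ⟨⟨hy1, hy2⟩, hy3⟩
      refine ⟨⟨br_mem a b x y hx1 hy1, ?_⟩, fun z => ?_⟩
      · change ψ (br x y) ∈ part (a + b)
        rw [hx3 y]
        exact br_mem a b _ _ hx2 hy2
      · have h1 := br_jacobi a b x y z hx1 hy1
        have h2 := br_jacobi a b (ψ x) (ψ y) (ψ z) hx2 hy2
        rw [← sub_eq_iff_eq_add] at h1 h2
        rw [← h1, hx3 y, ← h2, map_sub, map_smul, hx3, hy3, hy3, hx3]
    · intro x hx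
      obtain ⟨a, ha1, ha2⟩ := heven x hx
      exact Submodule.mem_iSup_of_mem a ⟨⟨ha1, ha2⟩, hbr x hx⟩
  constructor
  · intro a x hx
    rw [← eq_of_le_of_iSup_eq_top iSupIndep_part (fun a => inf_le_left.trans inf_le_left) hQ a]
      at hx
    exact hx.1.2
  · intro x
    have : (⊤ : Submodule ℂ g) ≤ P := by
      rw [← hQ]
      exact iSup_le fun a => inf_le_right
    exact this (Submodule.mem_top (x := x))

namespace Realization

variable {I : Type*} [Fintype I] [DecidableEq I] {C : CartanDatum I}
  {g : Type*} [AddCommGroup g] [Module ℂ g] [LieSuperalgebra g]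
  {R : Realization C g} {e f : I → g} {η : R.cartan →ₗ[ℂ] g} {π : (I → ℤ) →+ (I → ℤ)}

namespace IsGeneratorSystem

/-- Both systems of generators acting on `g × g`. -/
noncomputable abbrev pair (S : R.IsGeneratorSystem e f η π) :=
  R.isGeneratorSystem_self.system.prod S.system

variable (R π) in
/-- The grading of `g × g` by the root lattice. -/
def grading (a : I → ℤ) : Submodule ℂ (g × g) := (R.rootSpace a).prod (R.rootSpace (π a))

variable (S : R.IsGeneratorSystem e f η π)
include S

theorem iSupIndep_grading : iSupIndep (grading R π) :=
  iSupIndep_prod R.iSupIndep_rootSpace (R.iSupIndep_rootSpace.comp S.π_injective)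

theorem upper_le : S.pair.upper ≤
    ⨆ a, ⨆ (_ : a ≠ 0), S.pair.total ⊓ grading R π a := by
  refine Submodule.span_le.2 ?_
  rintro _ ⟨w, rfl⟩
  refine Submodule.mem_iSup_of_mem _ (Submodule.mem_iSup_of_mem
    (TriangularSystem.deg_ne_zero w) ⟨?_, ?_⟩)
  · exact S.pair.upper_le_total (Submodule.subset_span ⟨w, rfl⟩)
  · refine S.pair.upperWord_mem (grading R π) (fun i => ?_) (fun i a x hx => ?_) w
    · exact ⟨R.e_mem_rootSpace i, S.e_mem_rootSpace i⟩
    · refine ⟨R.rootSpace_br _ _ _ _ (R.e_mem_rootSpace i) hx.1, ?_⟩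
      change _ ∈ R.rootSpace (π _)
      rw [map_add]
      exact R.rootSpace_br _ _ _ _ (S.e_mem_rootSpace i) hx.2

theorem lower_le : S.pair.swap.upper ≤
    ⨆ a, ⨆ (_ : a ≠ 0), S.pair.total ⊓ grading R π a := by
  refine Submodule.span_le.2 ?_
  rintro _ ⟨w, rfl⟩
  refine Submodule.mem_iSup_of_mem (-TriangularSystem.deg w) (Submodule.mem_iSup_of_mem
    (neg_ne_zero.2 (TriangularSystem.deg_ne_zero w)) ⟨?_, ?_⟩)
  · exact S.pair.lower_le_total (Submodule.subset_span ⟨w, rfl⟩)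
  · refine S.pair.swap.upperWord_mem (fun a => grading R π (-a)) (fun i => ?_)
      (fun i a x hx => ?_) w
    · exact ⟨R.f_mem_rootSpace i, S.f_mem_rootSpace i⟩
    · rw [neg_add]
      refine ⟨R.rootSpace_br _ _ _ _ (R.f_mem_rootSpace i) hx.1, ?_⟩
      change _ ∈ R.rootSpace (π _)
      rw [map_add]
      exact R.rootSpace_br _ _ _ _ (S.f_mem_rootSpace i) hx.2

theorem range_le : LinearMap.range S.pair.η ≤ grading R π 0 := by
  rintro _ ⟨h, rfl⟩
  refine ⟨?_, ?_⟩
  · rw [R.rootSpace_zero]; exact h.2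
  · change _ ∈ R.rootSpace (π 0)
    rw [map_zero, R.rootSpace_zero]; exact S.η_mem h

theorem total_le : S.pair.total ≤ ⨆ a, S.pair.total ⊓ grading R π a := by
  refine sup_le (sup_le ?_ ?_) ?_
  · exact S.lower_le.trans (iSup₂_le_iSup _ _)
  · exact (le_inf S.pair.range_le_total S.range_le).trans
      (le_iSup (fun a => S.pair.total ⊓ grading R π a) 0)
  · exact S.upper_le.trans (iSup₂_le_iSup _ _)

/-- Upper and lower words have nonzero degree, so by independence of the grading only the pairs `(h,
η h)` remain in degree zero. -/
theorem total_inf_le : S.pair.total ⊓ grading R π 0 ≤ LinearMap.range S.pair.η := by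
  rintro z ⟨hz, hz0⟩
  obtain ⟨y, hy, v, hv, rfl⟩ := Submodule.mem_sup.1 hz
  obtain ⟨u, hu, k, hk, rfl⟩ := Submodule.mem_sup.1 hy
  have h1 : u + v ∈ ⨆ a, ⨆ (_ : a ≠ 0), grading R π a :=
    
    have h : (⨆ a, ⨆ (_ : a ≠ 0), S.pair.total ⊓ grading R π a) ≤
        ⨆ a, ⨆ (_ : a ≠ 0), grading R π a := iSup₂_mono fun _ _ => inf_le_right
    h (Submodule.add_mem _ (S.lower_le hu) (S.upper_le hv))
  have h2 : u + v ∈ grading R π 0 := by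
    have := Submodule.sub_mem _ hz0 (S.range_le hk)
    rwa [show u + k + v - k = u + v by abel] at this
  have h3 := Submodule.disjoint_def.1 (S.iSupIndep_grading 0) _ h2 h1
  rw [show u + k + v = (u + v) + k by abel, h3, zero_add]
  exact hk

theorem map_fst : S.pair.total.map (LinearMap.fst ℂ g g) = ⊤ := by
  apply R.eq_top_of_stable
  · rintro x (hx | ⟨i, rfl⟩ | ⟨i, rfl⟩)
    · exact ⟨_, S.pair.range_le_total ⟨⟨x, hx⟩, rfl⟩, rfl⟩
    · exact ⟨_, S.pair.upper_le_total (S.pair.e_mem_upper i), rfl⟩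
    · exact ⟨_, S.pair.lower_le_total (S.pair.swap.e_mem_upper i), rfl⟩
  · rintro x (hx | ⟨i, rfl⟩ | ⟨i, rfl⟩) _ ⟨z, hz, rfl⟩
    · exact ⟨_, S.pair.opH_mem_total ⟨x, hx⟩ hz, rfl⟩
    · exact ⟨_, S.pair.opE_mem_total i hz, rfl⟩
    · exact ⟨_, S.pair.opF_mem_total i hz, rfl⟩

/-- This is the kernel of the first projection. It is an ideal because the second system generates
`g`, it is graded, and in degree zero `(h, η h)` with `h = 0` vanishes; so the absence of
superfluous ideals kills it. -/
theorem comap_inr : S.pair.total.comap (LinearMap.inr ℂ g g) = ⊥ := by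
  apply R.ideal_eq_bot
  · intro x y hy
    refine S.generates.br_mem_of_stable _ ?_ x y hy
    rintro x (⟨h, rfl⟩ | ⟨i, rfl⟩ | ⟨i, rfl⟩) y hy
    · have := S.pair.opH_mem_total h hy
      rwa [show S.pair.opH h (LinearMap.inr ℂ g g y) = LinearMap.inr ℂ g g (br (η h) y) from
        Prod.ext (LinearMap.map_zero _) rfl] at this
    · have := S.pair.opE_mem_total i hy
      rwa [show S.pair.opE i (LinearMap.inr ℂ g g y) = LinearMap.inr ℂ g g (br (e i) y) from
        Prod.ext (LinearMap.map_zero _) rfl] at this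
    · have := S.pair.opF_mem_total i hy
      rwa [show S.pair.opF i (LinearMap.inr ℂ g g y) = LinearMap.inr ℂ g g (br (f i) y) from
        Prod.ext (LinearMap.map_zero _) rfl] at this
  · refine (comap_inr_le_iSup R.iSupIndep_rootSpace _ S.total_le).trans ?_
    exact iSup_le fun a =>
      le_iSup (fun b => S.pair.total.comap (LinearMap.inr ℂ g g) ⊓ R.rootSpace b) (π a)
  · rw [eq_bot_iff]
    rintro y ⟨hy, hy'⟩
    have h0 : LinearMap.inr ℂ g g y ∈ grading R π 0 := by
      refine ⟨Submodule.zero_mem _, ?_⟩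
      change y ∈ R.rootSpace (π 0)
      rw [map_zero, R.rootSpace_zero]; exact hy'
    obtain ⟨h, hh⟩ := S.total_inf_le ⟨hy, h0⟩
    have h1 : (h : g) = 0 := congrArg Prod.fst hh
    have h2 : η h = y := congrArg Prod.snd hh
    rw [← h2, show h = 0 from Subtype.ext h1, map_zero]
    exact Submodule.zero_mem _

/-- The mirror image: injectivity of `π` makes the second grading independent, and injectivity of
`η` settles degree zero. -/
theorem comap_inl : S.pair.total.comap (LinearMap.inl ℂ g g) = ⊥ := by
  apply R.ideal_eq_bot
  · intro x y hy
    refine R.generates.br_mem_of_stable _ ?_ x y hy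
    rintro x (hx | ⟨i, rfl⟩ | ⟨i, rfl⟩) y hy
    · have := S.pair.opH_mem_total ⟨x, hx⟩ hy
      rwa [show S.pair.opH ⟨x, hx⟩ (LinearMap.inl ℂ g g y) = LinearMap.inl ℂ g g (br x y) from
        Prod.ext rfl (LinearMap.map_zero _)] at this
    · have := S.pair.opE_mem_total i hy
      rwa [show S.pair.opE i (LinearMap.inl ℂ g g y) = LinearMap.inl ℂ g g (br (R.e i) y) from
        Prod.ext rfl (LinearMap.map_zero _)] at this
    · have := S.pair.opF_mem_total i hy
      rwa [show S.pair.opF i (LinearMap.inl ℂ g g y) = LinearMap.inl ℂ g g (br (R.f i) y) from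
        Prod.ext rfl (LinearMap.map_zero _)] at this
  · exact comap_inl_le_iSup (R.iSupIndep_rootSpace.comp S.π_injective) _ S.total_le
  · rw [eq_bot_iff]
    rintro y ⟨hy, hy'⟩
    have h0 : LinearMap.inl ℂ g g y ∈ grading R π 0 := by
      refine ⟨?_, Submodule.zero_mem _⟩
      change y ∈ R.rootSpace 0
      rw [R.rootSpace_zero]; exact hy'
    obtain ⟨h, hh⟩ := S.total_inf_le ⟨hy, h0⟩
    have h1 : (h : g) = y := congrArg Prod.fst hh
    have h2 : η h = η 0 := (congrArg Prod.snd hh).trans (map_zero η).symm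
    rw [← h1, S.η_injective h2]
    exact Submodule.zero_mem _

/-- The isomorphism theorem: a second system of Chevalley generators is the image of the given one
under an automorphism. -/
theorem exists_isAut : ∃ ψ : Module.End ℂ g, IsAut ψ ∧ (∀ i, ψ (R.e i) = e i) ∧
    (∀ i, ψ (R.f i) = f i) ∧ ∀ h : R.cartan, ψ h = η h := by
  -- `K` is the graph of the automorphism; compatibility with the bracket is its stability under the
  -- paired generators.
  set K := S.pair.total with hK
  have hinj : Function.Injective ((LinearMap.fst ℂ g g).domRestrict K) := by
    rw [← LinearMap.ker_eq_bot, eq_bot_iff]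
    rintro ⟨⟨x, y⟩, hz⟩ hx
    have hx : x = 0 := hx
    subst hx
    have : y ∈ K.comap (LinearMap.inr ℂ g g) := hz
    rw [S.comap_inr] at this
    have hy : y = 0 := this
    subst hy
    rfl
  have hsurj : Function.Surjective ((LinearMap.fst ℂ g g).domRestrict K) := by
    intro x
    have : x ∈ K.map (LinearMap.fst ℂ g g) := S.map_fst ▸ Submodule.mem_top
    obtain ⟨z, hz, rfl⟩ := this
    exact ⟨⟨z, hz⟩, rfl⟩
  let E := LinearEquiv.ofBijective _ ⟨hinj, hsurj⟩
  let ψ : Module.End ℂ g := LinearMap.snd ℂ g g ∘ₗ K.subtype ∘ₗ E.symm.toLinearMap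
  have hψ : ∀ x y, (x, y) ∈ K → ψ x = y := by
    intro x y hxy
    have : E.symm x = ⟨(x, y), hxy⟩ := (LinearEquiv.symm_apply_eq E).2 rfl
    change (E.symm x : g × g).2 = y
    rw [this]
  have hψ' : ∀ x, (x, ψ x) ∈ K := by
    intro x
    obtain ⟨z, hz⟩ := hsurj x
    have h1 : (x, (z : g × g).2) ∈ K := by
      rw [← hz]; exact z.2
    rw [hψ x _ h1]
    exact h1
  have he : ∀ i, ψ (R.e i) = e i := fun i => hψ _ _ (S.pair.upper_le_total (S.pair.e_mem_upper i))
  have hf : ∀ i, ψ (R.f i) = f i := fun i =>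
    hψ _ _ (S.pair.lower_le_total (S.pair.swap.e_mem_upper i))
  have hh : ∀ h : R.cartan, ψ h = η h := fun h => hψ _ _ (S.pair.range_le_total ⟨h, rfl⟩)
  have hmap := R.generates.map_br_of_generators ψ (by
    rintro x (hx | ⟨i, rfl⟩ | ⟨i, rfl⟩)
    · exact ⟨0, R.cartan_even hx, by rw [hh ⟨x, hx⟩]; exact R.cartan_even (S.η_mem _)⟩
    · exact ⟨_, R.e_mem i, by rw [he]; exact S.e_mem i⟩
    · exact ⟨_, R.f_mem i, by rw [hf]; exact S.f_mem i⟩) (by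
    rintro x (hx | ⟨i, rfl⟩ | ⟨i, rfl⟩) z
    · rw [hh ⟨x, hx⟩]
      exact hψ _ _ (S.pair.opH_mem_total ⟨x, hx⟩ (hψ' z))
    · rw [he]
      exact hψ _ _ (S.pair.opE_mem_total i (hψ' z))
    · rw [hf]
      exact hψ _ _ (S.pair.opF_mem_total i (hψ' z)))
  refine ⟨ψ, ⟨⟨?_, ?_⟩, hmap.1, hmap.2⟩, he, hf, hh⟩
  · rw [← LinearMap.ker_eq_bot, eq_bot_iff]
    intro x hx
    have h1 := hψ' x
    rw [show ψ x = 0 from hx] at h1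
    have h2 : x ∈ K.comap (LinearMap.inl ℂ g g) := h1
    rwa [S.comap_inl] at h2
  · rw [← LinearMap.range_eq_top]
    refine S.generates.eq_top _ ?_ ?_
    · rintro _ ⟨x, rfl⟩ _ ⟨y, rfl⟩
      exact ⟨_, hmap.2 x y⟩
    · rintro x (⟨h, rfl⟩ | ⟨i, rfl⟩ | ⟨i, rfl⟩)
      · exact ⟨_, hh h⟩
      · exact ⟨_, he i⟩
      · exact ⟨_, hf i⟩

end IsGeneratorSystem

end Realization

end SuperSatake

namespace SuperSatake

open LieSuperalgebra

/-! ### Linear algebra for involutions of the Cartan subalgebra -/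

section LinearAlgebra

/-- An involution with prescribed `±1`-eigenvectors which is compatible with prescribed
bounds for its eigenspaces. -/
theorem exists_involution {W : Type*} [AddCommGroup W] [Module ℂ W]
    {P M KP KM : Submodule ℂ W} (hP : P ≤ KP) (hM : M ≤ KM) (hPM : Disjoint P M)
    (hK : KP ⊔ KM = ⊤) :
    ∃ σ : W →ₗ[ℂ] W, (∀ x ∈ P, σ x = x) ∧ (∀ x ∈ M, σ x = -x) ∧ (∀ x, σ (σ x) = x) ∧
      ∀ x, ∃ y ∈ KP, ∃ z ∈ KM, x = y + z ∧ σ x = y - z := by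
  -- The aim is to enlarge `P` and `M` to complementary subspaces `U ⊓ KP` and `Z ⊓ KM`. Choosing
  -- `U` complementary to `KP ⊓ M` makes `U ⊓ KP` avoid `M`; then `Z` is chosen to avoid what `U ⊓
  -- KP` already covers of `KM`.
  obtain ⟨U, hPU, hU⟩ := (hPM.mono_right (inf_le_right : KP ⊓ M ≤ M)).exists_isCompl
  have hd : Disjoint M ((U ⊓ KP) ⊓ KM) := by
    rw [Submodule.disjoint_def]
    rintro x hx ⟨⟨hxU, hxK⟩, -⟩
    exact Submodule.disjoint_def.1 hU.disjoint x hxU ⟨hxK, hx⟩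
  obtain ⟨Z, hMZ, hZ⟩ := hd.exists_isCompl
  have h1 : KP ≤ (U ⊓ KP) ⊔ M := by
    intro x hx
    obtain ⟨u, hu, m, hm, rfl⟩ := Submodule.mem_sup.1
      (show x ∈ U ⊔ KP ⊓ M from hU.sup_eq_top ▸ Submodule.mem_top)
    have : u ∈ KP := by simpa using KP.sub_mem hx hm.1
    exact Submodule.add_mem_sup ⟨hu, this⟩ hm.2
  have h2 : KM ≤ (U ⊓ KP) ⊔ (Z ⊓ KM) := by
    intro x hx
    obtain ⟨z, hz, u, hu, rfl⟩ := Submodule.mem_sup.1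
      (show x ∈ Z ⊔ (U ⊓ KP) ⊓ KM from hZ.sup_eq_top ▸ Submodule.mem_top)
    have : z ∈ KM := by simpa using KM.sub_mem hx hu.2
    exact Submodule.add_mem _ (Submodule.mem_sup_right ⟨hz, this⟩)
      (Submodule.mem_sup_left hu.1)
  have hc : IsCompl (U ⊓ KP) (Z ⊓ KM) := by
    constructor
    · rw [Submodule.disjoint_def]
      rintro x hx ⟨hxZ, hxK⟩
      exact Submodule.disjoint_def.1 hZ.disjoint x hxZ ⟨hx, hxK⟩
    · rw [codisjoint_iff, eq_top_iff, ← hK]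
      exact sup_le (h1.trans (sup_le_sup_left (le_inf hMZ hM) _)) h2
  set p := Submodule.projection _ _ hc with hp
  have hp1 : ∀ x ∈ U ⊓ KP, p x = x := fun x hx => Submodule.projection_apply_of_mem_left hc hx
  have hp2 : ∀ x ∈ Z ⊓ KM, p x = 0 := fun x hx =>
    (Submodule.projection_apply_eq_zero_iff hc).2 hx
  have hpm : ∀ x, p x ∈ U ⊓ KP := fun x => Submodule.projection_apply_mem hc x
  -- For a projection `p`, the operator `2p - 1` is the involution with the range and kernel of `p`
  -- as eigenspaces.
  refine ⟨p + p - LinearMap.id, ?_, ?_, ?_, ?_⟩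
  · intro x hx
    simp only [LinearMap.sub_apply, LinearMap.add_apply, LinearMap.id_apply,
      hp1 x ⟨hPU hx, hP hx⟩]
    abel
  · intro x hx
    simp [hp2 x ⟨hMZ hx, hM hx⟩]
  · intro x
    simp only [LinearMap.sub_apply, LinearMap.add_apply, LinearMap.id_apply, map_sub, map_add,
      hp1 _ (hpm x)]
    abel
  · intro x
    refine ⟨p x, (hpm x).2, x - p x, (Submodule.sub_projection_mem hc x).2, by abel, ?_⟩
    simp only [LinearMap.sub_apply, LinearMap.add_apply, LinearMap.id_apply]
    abel

/-- Linearly independent functionals take arbitrary values. -/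
theorem exists_apply_eq_of_linearIndependent {W I : Type*} [AddCommGroup W] [Module ℂ W]
    [Fintype I] {α : I → Module.Dual ℂ W} (hα : LinearIndependent ℂ α) (c : I → ℂ) :
    ∃ h : W, ∀ i, α i h = c i := by
  classical
  suffices hs : LinearMap.range (LinearMap.pi α) = ⊤ by
    obtain ⟨h, hh⟩ := (hs ▸ Submodule.mem_top : c ∈ LinearMap.range (LinearMap.pi α))
    exact ⟨h, fun i => congrFun hh i⟩
  by_contra hne
  -- A nonzero functional vanishing on a proper range is a nontrivial linear relation between the `α
  -- i`.
  obtain ⟨φ, hφ, hle⟩ := Submodule.exists_le_ker_of_lt_top _ (lt_top_iff_ne_top.2 hne)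
  have hz : ∑ i, φ (Pi.single i 1) • α i = 0 := by
    ext h
    have h1 : φ (LinearMap.pi α h) = 0 := hle ⟨h, rfl⟩
    rw [LinearMap.pi_apply_eq_sum_univ φ] at h1
    rw [LinearMap.sum_apply, LinearMap.zero_apply, ← h1]
    refine Finset.sum_congr rfl fun i _ => ?_
    have : (fun j => if i = j then (1 : ℂ) else 0) = Pi.single i 1 := by
      ext j; simp [Pi.single_apply, eq_comm]
    simp [this, mul_comm]
  have h0 := Fintype.linearIndependent_iff.1 hα _ hz
  refine hφ (LinearMap.ext fun x => ?_)
  rw [LinearMap.pi_apply_eq_sum_univ φ]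
  refine Finset.sum_eq_zero fun i _ => ?_
  have : (fun j => if i = j then (1 : ℂ) else 0) = Pi.single i 1 := by
    ext j; simp [Pi.single_apply, eq_comm]
  rw [this, h0 i, smul_zero]

end LinearAlgebra

theorem Generates.of_subset_span {g : Type*} [AddCommGroup g] [Module ℂ g] [LieSuperalgebra g]
    {S S' : Set g} (hS : Generates S) (hom : ∀ x ∈ S', ∃ a, x ∈ part (g := g) a)
    (h : ∀ x ∈ S, x ∈ Submodule.span ℂ S') : Generates S' where
  homogeneous := hom
  eq_top K hK hSK := hS.eq_top K hK fun x hx => Submodule.span_le.2 hSK (h x hx)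

theorem parity_cases (a : ZMod 2) : a = 0 ∨ a = 1 := by
  revert a; decide

/-! ### Signs of the diagram involution -/

section DiagramSign

variable {I : Type*} [Fintype I] [DecidableEq I]

/-- The sign `ε_i`: it is `-1` for odd nodes moved by `τ` and `1` otherwise. -/
def diagramSign (C : CartanDatum I) (τ : Equiv.Perm I) (i : I) : ℂ :=
  if τ i = i then 1 else (-1) ^ (C.p i).val

variable {C : CartanDatum I} {B : Set I} {τ : Equiv.Perm I}

theorem diagramSign_sq (i : I) : diagramSign C τ i * diagramSign C τ i = 1 := by
  unfold diagramSign
  split_ifs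
  · simp
  · rw [← pow_add, ← two_mul, pow_mul]; simp

theorem IsSuperAdmissible.diagramSign_apply (hadm : IsSuperAdmissible C B τ) (i : I) :
    diagramSign C τ (τ i) = diagramSign C τ i := by
  unfold diagramSign
  rw [hadm.invol, hadm.parity]
  simp only [eq_comm]

theorem IsSuperAdmissible.d_of_even (hadm : IsSuperAdmissible C B τ) {i : I} (hi : C.p i = 0) :
    C.d (τ i) = C.d i := by
  have h := hadm.form i i
  rw [C.diag_even i hi, C.diag_even (τ i) ((hadm.parity i).trans hi)] at h
  omega

theorem IsSuperAdmissible.A_of_even (hadm : IsSuperAdmissible C B τ) {i : I} (hi : C.p i = 0)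
    (j : I) : C.A (τ i) (τ j) = C.A i j := by
  have h := hadm.form i j
  rw [hadm.d_of_even hi] at h
  exact (mul_left_cancel₀ (C.d_ne_zero i) h).symm

/-- Divide d_i a_ij = d_{τi} a_{τi,τj} by d_{τi} = ±d_i; the normalization at moved odd nodes makes
the sign equal to ε_i. -/
theorem IsSuperAdmissible.A_apply (hadm : IsSuperAdmissible C B τ)
    (hsign : ∀ i, C.p i = 1 → τ i ≠ i → C.d (τ i) = -C.d i) (i j : I) :
    (C.A (τ i) (τ j) : ℂ) = diagramSign C τ i * C.A i j := by
  unfold diagramSign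
  have h := hadm.form i j
  split_ifs with hi
  · rw [hi] at h ⊢
    rw [mul_left_cancel₀ (C.d_ne_zero i) h, one_mul]
  · rcases parity_cases (C.p i) with hp | hp
    · simp [hp, hadm.A_of_even hp]
    · rw [hsign i hp hi, neg_mul, ← mul_neg] at h
      have := mul_left_cancel₀ (C.d_ne_zero i) h
      rw [hp, this, show (1 : ZMod 2).val = 1 from rfl]
      simp

end DiagramSign

/-! ### Existence of the Chevalley involution and of the diagram automorphism -/

namespace Realization

variable {I : Type*} [Fintype I] [DecidableEq I] {C : CartanDatum I}
  {g : Type*} [AddCommGroup g] [Module ℂ g] [LieSuperalgebra g]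
  (R : Realization C g)

/-- The isomorphism theorem for the exchanged generators, graded through -1. The factor (-1)^{p(i)}
compensates super skew-symmetry, so that the bracket of the new generators is -h_i. -/
theorem exists_isChevalley : ∃ ω, R.IsChevalley ω := by
  have hsq : ∀ i, ((-1 : ℂ) ^ (C.p i).val) * ((-1 : ℂ) ^ (C.p i).val) = 1 := fun i => by
    rw [← pow_add, ← two_mul, pow_mul]; simp
  have S : R.IsGeneratorSystem (fun i => -R.f i) (fun i => -(((-1 : ℂ) ^ (C.p i).val) • R.e i))
      (-R.cartan.subtype) (-AddMonoidHom.id _) := by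
    have h1 : ∀ i, -R.f i ∈ part (C.p i) := fun i => Submodule.neg_mem _ (R.f_mem i)
    have h2 : ∀ i, -(((-1 : ℂ) ^ (C.p i).val) • R.e i) ∈ part (C.p i) := fun i =>
      Submodule.neg_mem _ (Submodule.smul_mem _ _ (R.e_mem i))
    refine ⟨neg_injective, ?_, ?_, h1, h2, ?_, ?_, ?_, ?_, ?_, ?_⟩
    · intro x y h
      exact Subtype.ext (neg_injective h)
    · intro h
      exact R.cartan.neg_mem h.2
    · intro h i
      simp [R.cartan_f]
    · intro h i
      simp [R.cartan_e, smul_comm (R.root i h)]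
    · intro i j
      rw [map_neg, map_neg, LinearMap.neg_apply, neg_neg, map_smul,
        br_skew _ _ _ _ (R.f_mem i) (R.e_mem j), R.e_f]
      by_cases h : i = j
      · subst h
        have : ((-1 : ℂ) ^ ((C.p i).val * (C.p i).val)) = (-1 : ℂ) ^ (C.p i).val := by
          rcases parity_cases (C.p i) with h | h <;> simp [h, show (1 : ZMod 2).val = 1 from rfl]
        simp [this, smul_smul, hsq]
      · simp [h, Ne.symm h]
    · intro i
      exact Submodule.neg_mem _ (R.f_mem_rootSpace i)
    · intro i
      have : (-AddMonoidHom.id (I → ℤ)) (-Pi.single i 1) = Pi.single i 1 := by simp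
      rw [this]
      exact Submodule.neg_mem _ (Submodule.smul_mem _ _ (R.e_mem_rootSpace i))
    · refine R.generates.of_subset_span ?_ ?_
      · rintro x (⟨h, rfl⟩ | ⟨i, rfl⟩ | ⟨i, rfl⟩)
        · exact ⟨0, R.cartan_even (R.cartan.neg_mem h.2)⟩
        · exact ⟨_, h1 i⟩
        · exact ⟨_, h2 i⟩
      · rintro x (hx | ⟨i, rfl⟩ | ⟨i, rfl⟩)
        · exact Submodule.subset_span (Or.inl ⟨-⟨x, hx⟩, by simp⟩)
        · rw [show R.e i = (-(-1 : ℂ) ^ (C.p i).val) • -(((-1 : ℂ) ^ (C.p i).val) • R.e i) by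
            simp [smul_smul, hsq]]
          exact Submodule.smul_mem _ _ (Submodule.subset_span (Or.inr (Or.inr ⟨i, rfl⟩)))
        · rw [← neg_neg (R.f i)]
          exact Submodule.neg_mem _ (Submodule.subset_span (Or.inr (Or.inl ⟨i, rfl⟩)))
  obtain ⟨ψ, h1, h2, h3, h4⟩ := S.exists_isAut
  exact ⟨ψ, h1, h2, h3, h4⟩

variable {B : Set I} {τ : Equiv.Perm I}

/-- The involution of the Cartan subalgebra induced by `τ`. -/
theorem exists_cartan_involution (hadm : IsSuperAdmissible C B τ)
    (hsign : ∀ i, C.p i = 1 → τ i ≠ i → C.d (τ i) = -C.d i) :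
    ∃ σ : R.cartan →ₗ[ℂ] R.cartan,
      (∀ i, σ (R.coroot i) = diagramSign C τ i • R.coroot (τ i)) ∧ (∀ h, σ (σ h) = h) ∧
      ∀ i h, R.root (τ i) (σ h) = R.root i h := by
  set ε := diagramSign C τ with hε
  have hεε : ∀ i, ε i * ε i = 1 := diagramSign_sq
  have hετ : ∀ i, ε (τ i) = ε i := hadm.diagramSign_apply
  have hA : ∀ i j, (C.A (τ i) (τ j) : ℂ) = ε i * C.A i j := hadm.A_apply hsign
  have hA' : ∀ i j, (C.A i (τ j) : ℂ) = ε i * C.A (τ i) j := fun i j => by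
    have := hA (τ i) j
    rwa [hadm.invol, hετ] at this
  -- On `P` and `M` the rule h_i ↦ ε_i h_{τi} forces the eigenvalues 1 and -1; `KP` and `KM` are the
  -- largest subspaces where compatibility with the roots permits them.
  let P := Submodule.span ℂ (Set.range fun i => R.coroot i + ε i • R.coroot (τ i))
  let M := Submodule.span ℂ (Set.range fun i => R.coroot i - ε i • R.coroot (τ i))
  let KP : Submodule ℂ R.cartan := ⨅ i, LinearMap.ker (R.root (τ i) - R.root i)
  let KM : Submodule ℂ R.cartan := ⨅ i, LinearMap.ker (R.root (τ i) + R.root i)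
  have hKP : ∀ h, h ∈ KP ↔ ∀ i, R.root (τ i) h = R.root i h := fun h => by
    simp [KP, sub_eq_zero]
  have hKM : ∀ h, h ∈ KM ↔ ∀ i, R.root (τ i) h = -R.root i h := fun h => by
    simp [KM, add_eq_zero_iff_eq_neg]
  have hPK : P ≤ KP := by
    refine Submodule.span_le.2 ?_
    rintro _ ⟨i, rfl⟩
    refine (hKP _).2 fun j => ?_
    simp only [map_add, map_smul, R.root_coroot, hA, smul_eq_mul, hA', ← mul_assoc, hεε, one_mul]
    ring
  have hMK : M ≤ KM := by
    refine Submodule.span_le.2 ?_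
    rintro _ ⟨i, rfl⟩
    refine (hKM _).2 fun j => ?_
    simp only [map_sub, map_smul, R.root_coroot, hA, smul_eq_mul, hA', ← mul_assoc, hεε, one_mul]
    ring
  have hmemP : ∀ i, R.coroot i + ε i • R.coroot (τ i) ∈ P := fun i =>
    Submodule.subset_span ⟨i, rfl⟩
  have hmemM : ∀ i, R.coroot i - ε i • R.coroot (τ i) ∈ M := fun i =>
    Submodule.subset_span ⟨i, rfl⟩
  have hhalf : ∀ i, R.coroot i = (2⁻¹ : ℂ) • (R.coroot i + ε i • R.coroot (τ i)) +
      (2⁻¹ : ℂ) • (R.coroot i - ε i • R.coroot (τ i)) := fun i => by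
    rw [← smul_add, add_add_sub_cancel, ← two_smul ℂ, smul_smul]; norm_num
  have hspan : Submodule.span ℂ (Set.range R.coroot) ≤ P ⊔ M := by
    refine Submodule.span_le.2 ?_
    rintro _ ⟨i, rfl⟩
    rw [hhalf i]
    exact Submodule.add_mem_sup (P.smul_mem _ (hmemP i)) (M.smul_mem _ (hmemM i))
  have hdisj_li : LinearIndependent ℂ R.coroot → Disjoint P M := by
    intro hli
    -- With independent coroots, h_i ↦ ε_i h_{τi} extends to a linear map, which is 1 on `P` and -1
    -- on `M`.
    obtain ⟨G, hG⟩ := LinearMap.exists_extend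
      ((Finsupp.linearCombination ℂ fun i => ε i • R.coroot (τ i)) ∘ₗ
        (hli.repr : Submodule.span ℂ (Set.range R.coroot) →ₗ[ℂ] (I →₀ ℂ)))
    have hGi : ∀ i, G (R.coroot i) = ε i • R.coroot (τ i) := fun i => by
      have := LinearMap.congr_fun hG ⟨R.coroot i, Submodule.subset_span ⟨i, rfl⟩⟩
      simpa [hli.repr_eq_single i ⟨R.coroot i, Submodule.subset_span ⟨i, rfl⟩⟩ rfl] using this
    have hGP : P ≤ LinearMap.ker (G - LinearMap.id) := by
      refine Submodule.span_le.2 ?_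
      rintro _ ⟨i, rfl⟩
      simp [hGi, hετ, hadm.invol, smul_smul, hεε, add_comm]
    have hGM : M ≤ LinearMap.ker (G + LinearMap.id) := by
      refine Submodule.span_le.2 ?_
      rintro _ ⟨i, rfl⟩
      simp [hGi, hετ, hadm.invol, smul_smul, hεε]
    rw [Submodule.disjoint_def]
    intro x hx hx'
    have h1 := hGP hx
    have h2 := hGM hx'
    simp only [LinearMap.mem_ker, LinearMap.sub_apply, LinearMap.add_apply, LinearMap.id_apply]
      at h1 h2
    rw [sub_eq_zero.1 h1, ← two_smul ℂ] at h2
    exact (smul_eq_zero.1 h2).resolve_left two_ne_zero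
  have hmain : Disjoint P M ∧ KP ⊔ KM = ⊤ := by
    rcases R.cartan_size with ⟨h1, h2⟩ | ⟨h1, h2⟩ | ⟨h1, h2⟩
    · refine ⟨hdisj_li h1, eq_top_iff.2 fun h _ => ?_⟩
      -- The root values of `k` are the τ-averages of those of `h`, so those of `h - k` are
      -- τ-antisymmetric.
      obtain ⟨k, hk⟩ := exists_apply_eq_of_linearIndependent h2
        fun i => (2⁻¹ : ℂ) * (R.root i h + R.root (τ i) h)
      rw [show h = k + (h - k) by abel]
      refine Submodule.add_mem_sup ((hKP _).2 fun i => ?_) ((hKM _).2 fun i => ?_)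
      · rw [hk, hk, hadm.invol]; ring
      · rw [map_sub, map_sub, hk, hk, hadm.invol]; ring
    · refine ⟨hdisj_li h1, ?_⟩
      rw [eq_top_iff, ← h2]
      exact hspan.trans (sup_le_sup hPK hMK)
    · constructor
      · rw [Submodule.disjoint_def]
        intro x hx hx'
        -- An element of `KP ⊓ KM` is killed by every simple root.
        refine h2 x fun i => ?_
        have e1 := (hKP x).1 (hPK hx) i
        have e2 := (hKM x).1 (hMK hx') i
        rw [e1] at e2
        linear_combination (2⁻¹ : ℂ) * e2
      · rw [eq_top_iff, ← h1]
        exact hspan.trans (sup_le_sup hPK hMK)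
  obtain ⟨σ, h1, h2, h3, h4⟩ := exists_involution hPK hMK hmain.1 hmain.2
  refine ⟨σ, fun i => ?_, h3, fun i h => ?_⟩
  · conv_lhs => rw [hhalf i]
    rw [map_add, map_smul, map_smul, h1 _ (hmemP i), h2 _ (hmemM i), smul_neg, ← sub_eq_add_neg,
      ← smul_sub, add_sub_sub_cancel, ← two_smul ℂ, smul_smul]
    norm_num
  · obtain ⟨y, hy, z, hz, hyz, hσ⟩ := h4 h
    rw [hσ, map_sub, (hKP y).1 hy, (hKM z).1 hz, hyz, map_add, sub_neg_eq_add]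

/-- The isomorphism theorem with `π` permuting coordinates; the sign ε_i placed on the upper
generators matches the one in the action on coroots. -/
theorem exists_isDiagramAut (hadm : IsSuperAdmissible C B τ)
    (hsign : ∀ i, C.p i = 1 → τ i ≠ i → C.d (τ i) = -C.d i) :
    ∃ φ, R.IsDiagramAut τ φ := by
  obtain ⟨σ, h1, h2, h3⟩ := R.exists_cartan_involution hadm hsign
  set ε := diagramSign C τ with hε
  have hεε : ∀ i, ε i * ε i = 1 := diagramSign_sq
  have hετ : ∀ i, ε (τ i) = ε i := hadm.diagramSign_apply
  let π : (I → ℤ) →+ (I → ℤ) :=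
    { toFun := fun a => a ∘ τ.symm
      map_zero' := rfl
      map_add' := fun _ _ => rfl }
  have hπ : ∀ i, π (Pi.single i 1) = Pi.single (τ i) 1 := fun i => by
    ext j
    change (Pi.single i 1 : I → ℤ) (τ.symm j) = _
    simp only [Pi.single_apply, Equiv.symm_apply_eq]
  have hm1 : ∀ i, ε i • R.e (τ i) ∈ part (C.p i) := fun i =>
    Submodule.smul_mem _ _ (hadm.parity i ▸ R.e_mem (τ i))
  have hm2 : ∀ i, R.f (τ i) ∈ part (C.p i) := fun i => hadm.parity i ▸ R.f_mem (τ i)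
  have S : R.IsGeneratorSystem (fun i => ε i • R.e (τ i)) (fun i => R.f (τ i))
      (R.cartan.subtype ∘ₗ σ) π := by
    refine ⟨?_, ?_, ?_, hm1, hm2, ?_, ?_, ?_, ?_, ?_, ?_⟩
    · intro a b hab
      exact τ.symm.surjective.injective_comp_right hab
    · exact R.cartan.injective_subtype.comp (Function.LeftInverse.injective h2)
    · exact fun h => (σ h).2
    · intro h i
      change br ((σ h : R.cartan) : g) _ = _
      rw [map_smul, R.cartan_e, h3, smul_comm]
    · intro h i
      change br ((σ h : R.cartan) : g) _ = _
      rw [R.cartan_f, h3]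
    · intro i j
      rw [map_smul, LinearMap.smul_apply, R.e_f]
      by_cases h : i = j
      · subst h; simp [h1]
      · simp [h]
    · intro i
      rw [hπ]
      exact Submodule.smul_mem _ _ (R.e_mem_rootSpace _)
    · intro i
      rw [map_neg, hπ]
      exact R.f_mem_rootSpace _
    · refine R.generates.of_subset_span ?_ ?_
      · rintro x (⟨h, rfl⟩ | ⟨i, rfl⟩ | ⟨i, rfl⟩)
        · exact ⟨0, R.cartan_even (σ h).2⟩
        · exact ⟨_, hm1 i⟩
        · exact ⟨_, hm2 i⟩
      · rintro x (hx | ⟨i, rfl⟩ | ⟨i, rfl⟩)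
        · exact Submodule.subset_span (Or.inl ⟨σ ⟨x, hx⟩, by simp [h2]⟩)
        · have : R.e i = ε (τ i) • ε (τ i) • R.e (τ (τ i)) := by
            rw [smul_smul, hεε, one_smul, hadm.invol]
          rw [this]
          exact Submodule.smul_mem _ _ (Submodule.subset_span (Or.inr (Or.inl ⟨τ i, rfl⟩)))
        · exact Submodule.subset_span (Or.inr (Or.inr ⟨τ i, by rw [hadm.invol]⟩))
  obtain ⟨ψ, hψ, he, hf, hh⟩ := S.exists_isAut
  refine ⟨ψ, hψ, fun i => ?_, hf, fun i => ?_, fun h => ?_, fun h => ?_⟩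
  · rw [he, hε, diagramSign]
    split_ifs with hi
    · rw [hi, one_smul]
    · rfl
  · rw [hh, LinearMap.comp_apply, h1, hε, diagramSign]
    split_ifs with hi
    · rw [hi, one_smul]; rfl
    · rfl
  · rw [hh]
    exact (σ h).2
  · rw [hh, LinearMap.comp_apply]
    have := hh (σ h)
    rw [LinearMap.comp_apply, h2] at this
    exact this

end Realization

end SuperSatake

namespace SuperSatake

open LieSuperalgebra

/-! ### Weights, positivity of roots and nilpotence -/

namespace TriangularSystem

theorem one_le_deg {I : Type*} [DecidableEq I] (w : List I × I) (j : I) (hj : j ∈ w.1 ∨ j = w.2) :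
    1 ≤ deg w j := by
  obtain ⟨l, i⟩ := w
  induction l with
  | nil =>
    obtain rfl : j = i := by simpa using hj
    simp [deg]
  | cons k l ih =>
    rw [deg_cons k (l, i), Pi.add_apply]
    by_cases h : j = k
    · subst h
      have := deg_nonneg (l, i) j
      simp only [Pi.single_eq_same]
      simp only [Pi.zero_apply] at this
      omega
    · rw [Pi.single_eq_of_ne h, zero_add]
      refine ih ?_
      simpa [h] using hj

end TriangularSystem

namespace Realization

open TriangularSystem

variable {I : Type*} [Fintype I] [DecidableEq I] {C : CartanDatum I}
  {g : Type*} [AddCommGroup g] [Module ℂ g] [LieSuperalgebra g]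
  (R : Realization C g)

/-- The weight of a root space. -/
noncomputable def weight (a : I → ℤ) : Module.Dual ℂ R.cartan := ∑ j, (a j : ℂ) • R.root j

theorem weight_single (i : I) : R.weight (Pi.single i 1) = R.root i := by
  unfold weight
  rw [Finset.sum_eq_single i]
  · simp
  · intro j _ hj; simp [Pi.single_eq_of_ne hj]
  · simp

theorem weight_add (a b : I → ℤ) : R.weight (a + b) = R.weight a + R.weight b := by
  simp [weight, add_smul, Finset.sum_add_distrib]

theorem weight_neg (a : I → ℤ) : R.weight (-a) = -R.weight a := by
  simp [weight]

theorem weight_zero : R.weight 0 = 0 := by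
  simp [weight]

theorem weight_coroot (a : I → ℤ) (i : I) :
    R.weight a (R.coroot i) = (rootEval C.A.transpose i a : ℤ) := by
  simp [weight, rootEval, R.root_coroot, mul_comm]

/-- The vectors of each root space on which the Cartan subalgebra acts by the right weight form a
multiplicatively closed family containing the generators; they span `g`, hence fill each root space.
-/
theorem br_cartan (h : R.cartan) (a : I → ℤ) (x : g) (hx : x ∈ R.rootSpace a) :
    br (h : g) x = R.weight a h • x := by
  let q : (I → ℤ) → Submodule ℂ g := fun a => R.rootSpace a ⊓
    ⨅ h : R.cartan, LinearMap.ker (br (h : g) - R.weight a h • LinearMap.id)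
  have hq : ∀ a x, x ∈ q a ↔ x ∈ R.rootSpace a ∧
      ∀ h : R.cartan, br (h : g) x = R.weight a h • x := fun a x => by
    simp [q, sub_eq_zero]
  have htop : ⨆ a, q a = ⊤ := by
    refine R.generates.eq_top _ (fun x hx y hy => br_mem_iSup ?_ hx hy) ?_
    · intro a b x y hx hy
      rw [hq] at hx hy ⊢
      refine ⟨R.rootSpace_br _ _ _ _ hx.1 hy.1, fun h => ?_⟩
      have hj : ∀ y', br (h : g) (br x y') = br (br (h : g) x) y' + br x (br (h : g) y') := by
        let P : Submodule ℂ g :=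
          { carrier := {x | ∀ y', br (h : g) (br x y') = br (br (h : g) x) y' +
              br x (br (h : g) y')}
            add_mem' := fun {a b} ha hb z => by
              simp only [map_add, LinearMap.add_apply, ha z, hb z]; abel
            zero_mem' := fun z => by simp
            smul_mem' := fun c x hx z => by
              simp only [map_smul, LinearMap.smul_apply, hx z, smul_add] }
        have hP : P = ⊤ := by
          have h1 : ⨆ a, part (g := g) a = ⊤ :=
            (DirectSum.isInternal_submodule_iff_iSupIndep_and_iSup_eq_top _).1 part_isInternal |>.2
          rw [eq_top_iff, ← h1]
          refine iSup_le fun a x hx y => ?_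
          have := br_jacobi 0 a (h : g) x y (R.cartan_even h.2) hx
          simpa using this
        have : x ∈ P := hP ▸ Submodule.mem_top
        exact this
      rw [hj, hx.2, hy.2, map_smul, map_smul, LinearMap.smul_apply, weight_add,
        LinearMap.add_apply, add_smul]
    · rintro x (hx | ⟨i, rfl⟩ | ⟨i, rfl⟩)
      · refine Submodule.mem_iSup_of_mem 0 ((hq _ _).2 ⟨R.rootSpace_zero ▸ hx, fun h => ?_⟩)
        rw [R.weight_zero, LinearMap.zero_apply, zero_smul]
        exact R.cartan_comm h ⟨x, hx⟩
      · refine Submodule.mem_iSup_of_mem (Pi.single i 1)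
          ((hq _ _).2 ⟨R.e_mem_rootSpace i, fun h => ?_⟩)
        rw [R.weight_single, R.cartan_e]
      · refine Submodule.mem_iSup_of_mem (-Pi.single i 1)
          ((hq _ _).2 ⟨R.f_mem_rootSpace i, fun h => ?_⟩)
        rw [R.weight_neg, R.weight_single, R.cartan_f, LinearMap.neg_apply, neg_smul]
  rw [← eq_of_le_of_iSup_eq_top R.iSupIndep_rootSpace (fun a => inf_le_left) htop a] at hx
  exact ((hq a x).1 hx).2 h

theorem br_coroot (i : I) (a : I → ℤ) (x : g) (hx : x ∈ R.rootSpace a) :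
    br (R.coroot i : g) x = ((rootEval C.A.transpose i a : ℤ) : ℂ) • x := by
  rw [R.br_cartan _ a x hx, weight_coroot]

/-- The iterated brackets of simple root vectors, and the Cartan subalgebra, sorted by degree. -/
def monomials (a : I → ℤ) : Set g :=
  {x | (∃ w, deg w = a ∧ x = R.isGeneratorSystem_self.system.upperWord w) ∨
    (∃ w, -deg w = a ∧ x = R.isGeneratorSystem_self.system.swap.upperWord w) ∨
    (a = 0 ∧ x ∈ R.cartan)}

/-- Each monomial lies in the root space of its degree, and by the triangular decomposition they
span `g`; so nothing is missing in any degree. -/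
theorem rootSpace_eq_span (a : I → ℤ) : Submodule.span ℂ (R.monomials a) = R.rootSpace a := by
  set T := R.isGeneratorSystem_self.system with hT
  refine eq_of_le_of_iSup_eq_top (q := fun a => Submodule.span ℂ (R.monomials a))
    R.iSupIndep_rootSpace (fun a => Submodule.span_le.2 ?_) ?_ a
  · rintro x (⟨w, rfl, rfl⟩ | ⟨w, rfl, rfl⟩ | ⟨rfl, hx⟩)
    · exact T.upperWord_mem R.rootSpace R.e_mem_rootSpace
        (fun i a x hx => R.rootSpace_br _ _ _ _ (R.e_mem_rootSpace i) hx) w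
    · refine T.swap.upperWord_mem (fun a => R.rootSpace (-a)) R.f_mem_rootSpace
        (fun i a x hx => ?_) w
      rw [neg_add]
      exact R.rootSpace_br _ _ _ _ (R.f_mem_rootSpace i) hx
    · rw [R.rootSpace_zero]; exact hx
  · rw [eq_top_iff, ← R.total_eq_top]
    refine sup_le (sup_le (Submodule.span_le.2 ?_) ?_) (Submodule.span_le.2 ?_)
    · rintro _ ⟨w, rfl⟩
      exact Submodule.mem_iSup_of_mem (-deg w)
        (Submodule.subset_span (Or.inr (Or.inl ⟨w, rfl, rfl⟩)))
    · rintro _ ⟨h, rfl⟩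
      exact Submodule.mem_iSup_of_mem 0 (Submodule.subset_span (Or.inr (Or.inr ⟨rfl, h.2⟩)))
    · rintro _ ⟨w, rfl⟩
      exact Submodule.mem_iSup_of_mem (deg w) (Submodule.subset_span (Or.inl ⟨w, rfl, rfl⟩))

/-- Every spanning monomial has a degree of one sign. This positivity drives all later length
arguments. -/
theorem nonneg_or_nonpos {a : I → ℤ} (ha : R.rootSpace a ≠ ⊥) : 0 ≤ a ∨ a ≤ 0 := by
  rw [← R.rootSpace_eq_span, Ne, Submodule.span_eq_bot] at ha
  push Not at ha
  obtain ⟨x, hx | hx | hx, -⟩ := ha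
  · obtain ⟨w, rfl, -⟩ := hx
    exact Or.inl (deg_nonneg w)
  · obtain ⟨w, rfl, -⟩ := hx
    exact Or.inr (neg_nonpos.2 (deg_nonneg w))
  · exact Or.inl hx.1.ge

theorem br_self_of_even {x : g} (hx : x ∈ part 0) : br x x = 0 := by
  have := br_swap_of_even x x 0 hx hx
  rw [eq_neg_iff_add_eq_zero, ← two_smul ℂ] at this
  exact (smul_eq_zero.1 this).resolve_left two_ne_zero

/-- A word of degree k α_i uses only the letter `i`, and its innermost bracket [e_i, e_i] vanishes
because `i` is even. -/
theorem rootSpace_multiple {i : I} (hi : C.p i = 0) {k : ℤ} (hk : 2 ≤ k) :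
    R.rootSpace (Pi.single i k) = ⊥ := by
  rw [← R.rootSpace_eq_span, Submodule.span_eq_bot]
  rintro x (⟨⟨l, j⟩, hw, rfl⟩ | ⟨w, hw, rfl⟩ | ⟨h, -⟩)
  · have hall : ∀ m, m ∈ l ∨ m = j → m = i := fun m hm => by
      by_contra hne
      have := one_le_deg (l, j) m hm
      rw [hw, Pi.single_eq_of_ne hne] at this
      omega
    obtain rfl := hall j (Or.inr rfl)
    have h1 := sum_deg (l, j)
    rw [hw, Finset.sum_pi_single'] at h1
    simp only [Finset.mem_univ, if_true] at h1
    have hl : l ≠ [] := by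
      rintro rfl
      simp at h1; omega
    have hlast := hall _ (Or.inl (List.getLast_mem hl))
    rw [← List.dropLast_append_getLast hl, hlast]
    simp only [upperWord, List.map_append, List.prod_append, List.map_cons, List.map_nil,
      List.prod_cons, List.prod_nil, mul_one, Module.End.mul_apply]
    have : R.isGeneratorSystem_self.system.opE j (R.isGeneratorSystem_self.system.e j) = 0 :=
      br_self_of_even (hi ▸ R.e_mem j)
    rw [this, map_zero]
  · have h1 := deg_nonneg w i
    have h2 := congrFun hw i
    simp at h1 h2
    omega
  · have := congrFun h i
    simp at this
    omega

theorem e_ne_zero (i : I) : R.e i ≠ 0 := by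
  intro h
  have := R.e_f i i
  rw [h, map_zero, LinearMap.zero_apply, if_pos rfl] at this
  exact R.coroot_ne_zero i (Subtype.ext this.symm)

theorem f_ne_zero (i : I) : R.f i ≠ 0 := by
  intro h
  have := R.e_f i i
  rw [h, map_zero, if_pos rfl] at this
  exact R.coroot_ne_zero i (Subtype.ext this.symm)

theorem finite_ne_bot [FiniteDimensional ℂ g] : {a | R.rootSpace a ≠ ⊥}.Finite :=
  WellFoundedGT.finite_ne_bot_of_iSupIndep R.iSupIndep_rootSpace

/-- Root vectors act nilpotently. -/
theorem isNilpotent_br [FiniteDimensional ℂ g] {b : I → ℤ} (hb : b ≠ 0) {x : g}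
    (hx : x ∈ R.rootSpace b) : IsNilpotent (br x) := by
  have hpow : ∀ (n : ℕ) a y, y ∈ R.rootSpace a → ((br x) ^ n) y ∈ R.rootSpace (a + n • b) := by
    intro n
    induction n with
    | zero => intro a y hy; simpa using hy
    | succ n ih =>
      intro a y hy
      rw [pow_succ', Module.End.mul_apply, succ_nsmul', add_left_comm]
      exact R.rootSpace_br _ _ _ _ hx (ih a y hy)
  set s := R.finite_ne_bot.toFinset with hs
  refine ⟨s.card, ?_⟩
  have hker : ∀ a, R.rootSpace a ≤ LinearMap.ker ((br x) ^ s.card) := by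
    intro a y hy
    -- Pigeonhole: of `s.card + 1` distinct translates of `a`, one is outside the finite set of
    -- roots. The exponent `s.card` works for all `a` at once.
    obtain ⟨k, hk, hks⟩ : ∃ k ∈ Finset.range (s.card + 1), a + k • b ∉ s := by
      by_contra! hcon
      have hinj : Function.Injective fun k : ℕ => a + k • b := fun m n hmn => by
        have h := add_left_cancel hmn
        obtain ⟨j, hj⟩ := Function.ne_iff.1 hb
        have h' := congrFun h j
        simp only [Pi.smul_apply, nsmul_eq_mul] at h'
        exact_mod_cast mul_right_cancel₀ hj h'
      have := Finset.card_le_card (Finset.image_subset_iff.2 hcon)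
      rw [Finset.card_image_of_injective _ hinj, Finset.card_range] at this
      omega
    have hbot : R.rootSpace (a + k • b) = ⊥ := by
      by_contra hne
      exact hks (R.finite_ne_bot.mem_toFinset.2 hne)
    have h0 : ((br x) ^ k) y = 0 := by
      have := hpow k a y hy
      rw [hbot] at this
      exact this
    have hk' : k ≤ s.card := Nat.lt_succ_iff.1 (Finset.mem_range.1 hk)
    rw [LinearMap.mem_ker, ← Nat.sub_add_cancel hk', pow_add, Module.End.mul_apply, h0, map_zero]
  rw [← LinearMap.ker_eq_top, eq_top_iff, ← R.iSup_rootSpace]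
  exact iSup_le hker

end Realization

end SuperSatake

namespace SuperSatake

open LieSuperalgebra

/-! ### Exponentials of nilpotent operators -/

section NilExp

variable {V : Type*} [AddCommGroup V] [Module ℂ V]

/-- Links the complex exponential to `IsNilpotent.exp`; the rational structure is later supplied
locally by restriction of scalars. -/
theorem nilExp_eq_exp [Module ℚ V] (a : Module.End ℂ V) : nilExp a = IsNilpotent.exp a := by
  unfold nilExp IsNilpotent.exp
  refine Finset.sum_congr rfl fun n _ => ?_
  rw [← Rat.cast_smul_eq_qsmul ℂ]
  push_cast
  rfl

theorem nilExp_mul_nilExp_neg {a : Module.End ℂ V} (ha : IsNilpotent a) :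
    nilExp a * nilExp (-a) = 1 := by
  let _ : Module ℚ V := Module.compHom V (algebraMap ℚ ℂ)
  rw [nilExp_eq_exp, nilExp_eq_exp, IsNilpotent.exp_mul_exp_neg_self ha]

theorem nilExp_neg_mul_nilExp {a : Module.End ℂ V} (ha : IsNilpotent a) :
    nilExp (-a) * nilExp a = 1 := by
  let _ : Module ℚ V := Module.compHom V (algebraMap ℚ ℂ)
  rw [nilExp_eq_exp, nilExp_eq_exp, IsNilpotent.exp_neg_mul_exp_self ha]

theorem nilExp_apply_eq_sum {a : Module.End ℂ V} (ha : IsNilpotent a) {k : ℕ} {x : V}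
    (hx : (a ^ k) x = 0) :
    nilExp a x = ∑ n ∈ Finset.range k, ((n.factorial : ℂ)⁻¹) • (a ^ n) x := by
  let _ : Module ℚ V := Module.compHom V (algebraMap ℚ ℂ)
  rw [nilExp_eq_exp]
  refine (IsNilpotent.exp_smul_eq_sum (m := x) hx ha).trans ?_
  refine Finset.sum_congr rfl fun n _ => ?_
  rw [← Rat.cast_smul_eq_qsmul ℂ]
  push_cast
  rfl

/-- Exponentials are compatible with intertwining maps. -/
theorem nilExp_intertwine {a b T : Module.End ℂ V} (ha : IsNilpotent a) (hb : IsNilpotent b)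
    (h : T * a = b * T) : T * nilExp a = nilExp b * T := by
  let _ : Module ℚ V := Module.compHom V (algebraMap ℚ ℂ)
  rw [nilExp_eq_exp, nilExp_eq_exp]
  exact (Module.End.commute_exp_left_of_commute ha hb h.symm).symm

theorem nilExp_br {g : Type*} [AddCommGroup g] [Module ℂ g] [LieSuperalgebra g]
    {D : Module.End ℂ g} (hD : IsNilpotent D) (hder : ∀ x y, D (br x y) = br (D x) y + br x (D y))
    (x y : g) : nilExp D (br x y) = br (nilExp D x) (nilExp D y) := by
  let _ : Module ℚ g := Module.compHom g (algebraMap ℚ ℂ)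
  -- Regarding the bracket as a non-associative product turns the claim into multiplicativity of the
  -- exponential of a derivation.
  let _ : NonUnitalNonAssocRing g :=
    { (inferInstance : AddCommGroup g) with
      mul := fun x y => br x y
      left_distrib := fun a b c => map_add _ _ _
      right_distrib := fun a b c => by
        change br (a + b) c = br a c + br b c
        rw [map_add, LinearMap.add_apply]
      zero_mul := fun a => by
        change br 0 a = 0
        rw [map_zero, LinearMap.zero_apply]
      mul_zero := fun a => map_zero _ }
  have : SMulCommClass ℂ g g := ⟨fun c x y => ((br x).map_smul c y).symm⟩
  have : IsScalarTower ℂ g g := ⟨fun c x y => by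
    change br (c • x) y = c • br x y
    rw [map_smul, LinearMap.smul_apply]⟩
  rw [nilExp_eq_exp]
  exact Module.End.exp_mul_of_derivation ℂ g D (fun x y => (hder x y).trans (add_comm _ _)) hD x y

theorem nilExp_mem {a : Module.End ℂ V} {P : Submodule ℂ V} (h : ∀ x ∈ P, a x ∈ P)
    {x : V} (hx : x ∈ P) : nilExp a x ∈ P := by
  have hpow : ∀ n, (a ^ n) x ∈ P := fun n => by
    induction n with
    | zero => simpa using hx
    | succ n ih => rw [pow_succ', Module.End.mul_apply]; exact h _ ih
  unfold nilExp
  rw [LinearMap.sum_apply]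
  exact P.sum_mem fun n _ => P.smul_mem _ (hpow n)

end NilExp

/-! ### The simple reflection operator of an sl₂-triple -/

section SlTwo

attribute [local instance] LieRing.ofAssociativeRing

variable {V : Type*} [AddCommGroup V] [Module ℂ V] [FiniteDimensional ℂ V]

/-- An `sl₂`-triple of operators `E`, `F`, `H` together with the operator `T` which represents the
simple reflection. -/
structure IsWeylTriple (E F H T : Module.End ℂ V) : Prop where
  H_ne_zero : H ≠ 0
  E_F : E * F - F * E = H
  H_E : H * E - E * H = 2 • E
  H_F : H * F - F * H = -(2 • F)
  nilE : IsNilpotent E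
  nilF : IsNilpotent F
  T_eq : T = nilExp E * nilExp (-F) * nilExp E
  T_E : T * E = -F * T
  T_F : T * F = -E * T

namespace IsWeylTriple

variable {E F H T : Module.End ℂ V} (W : IsWeylTriple E F H T)
include W

omit [FiniteDimensional ℂ V] in
theorem triple : IsSl2Triple H E F := ⟨W.H_ne_zero, W.E_F, W.H_E, W.H_F⟩

-- From T E = -F T one gets T exp(E) = exp(-F) T, hence T = exp(-F) T exp(-E), and the last two
-- factors cancel. This makes `T` symmetric under passing to the opposite triple.
omit [FiniteDimensional ℂ V] in
theorem T_eq' : T = nilExp (-F) * nilExp E * nilExp (-F) := by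
  have h : T * nilExp E = nilExp (-F) * T := nilExp_intertwine W.nilE W.nilF.neg W.T_E
  have h2 : nilExp E * nilExp (-E) = 1 := nilExp_mul_nilExp_neg W.nilE
  calc T = T * nilExp E * nilExp (-E) := by rw [mul_assoc, h2, mul_one]
    _ = nilExp (-F) * (nilExp E * nilExp (-F) * nilExp E) * nilExp (-E) := by
        rw [h, ← W.T_eq]
    _ = nilExp (-F) * nilExp E * nilExp (-F) * (nilExp E * nilExp (-E)) := by
        simp only [mul_assoc]
    _ = _ := by rw [h2, mul_one]

omit [FiniteDimensional ℂ V] in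
theorem T_H : T * H = -H * T := by
  rw [← W.E_F, mul_sub, ← mul_assoc, ← mul_assoc, W.T_E, W.T_F, mul_assoc, mul_assoc, W.T_E, W.T_F]
  noncomm_ring

omit [FiniteDimensional ℂ V] in
/-- The same operator is obtained from the opposite triple. -/
theorem symm : IsWeylTriple (-F) (-E) (-H) T where
  H_ne_zero := neg_ne_zero.2 W.H_ne_zero
  E_F := by rw [← W.E_F]; noncomm_ring
  H_E := by rw [← neg_neg (-H * -F - -F * -H), smul_neg, ← W.H_F]; noncomm_ring
  H_F := by rw [smul_neg, ← W.H_E]; noncomm_ring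
  nilE := W.nilF.neg
  nilF := W.nilE.neg
  T_eq := by rw [neg_neg]; exact W.T_eq'
  T_E := by rw [mul_neg, W.T_F]; simp
  T_F := by rw [mul_neg, W.T_E]; simp

/-- A lowest weight vector has nonpositive integral weight. -/
theorem exists_nat {v : V} (hv : v ≠ 0) {c : ℂ} (hF : F v = 0) (hH : H v = c • v) :
    ∃ n : ℕ, c = -n := by
  have P : W.triple.symm.HasPrimitiveVectorWith v (-c) :=
    { ne_zero := hv
      lie_h := by
        change (-H) v = _
        rw [LinearMap.neg_apply, hH, neg_smul]
      lie_e := hF }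
  obtain ⟨n, hn⟩ := P.exists_nat
  exact ⟨n, by rw [← hn, neg_neg]⟩

/-- The usual highest weight formulas, read for the opposite triple so that they describe a lowest
weight vector. -/
theorem pow_succ_apply {v : V} {n : ℕ} (hF : F v = 0) (hH : H v = (-n : ℂ) • v) :
    (E ^ (n + 1)) v = 0 ∧
      ∀ k : ℕ, F ((E ^ (k + 1)) v) = (((k : ℂ) + 1) * (n - k)) • (E ^ k) v := by
  by_cases hv : v = 0
  · simp [hv]
  have P : W.triple.symm.HasPrimitiveVectorWith v (n : ℂ) :=
    { ne_zero := hv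
      lie_h := by
        change (-H) v = _
        rw [LinearMap.neg_apply, hH, neg_smul, neg_neg]
      lie_e := hF }
  refine ⟨by simpa using P.pow_toEnd_f_eq_zero_of_eq_nat rfl, fun k => ?_⟩
  simpa using P.lie_e_pow_succ_toEnd_f k

omit [FiniteDimensional ℂ V] in
theorem H_pow_apply {v : V} {c : ℂ} (hH : H v = c • v) (k : ℕ) :
    H ((E ^ k) v) = (c + 2 * k) • (E ^ k) v := by
  have h : ∀ x, H (E x) = E (H x) + (2 : ℂ) • E x := fun x => by
    have := LinearMap.congr_fun W.H_E x
    simp only [LinearMap.sub_apply, Module.End.mul_apply, LinearMap.smul_apply] at this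
    rw [sub_eq_iff_eq_add] at this
    rw [this, add_comm, two_smul, two_smul]
  induction k with
  | zero => simpa using hH
  | succ k ih =>
    rw [pow_succ', Module.End.mul_apply, h, ih, map_smul, ← add_smul]
    push_cast
    ring_nf

/-- The action of `T` on a lowest weight vector. -/
theorem T_lowest {v : V} {n : ℕ} (hF : F v = 0) (hH : H v = (-n : ℂ) • v) :
    T v = ((n.factorial : ℂ)⁻¹) • (E ^ n) v := by
  obtain ⟨hE, hFE⟩ := W.pow_succ_apply hF hH
  -- `T v` is computed modulo `S n`. Since `T v` has weight `n` while `S n` only has the weights -n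
  -- + 2k with k < n, the error term must vanish.
  let S : ℕ → Submodule ℂ V := fun m => Submodule.span ℂ {x | ∃ k < m, x = (E ^ k) v}
  have hSmem : ∀ {m k : ℕ}, k < m → (E ^ k) v ∈ S m := fun {m k} hk =>
    Submodule.subset_span ⟨k, hk, rfl⟩
  have hFS : ∀ m, ∀ x ∈ S m, F x ∈ S m := by
    intro m
    change S m ≤ (S m).comap F
    refine Submodule.span_le.2 ?_
    rintro _ ⟨k, hk, rfl⟩
    change F _ ∈ S m
    cases k with
    | zero => simp [hF]
    | succ k => rw [hFE]; exact (S m).smul_mem _ (hSmem (by omega))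
  have hexp : ∀ m, ∀ x ∈ S m, nilExp (-F) x ∈ S m := fun m x hx =>
    nilExp_mem (fun y hy => (S m).neg_mem (hFS m y hy)) hx
  have htop : nilExp (-F) ((E ^ n) v) - (E ^ n) v ∈ S n := by
    have hpow : ∀ k, ((-F) ^ (k + 1)) ((E ^ n) v) ∈ S n := by
      intro k
      induction k with
      | zero =>
        rw [zero_add, pow_one, LinearMap.neg_apply]
        refine (S n).neg_mem ?_
        cases n with
        | zero => simp [hF]
        | succ n => rw [hFE]; exact (S _).smul_mem _ (hSmem (by omega))
      | succ k ih =>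
        rw [pow_succ', Module.End.mul_apply]
        exact (S n).neg_mem (hFS n _ ih)
    obtain ⟨N, hN⟩ := W.nilF.neg
    have hN' : ((-F) ^ (N + 1)) ((E ^ n) v) = 0 := by
      rw [pow_succ', hN, mul_zero, LinearMap.zero_apply]
    rw [nilExp_apply_eq_sum W.nilF.neg hN', Finset.sum_range_succ']
    simp only [Nat.factorial_zero, Nat.cast_one, inv_one, pow_zero, Module.End.one_apply, one_smul,
      add_sub_cancel_right]
    exact (S n).sum_mem fun k _ => (S n).smul_mem _ (hpow k)
  have hv1 : nilExp (-F) v = v := by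
    rw [nilExp_apply_eq_sum W.nilF.neg (k := 1) (by simp [hF])]
    simp
  have hdiff : T v - ((n.factorial : ℂ)⁻¹) • (E ^ n) v ∈ S n := by
    -- As exp(-F) fixes `v`, two exponentials remain; modulo `S n` their product contributes only
    -- the top term E^n v / n!.
    rw [W.T_eq', Module.End.mul_apply, Module.End.mul_apply, hv1,
      nilExp_apply_eq_sum W.nilE hE, Finset.sum_range_succ, map_add, map_smul, add_sub_assoc,
      ← smul_sub]
    refine (S n).add_mem (hexp n _ ((S n).sum_mem fun k hk => (S n).smul_mem _
      (hSmem (Finset.mem_range.1 hk)))) ((S n).smul_mem _ htop)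
  have hHT : H (T v) = (n : ℂ) • T v := by
    have h1 := LinearMap.congr_fun W.T_H v
    rw [Module.End.mul_apply, Module.End.mul_apply, hH, map_smul, LinearMap.neg_apply, neg_smul,
      neg_inj] at h1
    exact h1.symm
  have hw1 : T v - ((n.factorial : ℂ)⁻¹) • (E ^ n) v ∈ Module.End.eigenspace H (n : ℂ) := by
    refine Submodule.sub_mem _ (Module.End.mem_eigenspace_iff.2 hHT)
      (Submodule.smul_mem _ _ (Module.End.mem_eigenspace_iff.2 ?_))
    rw [W.H_pow_apply hH]
    ring_nf
  have hw2 : S n ≤ ⨆ μ, ⨆ (_ : μ ≠ (n : ℂ)), Module.End.eigenspace H μ := by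
    refine Submodule.span_le.2 ?_
    rintro _ ⟨k, hk, rfl⟩
    refine Submodule.mem_iSup_of_mem (-n + 2 * k : ℂ) (Submodule.mem_iSup_of_mem ?_
      (Module.End.mem_eigenspace_iff.2 (W.H_pow_apply hH k)))
    intro h
    have : (2 * k : ℂ) = ((2 * n : ℕ) : ℂ) := by push_cast; linear_combination h
    norm_cast at this
    omega
  exact sub_eq_zero.1 (Submodule.disjoint_def.1 (Module.End.eigenspaces_iSupIndep H (n : ℂ)) _
    hw1 (hw2 hdiff))

/-- With T v = E^n v / n! and T E = -F T, the square is (-F)^n E^n v / (n!)², and F^n E^n v = (n!)²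
v. -/
theorem T_T_lowest {v : V} {n : ℕ} (hF : F v = 0) (hH : H v = (-n : ℂ) • v) :
    T (T v) = ((-1 : ℂ) ^ n) • v := by
  obtain ⟨hE, hFE⟩ := W.pow_succ_apply hF hH
  have hTE : ∀ (k : ℕ) x, T ((E ^ k) x) = ((-F) ^ k) (T x) := by
    intro k
    induction k with
    | zero => simp
    | succ k ih =>
      intro x
      rw [pow_succ, Module.End.mul_apply, ih, pow_succ, Module.End.mul_apply]
      congr 1
      exact LinearMap.congr_fun W.T_E x
  have hFk : ∀ k ≤ n, (F ^ k) ((E ^ k) v) = ((k.factorial : ℂ) * (n.descFactorial k : ℂ)) • v := by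
    intro k
    induction k with
    | zero => simp
    | succ k ih =>
      intro hk
      rw [pow_succ F, Module.End.mul_apply, hFE, map_smul, ih (by omega), smul_smul,
        Nat.factorial_succ, Nat.descFactorial_succ]
      push_cast [Nat.cast_sub (show k ≤ n by omega)]
      ring_nf
  have hn : (n.factorial : ℂ) ≠ 0 := by exact_mod_cast n.factorial_ne_zero
  rw [W.T_lowest hF hH, map_smul, hTE, W.T_lowest hF hH, map_smul, neg_pow, Module.End.mul_apply,
    hFk n le_rfl, Nat.descFactorial_self, map_smul, smul_smul, smul_smul]
  have : ((-1 : Module.End ℂ V) ^ n) v = ((-1 : ℂ) ^ n) • v := by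
    rcases Nat.even_or_odd n with h | h
    · simp [h.neg_one_pow]
    · simp [h.neg_one_pow]
  rw [this, smul_smul]
  congr 1
  field_simp

end IsWeylTriple

end SlTwo

end SuperSatake

namespace SuperSatake

open LieSuperalgebra

/-! ### Exponential automorphisms and the operators Ad(m_i) -/

section Aut

variable {g : Type*} [AddCommGroup g] [Module ℂ g] [LieSuperalgebra g]

theorem IsAut.mul {φ ψ : Module.End ℂ g} (hφ : IsAut φ) (hψ : IsAut ψ) : IsAut (φ * ψ) where
  bijective := hφ.bijective.comp hψ.bijective
  even a x hx := hφ.even a _ (hψ.even a x hx)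
  map_br x y := by
    rw [Module.End.mul_apply, hψ.map_br, hφ.map_br]; rfl

theorem isAut_one : IsAut (1 : Module.End ℂ g) where
  bijective := Function.bijective_id
  even _ _ hx := hx
  map_br _ _ := rfl

theorem IsAut.mul_br {φ : Module.End ℂ g} (hφ : IsAut φ) (x : g) :
    φ * br x = br (φ x) * φ :=
  LinearMap.ext fun y => hφ.map_br x y

/-- The exponential of a nilpotent even inner derivation is an automorphism. -/
theorem isAut_nilExp {x : g} (hx : x ∈ part 0) (hnil : IsNilpotent (br x)) :
    IsAut (nilExp (br x)) where
  bijective := by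
    refine Function.bijective_iff_has_inverse.2 ⟨nilExp (-br x), fun y => ?_, fun y => ?_⟩
    · exact LinearMap.congr_fun (nilExp_neg_mul_nilExp hnil) y
    · exact LinearMap.congr_fun (nilExp_mul_nilExp_neg hnil) y
  even a y hy := nilExp_mem (fun z hz => by simpa using br_mem 0 a x z hx hz) hy
  map_br := by
    refine nilExp_br hnil fun y z => ?_
    let P : Submodule ℂ g :=
      { carrier := {y | br x (br y z) = br (br x y) z + br y (br x z)}
        add_mem' := fun {a b} ha hb => by
          simp only [Set.mem_ofPred_eq] at ha hb ⊢
          simp only [map_add, LinearMap.add_apply, ha, hb]; abel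
        zero_mem' := by simp
        smul_mem' := fun c y hy => by
          simp only [Set.mem_ofPred_eq] at hy ⊢
          simp only [map_smul, LinearMap.smul_apply, hy, smul_add] }
    have hP : P = ⊤ := by
      have h1 : ⨆ a, part (g := g) a = ⊤ :=
        (DirectSum.isInternal_submodule_iff_iSupIndep_and_iSup_eq_top _).1 part_isInternal |>.2
      rw [eq_top_iff, ← h1]
      refine iSup_le fun a y hy => ?_
      have := br_jacobi 0 a x y z hx hy
      simpa [P] using this
    have : y ∈ P := hP ▸ Submodule.mem_top
    exact this

end Aut

namespace Realization

variable {I : Type*} [Fintype I] [DecidableEq I] {C : CartanDatum I}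
  {g : Type*} [AddCommGroup g] [Module ℂ g] [LieSuperalgebra g]
  (R : Realization C g)

/-- Automorphisms are determined by their values on the generators. -/
theorem aut_ext {φ ψ : Module.End ℂ g} (hφ : IsAut φ) (hψ : IsAut ψ)
    (hh : ∀ h : R.cartan, φ h = ψ h) (he : ∀ i, φ (R.e i) = ψ (R.e i))
    (hf : ∀ i, φ (R.f i) = ψ (R.f i)) : φ = ψ := by
  have h : LinearMap.eqLocus φ ψ = ⊤ := by
    refine R.generates.eq_top _ (fun x hx y hy => ?_) ?_
    · rw [LinearMap.mem_eqLocus] at hx hy ⊢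
      rw [hφ.map_br, hψ.map_br, hx, hy]
    · rintro x (hx | ⟨i, rfl⟩ | ⟨i, rfl⟩)
      · exact hh ⟨x, hx⟩
      · exact he i
      · exact hf i
  exact LinearMap.ext fun x => by
    have : x ∈ LinearMap.eqLocus φ ψ := h ▸ Submodule.mem_top
    exact this

theorem br_e_cartan (i : I) (h : R.cartan) : br (R.e i) (h : g) = -(R.root i h • R.e i) :=
  R.isGeneratorSystem_self.system.E_η i h

theorem br_f_cartan (i : I) (h : R.cartan) : br (R.f i) (h : g) = R.root i h • R.f i :=
  R.isGeneratorSystem_self.system.F_η i h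

variable {i : I} (hi : C.p i = 0)

include hi in
theorem e_mem_even : R.e i ∈ part 0 := hi ▸ R.e_mem i

include hi in
theorem f_mem_even : R.f i ∈ part 0 := hi ▸ R.f_mem i

include hi in
theorem br_f_e_of_even : br (R.f i) (R.e i) = -(R.coroot i : g) := by
  rw [br_swap_of_even _ _ _ (R.e_mem_even hi) (R.f_mem_even hi), R.e_f, if_pos rfl]

include hi in
theorem root_coroot_of_even : R.root i (R.coroot i) = 2 := by
  rw [R.root_coroot, C.diag_even i hi]; norm_num

variable [FiniteDimensional ℂ g]

theorem isNilpotent_br_e (i : I) : IsNilpotent (br (R.e i)) :=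
  R.isNilpotent_br (by simp) (R.e_mem_rootSpace i)

theorem isNilpotent_br_f (i : I) : IsNilpotent (br (R.f i)) :=
  R.isNilpotent_br (by simp) (R.f_mem_rootSpace i)

include hi

theorem exp_e_e : nilExp (br (R.e i)) (R.e i) = R.e i := by
  rw [nilExp_apply_eq_sum (R.isNilpotent_br_e i) (k := 1)
    (by simp [br_self_of_even (R.e_mem_even hi)])]
  simp

theorem exp_neg_f_f : nilExp (-br (R.f i)) (R.f i) = R.f i := by
  rw [nilExp_apply_eq_sum (R.isNilpotent_br_f i).neg (k := 1)
    (by simp [br_self_of_even (R.f_mem_even hi)])]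
  simp

theorem exp_e_cartan (h : R.cartan) :
    nilExp (br (R.e i)) (h : g) = (h : g) - R.root i h • R.e i := by
  have h1 := br_self_of_even (R.e_mem_even hi)
  rw [nilExp_apply_eq_sum (R.isNilpotent_br_e i) (k := 2)
    (by simp [pow_two, br_e_cartan, h1])]
  simp [Finset.sum_range_succ, br_e_cartan, sub_eq_add_neg]

theorem exp_neg_f_cartan (h : R.cartan) :
    nilExp (-br (R.f i)) (h : g) = (h : g) - R.root i h • R.f i := by
  have h1 := br_self_of_even (R.f_mem_even hi)
  rw [nilExp_apply_eq_sum (R.isNilpotent_br_f i).neg (k := 2)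
    (by simp [pow_two, br_f_cartan, h1])]
  simp [Finset.sum_range_succ, br_f_cartan, sub_eq_add_neg]

theorem exp_e_f : nilExp (br (R.e i)) (R.f i) = R.f i + R.coroot i - R.e i := by
  have h1 := br_self_of_even (R.e_mem_even hi)
  rw [nilExp_apply_eq_sum (R.isNilpotent_br_e i) (k := 3)
    (by simp [pow_succ, R.e_f, br_e_cartan, h1])]
  simp [Finset.sum_range_succ, pow_two, R.e_f, br_e_cartan, R.root_coroot_of_even hi, smul_smul,
    sub_eq_add_neg]

theorem exp_neg_f_e : nilExp (-br (R.f i)) (R.e i) = R.e i + R.coroot i - R.f i := by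
  have h1 := br_self_of_even (R.f_mem_even hi)
  have h2 := R.br_f_e_of_even hi
  rw [nilExp_apply_eq_sum (R.isNilpotent_br_f i).neg (k := 3)
    (by simp [pow_succ, h2, br_f_cartan, h1])]
  simp [Finset.sum_range_succ, pow_two, h2, br_f_cartan, R.root_coroot_of_even hi, smul_smul,
    sub_eq_add_neg]

theorem isAut_adM : IsAut (R.adM i) := by
  have h := isAut_nilExp (R.e_mem_even hi) (R.isNilpotent_br_e i)
  have h' := isAut_nilExp (x := -R.f i) (Submodule.neg_mem _ (R.f_mem_even hi))
    (by rw [map_neg]; exact (R.isNilpotent_br_f i).neg)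
  rw [map_neg] at h'
  exact (h.mul h').mul h

theorem adM_e : R.adM i (R.e i) = -R.f i := by
  simp only [adM, Module.End.mul_apply, R.exp_e_e hi, R.exp_neg_f_e hi, map_add, map_sub,
    R.exp_e_f hi, R.exp_e_cartan hi, R.root_coroot_of_even hi, two_smul]
  abel

theorem adM_f : R.adM i (R.f i) = -R.e i := by
  simp only [adM, Module.End.mul_apply, R.exp_e_f hi, map_add, map_sub, R.exp_neg_f_f hi,
    R.exp_neg_f_e hi, R.exp_neg_f_cartan hi, R.root_coroot_of_even hi, two_smul,
    R.exp_e_cartan hi, R.exp_e_e hi]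
  abel

theorem adM_cartan (h : R.cartan) :
    R.adM i (h : g) = ((h - R.root i h • R.coroot i : R.cartan) : g) := by
  simp only [adM, Module.End.mul_apply, R.exp_e_cartan hi, map_sub, map_smul,
    R.exp_neg_f_e hi, R.exp_neg_f_cartan hi, map_add, R.exp_e_e hi, R.exp_e_f hi,
    R.root_coroot_of_even hi, two_smul, Submodule.coe_sub, Submodule.coe_smul]
  module

theorem isWeylTriple :
    IsWeylTriple (br (R.e i)) (br (R.f i)) (br (R.coroot i : g)) (R.adM i) where
  H_ne_zero := by
    intro h
    have h1 := R.cartan_e (R.coroot i) i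
    rw [h, R.root_coroot_of_even hi, LinearMap.zero_apply] at h1
    exact R.e_ne_zero i ((smul_eq_zero.1 h1.symm).resolve_left two_ne_zero)
  E_F := by
    ext x
    have := br_jacobi 0 0 (R.e i) (R.f i) x (R.e_mem_even hi) (R.f_mem_even hi)
    rw [R.e_f, if_pos rfl] at this
    simp [this]
  H_E := by
    ext x
    have := br_jacobi 0 0 (R.coroot i : g) (R.e i) x (R.cartan_even (R.coroot i).2)
      (R.e_mem_even hi)
    rw [R.cartan_e, R.root_coroot_of_even hi] at this
    simp [this, two_smul]
  H_F := by
    ext x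
    have := br_jacobi 0 0 (R.coroot i : g) (R.f i) x (R.cartan_even (R.coroot i).2)
      (R.f_mem_even hi)
    rw [R.cartan_f, R.root_coroot_of_even hi] at this
    simp [this, two_smul]
  nilE := R.isNilpotent_br_e i
  nilF := R.isNilpotent_br_f i
  T_eq := rfl
  T_E := by rw [(R.isAut_adM hi).mul_br, R.adM_e hi, map_neg]
  T_F := by rw [(R.isAut_adM hi).mul_br, R.adM_f hi, map_neg]

omit [FiniteDimensional ℂ g] in
theorem br_f_e_of_ne {j : I} (hj : j ≠ i) : br (R.f i) (R.e j) = 0 := by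
  have := br_swap_of_even _ _ _ (R.f_mem_even hi) (R.e_mem j)
  rwa [R.e_f, if_neg hj, eq_comm, neg_eq_zero] at this

/-- The operator `Ad(m_i)` maps the root space of `a` to that of `r_i(a)`. -/
theorem adM_mem_rootSpace {a : I → ℤ} {x : g} (hx : x ∈ R.rootSpace a) :
    R.adM i x ∈ R.rootSpace (reflection C.A.transpose i a) := by
  have W := R.isWeylTriple hi
  set m := rootEval C.A.transpose i a with hm
  -- `P` is the α_i-string through `a`. The coroot h_i acts on its members by the distinct scalars m
  -- + 2k, so the eigenvalue -m of the image, read off from T H = -H T, singles out r_i(a).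
  let P : Submodule ℂ g := ⨆ k : ℤ, R.rootSpace (a + k • Pi.single i 1)
  have hPe : ∀ x ∈ P, br (R.e i) x ∈ P := by
    intro x hx
    refine Submodule.iSup_induction _ (motive := fun x => br (R.e i) x ∈ P) hx ?_ (by simp) ?_
    · intro k x hx
      refine Submodule.mem_iSup_of_mem (1 + k) ?_
      rw [add_smul, one_smul, add_left_comm]
      exact R.rootSpace_br _ _ _ _ (R.e_mem_rootSpace i) hx
    · intro x y hx hy
      rw [map_add]; exact P.add_mem hx hy
  have hPf : ∀ x ∈ P, (-br (R.f i)) x ∈ P := by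
    intro x hx
    refine Submodule.iSup_induction _ (motive := fun x => (-br (R.f i)) x ∈ P) hx ?_ (by simp) ?_
    · intro k x hx
      refine Submodule.mem_iSup_of_mem (-1 + k) ?_
      rw [add_smul, neg_one_smul, add_left_comm]
      exact Submodule.neg_mem _ (R.rootSpace_br _ _ _ _ (R.f_mem_rootSpace i) hx)
    · intro x y hx hy
      rw [map_add]; exact P.add_mem hx hy
  have hxP : x ∈ P := Submodule.mem_iSup_of_mem 0 (by simpa using hx)
  have hTP : R.adM i x ∈ P := nilExp_mem hPe (nilExp_mem hPf (nilExp_mem hPe hxP))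
  have hTH : br (R.coroot i : g) (R.adM i x) = (-m : ℂ) • R.adM i x := by
    have h1 := LinearMap.congr_fun W.T_H x
    rw [Module.End.mul_apply, Module.End.mul_apply, R.br_coroot i a x hx, map_smul,
      LinearMap.neg_apply] at h1
    rw [neg_smul, h1, neg_neg]
  have hk : ∀ k : ℤ, rootEval C.A.transpose i (a + k • Pi.single i 1) = m + 2 * k := fun k => by
    have h2 : rootEval C.A.transpose i (Pi.single i 1) = 2 := by
      simp [rootEval, Pi.single_apply, C.diag_even i hi]
    rw [map_add, map_smul, h2, smul_eq_mul, mul_comm]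
  have hrefl : reflection C.A.transpose i a = a + (-m) • Pi.single i 1 := by
    simp [reflection, hm, sub_eq_add_neg]
  rw [hrefl]
  have hsplit : P ≤ R.rootSpace (a + (-m) • Pi.single i 1) ⊔
      ⨆ μ, ⨆ (_ : μ ≠ (-m : ℂ)), Module.End.eigenspace (br (R.coroot i : g)) μ := by
    refine iSup_le fun k => ?_
    by_cases h : k = -m
    · subst h; exact le_sup_left
    · intro y hy
      refine Submodule.mem_sup_right (Submodule.mem_iSup_of_mem (m + 2 * k : ℂ)
        (Submodule.mem_iSup_of_mem ?_ (Module.End.mem_eigenspace_iff.2 ?_)))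
      · intro h'
        have : ((m + 2 * k : ℤ) : ℂ) = ((-m : ℤ) : ℂ) := by push_cast; exact h'
        have := Int.cast_injective this
        omega
      · rw [R.br_coroot i _ y hy, hk]; push_cast; rfl
  obtain ⟨u, hu, v, hv, huv⟩ := Submodule.mem_sup.1 (hsplit hTP)
  have hv' : v ∈ Module.End.eigenspace (br (R.coroot i : g)) (-m : ℂ) := by
    have : v = R.adM i x - u := by rw [← huv]; abel
    rw [this]
    refine Submodule.sub_mem _ (Module.End.mem_eigenspace_iff.2 hTH)
      (Module.End.mem_eigenspace_iff.2 ?_)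
    rw [R.br_coroot i _ u hu, hk]
    push_cast
    ring_nf
  have hv0 : v = 0 :=
    Submodule.disjoint_def.1 (Module.End.eigenspaces_iSupIndep _ (-m : ℂ)) v hv' hv
  rw [← huv, hv0, add_zero]
  exact hu

end Realization

end SuperSatake

namespace SuperSatake

open LieSuperalgebra Matrix

/-! ### Root and coroot lattices, and words in reflections -/

section Pairing

variable {I : Type*} [Fintype I] [DecidableEq I]

/-- The pairing between the root lattice and the coroot lattice. -/
def pairing (A : Matrix I I ℤ) (a y : I → ℤ) : ℤ := y ⬝ᵥ A *ᵥ a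

variable (A : Matrix I I ℤ)

omit [DecidableEq I] in
theorem rootEval_eq (i : I) (y : I → ℤ) : rootEval A i y = (y ᵥ* A) i := by
  simp [rootEval, Matrix.vecMul, dotProduct, mul_comm]

omit [DecidableEq I] in
theorem rootEval_transpose (i : I) (a : I → ℤ) : rootEval A.transpose i a = (A *ᵥ a) i := by
  rw [rootEval_eq, Matrix.vecMul_transpose]

theorem reflection_apply (i : I) (y : I → ℤ) :
    reflection A i y = y - rootEval A i y • Pi.single i 1 := rfl

omit [DecidableEq I] in
theorem pairing_add_left (a b y : I → ℤ) : pairing A (a + b) y = pairing A a y + pairing A b y := by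
  simp [pairing, Matrix.mulVec_add]

omit [DecidableEq I] in
theorem pairing_add_right (a y z : I → ℤ) :
    pairing A a (y + z) = pairing A a y + pairing A a z := by
  simp [pairing]

theorem pairing_single_right (a : I → ℤ) (i : I) :
    pairing A a (Pi.single i 1) = rootEval A.transpose i a := by
  rw [rootEval_transpose, pairing, single_one_dotProduct]

theorem pairing_single_left (y : I → ℤ) (i : I) :
    pairing A (Pi.single i 1) y = rootEval A i y := by
  rw [rootEval_eq, pairing, Matrix.dotProduct_mulVec, dotProduct_single_one]

/-- Both sides are ⟨a, y⟩ - ⟨a, h_i⟩⟨α_i, y⟩. The transposed matrix is the one that governs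
reflections of the root lattice. -/
theorem pairing_reflection (i : I) (a y : I → ℤ) :
    pairing A (reflection A.transpose i a) y = pairing A a (reflection A i y) := by
  have h1 : ∀ c : ℤ, pairing A (a - c • Pi.single i 1) y =
      pairing A a y - c * pairing A (Pi.single i 1) y := fun c => by
    simp only [pairing, Matrix.mulVec_sub, Matrix.mulVec_smul, dotProduct_sub, dotProduct_smul,
      smul_eq_mul]
  have h2 : ∀ c : ℤ, pairing A a (y - c • Pi.single i 1) =
      pairing A a y - c * pairing A a (Pi.single i 1) := fun c => by
    simp only [pairing, sub_dotProduct, smul_dotProduct, smul_eq_mul]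
  rw [reflection_apply, reflection_apply, h1, h2, pairing_single_left, pairing_single_right,
    mul_comm]

variable {A}

theorem wordProd_nil : wordProd A [] = 1 := rfl

theorem wordProd_cons (i : I) (l : List I) :
    wordProd A (i :: l) = reflection A i * wordProd A l := by
  simp [wordProd]

theorem wordProd_append (l l' : List I) :
    wordProd A (l ++ l') = wordProd A l * wordProd A l' := by
  simp [wordProd]

theorem wordProd_singleton (i : I) : wordProd A [i] = reflection A i := by
  simp [wordProd]

theorem pairing_wordProd (l : List I) (a y : I → ℤ) :
    pairing A (wordProd A.transpose l a) y = pairing A a (wordProd A l.reverse y) := by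
  induction l generalizing y with
  | nil => rfl
  | cons i l ih =>
    rw [wordProd_cons, Module.End.mul_apply, pairing_reflection, ih, List.reverse_cons,
      wordProd_append, wordProd_singleton, Module.End.mul_apply]

theorem reflection_mul_self {i : I} (hi : A i i = 2) : reflection A i * reflection A i = 1 := by
  refine LinearMap.ext fun y => ?_
  have h : rootEval A i (Pi.single i 1) = 2 := by
    simp [rootEval, Pi.single_apply, hi]
  rw [Module.End.mul_apply, reflection_apply A i (reflection A i y), reflection_apply, map_sub,
    map_smul, h, Module.End.one_apply]
  module

theorem reflection_single {i : I} (hi : A i i = 2) :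
    reflection A i (Pi.single i 1) = -Pi.single i 1 := by
  have h : rootEval A i (Pi.single i 1) = 2 := by
    simp [rootEval, Pi.single_apply, hi]
  rw [reflection_apply, h]
  module

theorem wordProd_mul_reverse {l : List I} (hl : ∀ i ∈ l, A i i = 2) :
    wordProd A l * wordProd A l.reverse = 1 := by
  induction l with
  | nil => rfl
  | cons i l ih =>
    rw [List.reverse_cons, wordProd_append, wordProd_cons, wordProd_singleton]
    have h1 := ih fun j hj => hl j (List.mem_cons_of_mem _ hj)
    calc _ = reflection A i * (wordProd A l * wordProd A l.reverse) * reflection A i := by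
          simp only [mul_assoc]
      _ = 1 := by rw [h1, mul_one, reflection_mul_self (hl i List.mem_cons_self)]

theorem wordProd_reverse_mul {l : List I} (hl : ∀ i ∈ l, A i i = 2) :
    wordProd A l.reverse * wordProd A l = 1 := by
  have := wordProd_mul_reverse (l := l.reverse) fun i hi => hl i (List.mem_reverse.1 hi)
  rwa [List.reverse_reverse] at this

theorem wordProd_injective {l : List I} (hl : ∀ i ∈ l, A i i = 2) :
    Function.Injective (wordProd A l) :=
  Function.LeftInverse.injective (g := wordProd A l.reverse)
    fun y => LinearMap.congr_fun (wordProd_reverse_mul hl) y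

/-- Each reflection with letter in `B` subtracts a multiple of a basis vector indexed by `B`. -/
theorem wordProd_sub_apply {B : Set I} {l : List I} (hl : ∀ i ∈ l, i ∈ B) (y : I → ℤ) {j : I}
    (hj : j ∉ B) : wordProd A l y j = y j := by
  induction l with
  | nil => rfl
  | cons i l ih =>
    have hij : j ≠ i := fun h => hj (h ▸ hl i List.mem_cons_self)
    rw [wordProd_cons, Module.End.mul_apply, reflection_apply, Pi.sub_apply,
      ih fun k hk => hl k (List.mem_cons_of_mem _ hk), Pi.smul_apply, Pi.single_eq_of_ne hij]
    simp

/-- The sign character `a ↦ (-1)^{⟨a, y⟩}` of the root lattice. -/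
noncomputable def signChar (A : Matrix I I ℤ) (y : I → ℤ) : AddChar (I → ℤ) ℂ where
  toFun a := (-1 : ℂ) ^ pairing A a y
  map_zero_eq_one' := by simp [pairing]
  map_add_eq_mul' a b := by
    rw [pairing_add_left, zpow_add₀ (by norm_num)]

omit [DecidableEq I] in
theorem signChar_apply (y a : I → ℤ) : signChar A y a = (-1 : ℂ) ^ pairing A a y := rfl

/-- The sum of the coroots inverted along a word. -/
def inversionSum (A : Matrix I I ℤ) : List I → I → ℤ
  | [] => 0
  | i :: l => inversionSum A l + wordProd A l.reverse (Pi.single i 1)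

end Pairing

/-! ### The torus action and products of the Ad(m_i) -/

namespace Realization

variable {I : Type*} [Fintype I] [DecidableEq I] {C : CartanDatum I}
  {g : Type*} [AddCommGroup g] [Module ℂ g] [LieSuperalgebra g]
  (R : Realization C g)

theorem adTorus_apply (s : AddChar (I → ℤ) ℂ) {a : I → ℤ} {x : g} (hx : x ∈ R.rootSpace a) :
    R.adTorus s x = s a • x := by
  have h : (LinearEquiv.ofBijective (DirectSum.coeLinearMap R.rootSpace)
      R.rootSpace_isInternal).symm x = DirectSum.lof ℂ (I → ℤ) (fun a => R.rootSpace a) a ⟨x, hx⟩ := by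
    rw [LinearEquiv.symm_apply_eq]
    exact (DirectSum.coeLinearMap_lof R.rootSpace a ⟨x, hx⟩).symm
  unfold adTorus
  rw [LinearMap.comp_apply, LinearEquiv.coe_coe, h, DirectSum.toModule_lof]
  rfl

/-- Two linear maps agree if they agree on all root spaces. -/
theorem end_ext {φ ψ : Module.End ℂ g} (h : ∀ a, ∀ x ∈ R.rootSpace a, φ x = ψ x) : φ = ψ := by
  have : LinearMap.eqLocus φ ψ = ⊤ := by
    rw [eq_top_iff, ← R.iSup_rootSpace]
    exact iSup_le fun a x hx => h a x hx
  exact LinearMap.ext fun x => by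
    have : x ∈ LinearMap.eqLocus φ ψ := this ▸ Submodule.mem_top
    exact this

theorem adTorus_mul (s t : AddChar (I → ℤ) ℂ) :
    R.adTorus s * R.adTorus t = R.adTorus (s * t) :=
  R.end_ext fun a x hx => by
    rw [Module.End.mul_apply, R.adTorus_apply t hx, map_smul, R.adTorus_apply s hx,
      R.adTorus_apply _ hx, smul_smul, AddChar.mul_apply, mul_comm]

theorem adTorus_one : R.adTorus 1 = 1 :=
  R.end_ext fun a x hx => by
    rw [R.adTorus_apply 1 hx, AddChar.one_apply, one_smul, Module.End.one_apply]

theorem adTorus_cartan (s : AddChar (I → ℤ) ℂ) (h : R.cartan) : R.adTorus s (h : g) = h := by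
  rw [R.adTorus_apply s (a := 0) (by rw [R.rootSpace_zero]; exact h.2), AddChar.map_zero_eq_one, one_smul]

theorem isAut_adTorus (s : AddChar (I → ℤ) ℂ) : IsAut (R.adTorus s) := by
  have hbr : ∀ x z, R.adTorus s (br x z) = br (R.adTorus s x) (R.adTorus s z) := by
    intro x z
    have hx : x ∈ ⨆ a, R.rootSpace a := R.iSup_rootSpace ▸ Submodule.mem_top
    have hz : z ∈ ⨆ a, R.rootSpace a := R.iSup_rootSpace ▸ Submodule.mem_top
    refine Submodule.iSup_induction _
      (motive := fun x => R.adTorus s (br x z) = br (R.adTorus s x) (R.adTorus s z)) hx ?_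
      (by simp) ?_
    · intro a x hx
      refine Submodule.iSup_induction _
        (motive := fun z => R.adTorus s (br x z) = br (R.adTorus s x) (R.adTorus s z)) hz ?_
        (by simp) ?_
      · intro b z hz
        rw [R.adTorus_apply s hx, R.adTorus_apply s hz,
          R.adTorus_apply s (R.rootSpace_br _ _ _ _ hx hz), AddChar.map_add_eq_mul]
        simp [smul_smul, mul_comm]
      · intro y z hy hz
        simp only [map_add, hy, hz]
    · intro x y hx hy
      simp only [map_add, LinearMap.add_apply, hx, hy]
  have heven := (R.generates.map_br_of_generators (R.adTorus s) (by
    rintro x (hx | ⟨i, rfl⟩ | ⟨i, rfl⟩)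
    · exact ⟨0, R.cartan_even hx, by rw [R.adTorus_cartan s ⟨x, hx⟩]; exact R.cartan_even hx⟩
    · exact ⟨_, R.e_mem i, by
        rw [R.adTorus_apply s (R.e_mem_rootSpace i)]; exact Submodule.smul_mem _ _ (R.e_mem i)⟩
    · exact ⟨_, R.f_mem i, by
        rw [R.adTorus_apply s (R.f_mem_rootSpace i)]; exact Submodule.smul_mem _ _ (R.f_mem i)⟩)
    (fun x _ z => hbr x z)).1
  refine ⟨?_, heven, hbr⟩
  have hinv : ∀ t : AddChar (I → ℤ) ℂ, R.adTorus t⁻¹ * R.adTorus t = 1 := fun t => by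
    rw [R.adTorus_mul, inv_mul_cancel, R.adTorus_one]
  refine Function.bijective_iff_has_inverse.2 ⟨R.adTorus s⁻¹, fun y => ?_, fun y => ?_⟩
  · exact LinearMap.congr_fun (hinv s) y
  · have := hinv s⁻¹
    rw [inv_inv] at this
    exact LinearMap.congr_fun this y

theorem adWord_nil : R.adWord [] = 1 := rfl

theorem adWord_cons (i : I) (l : List I) : R.adWord (i :: l) = R.adM i * R.adWord l := by
  simp [adWord]

theorem adWord_append (l l' : List I) : R.adWord (l ++ l') = R.adWord l * R.adWord l' := by
  simp [adWord]

theorem adWord_singleton (i : I) : R.adWord [i] = R.adM i := by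
  simp [adWord]

variable [FiniteDimensional ℂ g]

include R in
/-- Off-diagonal entries in rows of even nodes are nonpositive. -/
theorem exists_nat_of_ne {i j : I} (hi : C.p i = 0) (hj : j ≠ i) : ∃ n : ℕ, C.A i j = -n := by
  -- ad f_i kills e_j, so e_j is a lowest weight vector of weight a_ij.
  obtain ⟨n, hn⟩ := (R.isWeylTriple hi).exists_nat (R.e_ne_zero j) (R.br_f_e_of_ne hi hj)
    (R.cartan_e (R.coroot i) j)
  rw [R.root_coroot] at hn
  exact ⟨n, by exact_mod_cast hn⟩

/-- Both sides are automorphisms, so generators suffice. For j ≠ i, e_j is a lowest weight vector of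
the triple of `i`, and f_j one of the opposite triple, both of weight a_ij; on these the square is
the sign (-1)^{a_ij}. -/
theorem adM_mul_self {i : I} (hi : C.p i = 0) :
    R.adM i * R.adM i = R.adTorus (signChar C.A (Pi.single i 1)) := by
  have hT := R.isAut_adM hi
  have W := R.isWeylTriple hi
  refine R.aut_ext (hT.mul hT) (R.isAut_adTorus _) (fun h => ?_) (fun j => ?_) (fun j => ?_)
  · rw [Module.End.mul_apply, R.adM_cartan hi, R.adM_cartan hi, R.adTorus_cartan]
    congr 1
    rw [map_sub, map_smul, R.root_coroot_of_even hi, smul_eq_mul]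
    module
  · rw [R.adTorus_apply _ (R.e_mem_rootSpace j), signChar_apply, pairing_single_left,
      Module.End.mul_apply]
    have hA : rootEval C.A j (Pi.single i 1) = C.A i j := by simp [rootEval, Pi.single_apply]
    rw [hA]
    by_cases hj : j = i
    · subst hj
      rw [R.adM_e hi, map_neg, R.adM_f hi, C.diag_even j hi]
      norm_num
    · obtain ⟨n, hn⟩ := R.exists_nat_of_ne hi hj
      rw [W.T_T_lowest (n := n) (R.br_f_e_of_ne hi hj)
        (by rw [R.cartan_e, R.root_coroot, hn]; push_cast; rfl), hn]
      simp [← inv_pow]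
  · rw [R.adTorus_apply _ (R.f_mem_rootSpace j), signChar_apply, Module.End.mul_apply]
    have hA : pairing C.A (-Pi.single j 1) (Pi.single i 1) = -C.A i j := by
      simp [pairing, Matrix.mulVec_neg]
    rw [hA]
    by_cases hj : j = i
    · subst hj
      rw [R.adM_f hi, map_neg, R.adM_e hi, C.diag_even j hi]
      norm_num
    · obtain ⟨n, hn⟩ := R.exists_nat_of_ne hi hj
      rw [W.symm.T_T_lowest (n := n)
        (by rw [LinearMap.neg_apply, R.e_f, if_neg (Ne.symm hj), neg_zero])
        (by rw [LinearMap.neg_apply, R.cartan_f, R.root_coroot, hn, neg_neg]; push_cast; rfl), hn]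
      simp

theorem isAut_adWord {l : List I} (hl : ∀ i ∈ l, C.p i = 0) : IsAut (R.adWord l) := by
  induction l with
  | nil => exact isAut_one
  | cons i l ih =>
    rw [R.adWord_cons]
    exact (R.isAut_adM (hl i List.mem_cons_self)).mul
      (ih fun j hj => hl j (List.mem_cons_of_mem _ hj))

theorem adWord_mem_rootSpace {l : List I} (hl : ∀ i ∈ l, C.p i = 0) {a : I → ℤ} {x : g}
    (hx : x ∈ R.rootSpace a) : R.adWord l x ∈ R.rootSpace (wordProd C.A.transpose l a) := by
  induction l with
  | nil => exact hx
  | cons i l ih =>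
    rw [R.adWord_cons, wordProd_cons]
    exact R.adM_mem_rootSpace (hl i List.mem_cons_self)
      (ih fun j hj => hl j (List.mem_cons_of_mem _ hj))

/-- The innermost Ad(m_i)² is a torus sign; moving it past the remaining word carries the coroot h_i
to the coroot inverted at that letter, and the signs accumulate. -/
theorem adWord_reverse_mul {l : List I} (hl : ∀ i ∈ l, C.p i = 0) :
    R.adWord l.reverse * R.adWord l = R.adTorus (signChar C.A (inversionSum C.A l)) := by
  induction l with
  | nil =>
    refine R.end_ext fun a x hx => ?_
    rw [R.adTorus_apply _ hx, signChar_apply]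
    simp [inversionSum, pairing, adWord]
  | cons i l ih =>
    have hl' : ∀ j ∈ l, C.p j = 0 := fun j hj => hl j (List.mem_cons_of_mem _ hj)
    refine R.end_ext fun a x hx => ?_
    have h1 : R.adWord (i :: l).reverse * R.adWord (i :: l) =
        R.adWord l.reverse * (R.adM i * R.adM i) * R.adWord l := by
      rw [List.reverse_cons, R.adWord_append, R.adWord_singleton, R.adWord_cons]
      simp only [mul_assoc]
    rw [h1, R.adM_mul_self (hl i List.mem_cons_self), Module.End.mul_apply, Module.End.mul_apply,
      R.adTorus_apply _ (R.adWord_mem_rootSpace hl' hx), map_smul, ← Module.End.mul_apply, ih hl',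
      R.adTorus_apply _ hx, R.adTorus_apply _ hx, smul_smul, signChar_apply, signChar_apply,
      signChar_apply, pairing_wordProd, inversionSum, pairing_add_right,
      zpow_add₀ (by norm_num), mul_comm]

/-- An automorphism which maps the generators of one node to those of another intertwines the
corresponding operators. -/
theorem mul_adM_of_apply {X : Module.End ℂ g} (hX : IsAut X) {i j : I}
    (he : X (R.e i) = R.e j) (hf : X (R.f i) = R.f j) : X * R.adM i = R.adM j * X := by
  have h1 : X * nilExp (br (R.e i)) = nilExp (br (R.e j)) * X :=
    nilExp_intertwine (R.isNilpotent_br_e i) (R.isNilpotent_br_e j) (by rw [hX.mul_br, he])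
  have h2 : X * nilExp (-br (R.f i)) = nilExp (-br (R.f j)) * X :=
    nilExp_intertwine (R.isNilpotent_br_f i).neg (R.isNilpotent_br_f j).neg
      (by rw [mul_neg, hX.mul_br, hf, neg_mul])
  rw [adM, adM, mul_assoc, ← mul_assoc X, h1, mul_assoc, ← mul_assoc X, h2, mul_assoc, h1]
  simp only [mul_assoc]

/-- ω exchanges e_i and -f_i, turning exp(e) exp(-f) exp(e) into exp(-f) exp(e) exp(-f), which is
the same operator by `T_eq'`. -/
theorem IsChevalley.mul_adM {R : Realization C g} {ω : Module.End ℂ g} (hω : R.IsChevalley ω)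
    {i : I} (hi : C.p i = 0) : ω * R.adM i = R.adM i * ω := by
  have hf : ω (R.f i) = -R.e i := by rw [hω.map_f, hi]; simp
  have h1 : ω * nilExp (br (R.e i)) = nilExp (-br (R.f i)) * ω :=
    nilExp_intertwine (R.isNilpotent_br_e i) (R.isNilpotent_br_f i).neg
      (by rw [hω.isAut.mul_br, hω.map_e, map_neg])
  have h2 : ω * nilExp (-br (R.f i)) = nilExp (br (R.e i)) * ω :=
    nilExp_intertwine (R.isNilpotent_br_f i).neg (R.isNilpotent_br_e i)
      (by rw [mul_neg, hω.isAut.mul_br, hf, map_neg, neg_mul, neg_neg])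
  conv_rhs => rw [(R.isWeylTriple hi).T_eq']
  rw [adM, mul_assoc, ← mul_assoc, h1, mul_assoc, ← mul_assoc ω, h2, mul_assoc, h1]
  simp only [mul_assoc]

theorem IsChevalley.mul_adWord {R : Realization C g} {ω : Module.End ℂ g} (hω : R.IsChevalley ω)
    {l : List I} (hl : ∀ i ∈ l, C.p i = 0) : ω * R.adWord l = R.adWord l * ω := by
  induction l with
  | nil => rw [R.adWord_nil, mul_one, one_mul]
  | cons i l ih =>
    rw [R.adWord_cons, ← mul_assoc, hω.mul_adM (hl i List.mem_cons_self), mul_assoc,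
      ih fun j hj => hl j (List.mem_cons_of_mem _ hj), mul_assoc]

end Realization

end SuperSatake

namespace SuperSatake

open LieSuperalgebra Matrix

/-! ### Comparing roots and coroots through the symmetrizer -/

section Scale

variable {I : Type*} [Fintype I] [DecidableEq I] (C : CartanDatum I)

/-- The embedding of the root lattice into the coroot lattice given by the symmetrizer. -/
def scale : (I → ℤ) →ₗ[ℤ] (I → ℤ) := LinearMap.pi fun j => C.d j • LinearMap.proj j

omit [DecidableEq I] in
theorem scale_apply (a : I → ℤ) (j : I) : scale C a j = C.d j * a j := rfl

omit [DecidableEq I] in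
theorem scale_injective : Function.Injective (scale C) := fun _ _ h =>
  funext fun j => mul_left_cancel₀ (C.d_ne_zero j) (congrFun h j)

theorem scale_single (i : I) : scale C (Pi.single i 1) = C.d i • Pi.single i 1 := by
  ext j
  by_cases h : j = i
  · subst h; simp [scale_apply]
  · simp [scale_apply, h]

/-- This is symmetrizability d_i a_ij = d_j a_ji. It transfers identities between Weyl group
elements from roots to coroots and back. -/
theorem scale_reflection (i : I) (a : I → ℤ) :
    scale C (reflection C.A.transpose i a) = reflection C.A i (scale C a) := by
  have h : rootEval C.A i (scale C a) = rootEval C.A.transpose i a * C.d i := by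
    simp only [rootEval, LinearMap.sum_apply, LinearMap.smul_apply, LinearMap.proj_apply,
      Matrix.transpose_apply, smul_eq_mul, scale_apply, Finset.sum_mul]
    refine Finset.sum_congr rfl fun j _ => ?_
    linear_combination -(a j) * C.symm i j
  rw [reflection_apply, reflection_apply, map_sub, map_smul, scale_single, h, smul_smul]

theorem scale_wordProd (l : List I) (a : I → ℤ) :
    scale C (wordProd C.A.transpose l a) = wordProd C.A l (scale C a) := by
  induction l with
  | nil => rfl
  | cons i l ih =>
    rw [wordProd_cons, wordProd_cons, Module.End.mul_apply, Module.End.mul_apply, scale_reflection,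
      ih]

theorem wordProd_transpose_eq_iff (l l' : List I) :
    wordProd C.A.transpose l = wordProd C.A.transpose l' ↔ wordProd C.A l = wordProd C.A l' := by
  constructor
  · intro h
    refine LinearMap.pi_ext' fun j => LinearMap.ext_ring ?_
    have h1 := congrArg (scale C) (LinearMap.congr_fun h (Pi.single j 1))
    rw [scale_wordProd, scale_wordProd, scale_single, map_smul, map_smul] at h1
    exact smul_right_injective _ (C.d_ne_zero j) h1
  · intro h
    refine LinearMap.ext fun a => scale_injective C ?_
    rw [scale_wordProd, scale_wordProd, h]

theorem isReducedWord_transpose_iff (B : Set I) (l : List I) :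
    IsReducedWord C.A.transpose B l ↔ IsReducedWord C.A B l := by
  simp only [IsReducedWord, wordProd_transpose_eq_iff]

variable {C} {B : Set I} (hB : ∀ i ∈ B, C.p i = 0)

include hB

omit [DecidableEq I] in
theorem diag_of_word {l : List I} (hl : ∀ i ∈ l, i ∈ B) : ∀ i ∈ l, C.A i i = 2 :=
  fun i hi => C.diag_even i (hB i (hl i hi))

omit [DecidableEq I] in
theorem diag_transpose_of_word {l : List I} (hl : ∀ i ∈ l, i ∈ B) :
    ∀ i ∈ l, C.A.transpose i i = 2 := diag_of_word hB hl

theorem pairing_wordProd_wordProd {l : List I} (hl : ∀ i ∈ l, i ∈ B) (a y : I → ℤ) :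
    pairing C.A (wordProd C.A.transpose l a) (wordProd C.A l y) = pairing C.A a y := by
  rw [pairing_wordProd, ← Module.End.mul_apply, wordProd_reverse_mul (diag_of_word hB hl)]
  rfl

/-- A Weyl group element which maps a simple root to a simple root maps the corresponding simple
coroots to each other. -/
theorem wordProd_coroot_of_root {l : List I} (hl : ∀ i ∈ l, i ∈ B) {i q : I} (hi : i ∈ B)
    (hq : q ∈ B) (h : wordProd C.A.transpose l (Pi.single i 1) = Pi.single q 1) :
    wordProd C.A l (Pi.single i 1) = Pi.single q 1 := by
  have h1 : wordProd C.A l (C.d i • Pi.single i 1) = C.d q • Pi.single q 1 := by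
    rw [← scale_single, ← scale_wordProd, h, scale_single]
  -- The invariant norm of α_j is 2d_j, so simple roots in one orbit have the same `d`.
  have hnorm : ∀ j ∈ B, pairing C.A (Pi.single j 1) (C.d j • Pi.single j 1) = 2 * C.d j :=
    fun j hj => by
      rw [pairing_single_left, map_smul, rootEval_eq, single_one_vecMul, smul_eq_mul, mul_comm]
      congr 1
      exact C.diag_even j (hB j hj)
  have h2 : 2 * C.d q = 2 * C.d i := by
    rw [← hnorm q hq, ← hnorm i hi, ← h1, ← h, pairing_wordProd_wordProd hB hl]
  have h3 : C.d q = C.d i := by omega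
  rw [map_smul, h3] at h1
  exact smul_right_injective _ (C.d_ne_zero i) h1

theorem wordProd_mul_reflection {l : List I} (hl : ∀ i ∈ l, i ∈ B) {i q : I} (hi : i ∈ B)
    (hq : q ∈ B) (h : wordProd C.A.transpose l (Pi.single i 1) = Pi.single q 1) :
    wordProd C.A.transpose l * reflection C.A.transpose i =
      reflection C.A.transpose q * wordProd C.A.transpose l := by
  refine LinearMap.ext fun a => ?_
  rw [Module.End.mul_apply, Module.End.mul_apply, reflection_apply, reflection_apply, map_sub,
    map_smul, h, ← pairing_single_right, ← pairing_single_right,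
    ← wordProd_coroot_of_root hB hl hi hq h, pairing_wordProd_wordProd hB hl]

end Scale

/-! ### Reduced words -/

section Reduced

variable {I : Type*} [Fintype I] [DecidableEq I] {A : Matrix I I ℤ} {B : Set I}

theorem IsReducedWord.of_append_left {l l' : List I} (h : IsReducedWord A B (l ++ l')) :
    IsReducedWord A B l := by
  refine ⟨fun i hi => h.1 i (List.mem_append_left _ hi), fun m hm hml => ?_⟩
  have := h.2 (m ++ l') (fun i hi => (List.mem_append.1 hi).elim (hm i)
    fun hi => h.1 i (List.mem_append_right _ hi)) (by rw [wordProd_append, wordProd_append, hml])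
  simp only [List.length_append] at this
  omega

theorem IsReducedWord.of_append_right {l l' : List I} (h : IsReducedWord A B (l ++ l')) :
    IsReducedWord A B l' := by
  refine ⟨fun i hi => h.1 i (List.mem_append_right _ hi), fun m hm hml => ?_⟩
  have := h.2 (l ++ m) (fun i hi => (List.mem_append.1 hi).elim
    (fun hi => h.1 i (List.mem_append_left _ hi)) (hm i))
    (by rw [wordProd_append, wordProd_append, hml])
  simp only [List.length_append] at this
  omega

theorem isReducedWord_nil : IsReducedWord A B [] :=
  ⟨by simp, fun _ _ _ => Nat.zero_le _⟩

theorem exists_isReducedWord {l : List I} (hl : ∀ i ∈ l, i ∈ B) :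
    ∃ l', IsReducedWord A B l' ∧ wordProd A l' = wordProd A l ∧ l'.length ≤ l.length := by
  classical
  have hex : ∃ n, ∃ l' : List I, (∀ i ∈ l', i ∈ B) ∧ wordProd A l' = wordProd A l ∧
      l'.length = n := ⟨_, l, hl, rfl, rfl⟩
  obtain ⟨l', h1, h2, h3⟩ := Nat.find_spec hex
  refine ⟨l', ⟨h1, fun m hm hml => ?_⟩, h2, ?_⟩
  · rw [h3]
    exact Nat.find_min' hex ⟨m, hm, hml.trans h2, rfl⟩
  · rw [h3]
    exact Nat.find_min' hex ⟨l, hl, rfl, rfl⟩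

theorem IsReducedWord.of_length_le {l l' : List I} (h : IsReducedWord A B l)
    (hl' : ∀ i ∈ l', i ∈ B) (heq : wordProd A l' = wordProd A l) (hlen : l'.length ≤ l.length) :
    IsReducedWord A B l' :=
  ⟨hl', fun m hm hml => hlen.trans (h.2 m hm (hml.trans heq))⟩

end Reduced

/-! ### Exchange and deletion from positivity of roots -/

namespace Realization

variable {I : Type*} [Fintype I] [DecidableEq I] {C : CartanDatum I}
  {g : Type*} [AddCommGroup g] [Module ℂ g] [LieSuperalgebra g] [FiniteDimensional ℂ g]
  (R : Realization C g) {B : Set I} (hB : ∀ i ∈ B, C.p i = 0)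

include hB R

theorem rootSpace_wordProd_ne_bot {l : List I} (hl : ∀ i ∈ l, i ∈ B) {a : I → ℤ}
    (ha : R.rootSpace a ≠ ⊥) : R.rootSpace (wordProd C.A.transpose l a) ≠ ⊥ := by
  obtain ⟨x, hx, hx0⟩ := Submodule.exists_mem_ne_zero_of_ne_bot ha
  have hl' : ∀ i ∈ l, C.p i = 0 := fun i hi => hB i (hl i hi)
  intro h
  have h1 := R.adWord_mem_rootSpace hl' hx
  rw [h] at h1
  exact hx0 ((R.isAut_adWord hl').bijective.1 (((Submodule.mem_bot ℂ).1 h1).trans (map_zero _).symm))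

theorem rootSpace_wordProd_single_ne_bot {l : List I} (hl : ∀ i ∈ l, i ∈ B) (i : I) :
    R.rootSpace (wordProd C.A.transpose l (Pi.single i 1)) ≠ ⊥ :=
  R.rootSpace_wordProd_ne_bot hB hl
    ((Submodule.ne_bot_iff _).2 ⟨_, R.e_mem_rootSpace i, R.e_ne_zero i⟩)

theorem wordProd_single_nonneg_or {l : List I} (hl : ∀ i ∈ l, i ∈ B) (i : I) :
    0 ≤ wordProd C.A.transpose l (Pi.single i 1) ∨
      wordProd C.A.transpose l (Pi.single i 1) ≤ 0 :=
  R.nonneg_or_nonpos (R.rootSpace_wordProd_single_ne_bot hB hl i)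

omit [FiniteDimensional ℂ g] R in
theorem wordProd_single_ne_zero {l : List I} (hl : ∀ i ∈ l, i ∈ B) (i : I) :
    wordProd C.A.transpose l (Pi.single i 1) ≠ 0 := by
  intro h
  have := wordProd_injective (diag_transpose_of_word hB hl) (h.trans (map_zero _).symm)
  simpa using congrFun this i

omit [FiniteDimensional ℂ g] in
/-- A simple reflection makes only one positive root negative. -/
theorem eq_single_of_reflection_nonpos {a : I → ℤ} {q : I} (hq : q ∈ B)
    (ha : R.rootSpace a ≠ ⊥) (ha0 : a ≠ 0) (hpos : 0 ≤ a)
    (hneg : reflection C.A.transpose q a ≤ 0) : a = Pi.single q 1 := by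
  -- The reflection alters only the coordinate `q`, so every other coordinate is both nonnegative
  -- and nonpositive. Thus `a` is a positive multiple of α_q, and higher multiples are not roots.
  have h1 : ∀ j, j ≠ q → a j = 0 := fun j hj => by
    have h := hneg j
    rw [reflection_apply, Pi.sub_apply, Pi.smul_apply, Pi.single_eq_of_ne hj] at h
    have h' := hpos j
    simp only [smul_zero, sub_zero, Pi.zero_apply] at h h'
    omega
  have h2 : a = Pi.single q (a q) := by
    ext j
    by_cases h : j = q
    · subst h; simp
    · rw [h1 j h, Pi.single_eq_of_ne h]
  have h3 : a q ≠ 0 := fun h => ha0 (by rw [h2, h]; simp)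
  have h4 : ¬ 2 ≤ a q := fun h => ha (by rw [h2]; exact R.rootSpace_multiple (hB q hq) h)
  have h5 := hpos q
  simp only [Pi.zero_apply] at h5
  rw [h2, show a q = 1 by omega]

/-- The exchange condition, in terms of roots. -/
theorem exists_split_of_nonpos {l : List I} (hl : ∀ i ∈ l, i ∈ B) {i : I}
    (hneg : wordProd C.A.transpose l (Pi.single i 1) ≤ 0) :
    ∃ l₁ q l₂, l = l₁ ++ q :: l₂ ∧
      wordProd C.A.transpose l₂ (Pi.single i 1) = Pi.single q 1 := by
  induction l with
  | nil =>
    have := hneg i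
    simp [wordProd_nil] at this
  | cons q l₂ ih =>
    have hl₂ : ∀ i ∈ l₂, i ∈ B := fun j hj => hl j (List.mem_cons_of_mem _ hj)
    -- Reading from the right, the first letter that makes the root negative meets it as its own
    -- simple root.
    rcases R.wordProd_single_nonneg_or hB hl₂ i with h | h
    · refine ⟨[], q, l₂, rfl, ?_⟩
      rw [wordProd_cons, Module.End.mul_apply] at hneg
      exact R.eq_single_of_reflection_nonpos hB (hl q List.mem_cons_self)
        (R.rootSpace_wordProd_single_ne_bot hB hl₂ i) (wordProd_single_ne_zero hB hl₂ i) h hneg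
    · obtain ⟨l₁, p, l₃, rfl, h'⟩ := ih hl₂ h
      exact ⟨q :: l₁, p, l₃, rfl, h'⟩

/-- The deletion condition. -/
theorem exists_shorter_of_nonpos {l : List I} (hl : ∀ i ∈ l, i ∈ B) {i : I} (hi : i ∈ B)
    (hneg : wordProd C.A.transpose l (Pi.single i 1) ≤ 0) :
    ∃ l' : List I, (∀ j ∈ l', j ∈ B) ∧ l'.length + 1 = l.length ∧
      wordProd C.A.transpose (l' ++ [i]) = wordProd C.A.transpose l := by
  obtain ⟨l₁, q, l₂, rfl, h⟩ := R.exists_split_of_nonpos hB hl hneg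
  have hl₂ : ∀ j ∈ l₂, j ∈ B := fun j hj => hl j (by simp [hj])
  refine ⟨l₁ ++ l₂, fun j hj => hl j ?_, by simp; omega, ?_⟩
  · rcases List.mem_append.1 hj with h | h <;> simp [h]
  · rw [List.append_assoc, wordProd_append, wordProd_append, wordProd_append, wordProd_singleton,
      wordProd_cons, wordProd_mul_reflection hB hl₂ hi (hl q (by simp)) h]

/-- If the image were negative, deletion would give a word for the same element with two letters
fewer. -/
theorem nonneg_of_isReducedWord_append {l : List I} {i : I}
    (h : IsReducedWord C.A.transpose B (l ++ [i])) :
    0 ≤ wordProd C.A.transpose l (Pi.single i 1) := by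
  have hl : ∀ j ∈ l, j ∈ B := h.of_append_left.1
  have hi : i ∈ B := h.1 i (by simp)
  refine (R.wordProd_single_nonneg_or hB hl i).resolve_right fun hneg => ?_
  obtain ⟨l', h1, h2, h3⟩ := R.exists_shorter_of_nonpos hB hl hi hneg
  have h4 : wordProd C.A.transpose l' = wordProd C.A.transpose (l ++ [i]) := by
    rw [wordProd_append l, ← h3, wordProd_append, mul_assoc, wordProd_singleton,
      reflection_mul_self (show C.A.transpose i i = 2 from C.diag_even i (hB i hi)), mul_one]
  have := h.2 l' h1 h4
  simp at this
  omega

/-- Any word `m` for the product sends α_i to a negative root; deletion turns it into a word for `l`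
with one letter fewer, which is at least as long as `l`. -/
theorem isReducedWord_append_singleton {l : List I} {i : I} (hi : i ∈ B)
    (h : IsReducedWord C.A.transpose B l)
    (hpos : 0 ≤ wordProd C.A.transpose l (Pi.single i 1)) :
    IsReducedWord C.A.transpose B (l ++ [i]) := by
  have hlB : ∀ j ∈ l ++ [i], j ∈ B := fun j hj => by
    rcases List.mem_append.1 hj with hj | hj
    · exact h.1 j hj
    · rwa [List.mem_singleton.1 hj]
  refine ⟨hlB, fun m hm hml => ?_⟩
  have hAi : C.A.transpose i i = 2 := C.diag_even i (hB i hi)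
  have hneg : wordProd C.A.transpose m (Pi.single i 1) ≤ 0 := by
    rw [hml, wordProd_append, wordProd_singleton, Module.End.mul_apply, reflection_single hAi,
      map_neg]
    exact neg_nonpos.2 hpos
  obtain ⟨l', h1, h2, h3⟩ := R.exists_shorter_of_nonpos hB hm hi hneg
  have h4 : wordProd C.A.transpose l' = wordProd C.A.transpose l := by
    have h5 : wordProd C.A.transpose (l' ++ [i]) * reflection C.A.transpose i =
        wordProd C.A.transpose (l ++ [i]) * reflection C.A.transpose i := by rw [h3, hml]
    rw [wordProd_append, wordProd_append, wordProd_singleton, mul_assoc, mul_assoc,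
      reflection_mul_self hAi, mul_one, mul_one] at h5
    exact h5
  have := h.2 l' h1 h4
  simp
  omega

end Realization

end SuperSatake

namespace SuperSatake

open LieSuperalgebra Matrix

/-! ### Rank two: alternating words and orbits of a simple root -/

section RankTwo

variable {I : Type*} [Fintype I] [DecidableEq I] {A : Matrix I I ℤ} {B : Set I}

theorem IsReducedWord.ne_of_cons_cons (hA : ∀ i ∈ B, A i i = 2) {j k : I} {l : List I}
    (h : IsReducedWord A B (j :: k :: l)) : j ≠ k := by
  rintro rfl
  have hj := hA j (h.1 j List.mem_cons_self)
  have := h.2 l (fun i hi => h.1 i (by simp [hi]))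
    (by rw [wordProd_cons, wordProd_cons, ← mul_assoc, reflection_mul_self hj, one_mul])
  simp at this

/-- A reduced word in two letters is alternating. -/
theorem IsReducedWord.eq_alternatingWord (hA : ∀ i ∈ B, A i i = 2) {i k : I} {v : List I}
    (hv : ∀ j ∈ v, j = i ∨ j = k) (h : IsReducedWord A B (v ++ [i])) :
    v = CoxeterSystem.alternatingWord i k v.length := by
  induction v with
  | nil => rfl
  | cons j v ih =>
    have hred : IsReducedWord A B (v ++ [i]) :=
      IsReducedWord.of_append_right (l := [j]) (by simpa using h)
    have hv' := ih (fun m hm => hv m (List.mem_cons_of_mem _ hm)) hred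
    rw [List.length_cons, CoxeterSystem.alternatingWord_succ', ← hv']
    congr 1
    have hj := hv j List.mem_cons_self
    cases v with
    | nil =>
      have hne := h.ne_of_cons_cons hA
      simpa using hj.resolve_left hne
    | cons m v =>
      have hne := h.ne_of_cons_cons hA
      rw [List.length_cons, CoxeterSystem.alternatingWord_succ'] at hv'
      have hm := (List.cons.inj hv').1
      rw [List.length_cons]
      by_cases he : Even v.length
      · rw [if_pos he] at hm
        rw [if_neg (by simpa [Nat.even_add_one] using he)]
        exact hj.resolve_right (hm ▸ hne)
      · rw [if_neg he] at hm
        rw [if_pos (by simpa [Nat.even_add_one] using he)]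
        exact hj.resolve_left (hm ▸ hne)

variable (A) in
/-- The images of a simple root under the alternating words in `i` and `k`. -/
theorem wordProd_alternatingWord_succ (i k : I) (n : ℕ) (a : I → ℤ) :
    wordProd A (CoxeterSystem.alternatingWord i k (n + 1)) a =
      reflection A (if Even n then k else i)
        (wordProd A (CoxeterSystem.alternatingWord i k n) a) := by
  rw [CoxeterSystem.alternatingWord_succ', wordProd_cons, Module.End.mul_apply]

/-- The linear combination `c α_i + d α_k`. -/
def comb (i k : I) (c d : ℤ) : I → ℤ := c • Pi.single i 1 + d • Pi.single k 1

variable {i k : I}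

omit [Fintype I] in
theorem comb_left (hik : i ≠ k) (c d : ℤ) : comb i k c d i = c := by simp [comb, hik]

omit [Fintype I] in
theorem comb_right (hik : i ≠ k) (c d : ℤ) : comb i k c d k = d := by simp [comb, hik.symm]

theorem rootEval_comb_left (hi : A i i = 2) (c d : ℤ) :
    rootEval A.transpose i (comb i k c d) = 2 * c + A i k * d := by
  have h : ∀ j m, rootEval A.transpose j (Pi.single m 1) = A j m := fun j m => by
    simp [rootEval, Pi.single_apply]
  rw [comb, map_add, map_smul, map_smul, h, h, hi]
  simp only [smul_eq_mul]; ring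

theorem rootEval_comb_right (hk : A k k = 2) (c d : ℤ) :
    rootEval A.transpose k (comb i k c d) = 2 * d + A k i * c := by
  have h : ∀ j m, rootEval A.transpose j (Pi.single m 1) = A j m := fun j m => by
    simp [rootEval, Pi.single_apply]
  rw [comb, map_add, map_smul, map_smul, h, h, hk]
  simp only [smul_eq_mul]; ring

theorem reflection_comb_left (hi : A i i = 2) (c d : ℤ) :
    reflection A.transpose i (comb i k c d) = comb i k (-c - A i k * d) d := by
  rw [reflection_apply, rootEval_comb_left hi, comb, comb]
  module

theorem reflection_comb_right (hk : A k k = 2) (c d : ℤ) :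
    reflection A.transpose k (comb i k c d) = comb i k c (-d - A k i * c) := by
  rw [reflection_apply, rootEval_comb_right hk, comb, comb]
  module

omit [Fintype I] in
theorem comb_one_zero : comb i k 1 0 = Pi.single i 1 := by simp [comb]

omit [Fintype I] in
theorem comb_zero_one : comb i k 0 1 = Pi.single k 1 := by simp [comb]

/-- If `A i k * A k i ≥ 4`, the images of a simple root under alternating words are never simple. -/
theorem exists_comb_of_four_le (hi : A i i = 2) (hk : A k k = 2) (hik0 : A i k < 0)
    (hki0 : A k i < 0) (h4 : 4 ≤ A i k * A k i) (n : ℕ) :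
    ∃ c d : ℤ, 1 ≤ c ∧ 1 ≤ d ∧
      wordProd A.transpose (CoxeterSystem.alternatingWord i k (n + 1)) (Pi.single i 1) =
        comb i k c d ∧ (Even n → 2 * c ≤ -A i k * d) ∧ (¬Even n → 2 * d ≤ -A k i * c) := by
  -- The two inequalities say that the coordinate changed by the next reflection does not decrease;
  -- the product being at least 4 passes them on.
  induction n with
  | zero =>
    refine ⟨1, -A k i, le_rfl, by omega, ?_, fun _ => by linarith, fun h => absurd Even.zero h⟩
    rw [wordProd_alternatingWord_succ, if_pos Even.zero]
    change reflection A.transpose k (Pi.single i 1) = _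
    rw [← comb_one_zero (i := i) (k := k), reflection_comb_right hk]
    norm_num
  | succ n ih =>
    obtain ⟨c, d, hc, hd, hx, he, ho⟩ := ih
    rw [wordProd_alternatingWord_succ, hx]
    by_cases hn : Even n
    · have hn' : ¬Even (n + 1) := by simpa [Nat.even_add_one] using hn
      rw [if_neg hn', reflection_comb_left hi]
      have := he hn
      refine ⟨_, d, by linarith, hd, rfl, fun h => absurd h hn', fun _ => ?_⟩
      nlinarith [mul_le_mul_of_nonneg_right h4 (show (0:ℤ) ≤ d by omega),
        mul_le_mul_of_nonneg_left this (show (0:ℤ) ≤ -A k i by omega)]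
    · have hn' : Even (n + 1) := by simpa [Nat.even_add_one] using hn
      rw [if_pos hn', reflection_comb_right hk]
      have := ho hn
      refine ⟨c, _, hc, by linarith, rfl, fun _ => ?_, fun h => absurd hn' h⟩
      nlinarith [mul_le_mul_of_nonneg_right h4 (show (0:ℤ) ≤ c by omega),
        mul_le_mul_of_nonneg_left this (show (0:ℤ) ≤ -A i k by omega)]

/-- The rank two types A₁×A₁, A₂, B₂ and G₂, in both orders of the nodes, and everything else. -/
theorem eq_or_four_le_mul {a b : ℕ} (h : a = 0 ↔ b = 0) :
    (a = 0 ∧ b = 0) ∨ (a = 1 ∧ b = 1) ∨ (a = 1 ∧ b = 2) ∨ (a = 2 ∧ b = 1) ∨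
      (a = 1 ∧ b = 3) ∨ (a = 3 ∧ b = 1) ∨ (0 < a ∧ 0 < b ∧ 4 ≤ b * a) := by
  by_cases h4 : 4 ≤ b * a
  · have : a ≠ 0 := by rintro rfl; simp at h4
    have : b ≠ 0 := by rintro rfl; simp at h4
    omega
  · by_cases ha0 : a = 0
    · exact Or.inl ⟨ha0, h.1 ha0⟩
    · have hb0 : b ≠ 0 := fun hb => ha0 (h.2 hb)
      have h1 : a ≤ 3 := by nlinarith [Nat.pos_of_ne_zero hb0]
      have h2 : b ≤ 3 := by nlinarith [Nat.pos_of_ne_zero ha0]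
      clear h
      interval_cases a <;> interval_cases b <;> omega

end RankTwo

/-! ### Rank two: operators on simple root vectors -/

namespace Realization

variable {I : Type*} [Fintype I] [DecidableEq I] {C : CartanDatum I}
  {g : Type*} [AddCommGroup g] [Module ℂ g] [LieSuperalgebra g] [FiniteDimensional ℂ g]
  (R : Realization C g)

theorem adM_adM_apply {j : I} (hj : C.p j = 0) {a : I → ℤ} {x : g} (hx : x ∈ R.rootSpace a) :
    R.adM j (R.adM j x) = (-1 : ℂ) ^ rootEval C.A.transpose j a • x := by
  rw [← Module.End.mul_apply, R.adM_mul_self hj, R.adTorus_apply _ hx, signChar_apply,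
    pairing_single_right]

/-- A vector of weight zero is fixed by a simple reflection if the next root space vanishes. -/
theorem adM_eq_self {j : I} (hj : C.p j = 0) {a : I → ℤ} {x : g} (hx : x ∈ R.rootSpace a)
    (h0 : rootEval C.A.transpose j a = 0) (hbot : R.rootSpace (-Pi.single j 1 + a) = ⊥) :
    R.adM j x = x := by
  have hf : br (R.f j) x = 0 := by
    have := R.rootSpace_br _ _ _ _ (R.f_mem_rootSpace j) hx
    rwa [hbot, Submodule.mem_bot] at this
  have := (R.isWeylTriple hj).T_lowest (n := 0) hf (by rw [R.br_coroot j a x hx, h0]; simp)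
  simpa using this

omit [FiniteDimensional ℂ g] in
theorem br_coroot_e (i j : I) : br (R.coroot i : g) (R.e j) = (C.A i j : ℂ) • R.e j := by
  rw [R.cartan_e, R.root_coroot]

omit [FiniteDimensional ℂ g] in
theorem br_e_e_comm {i k : I} (hi : C.p i = 0) (hk : C.p k = 0) :
    br (R.e k) (R.e i) = -br (R.e i) (R.e k) :=
  br_swap_of_even _ _ _ (R.e_mem_even hi) (hk ▸ R.e_mem k)

/-- If `α_i(h_k) = -1`, then `Ad(m_k)` maps `e_i` to `[e_k, e_i]`. -/
theorem adM_e_of_neg_one {i k : I} (hik : i ≠ k) (hk : C.p k = 0) (h : C.A k i = -1) :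
    R.adM k (R.e i) = br (R.e k) (R.e i) := by
  have := (R.isWeylTriple hk).T_lowest (n := 1) (R.br_f_e_of_ne hk hik)
    (by rw [R.br_coroot_e, h]; simp)
  simpa using this

section

variable {R} {i k : I} (hik : i ≠ k) (hi : C.p i = 0) (hk : C.p k = 0)

include hik hi hk

omit hik hi in
theorem adM_e_mem_comb :
    R.adM k (R.e i) ∈ R.rootSpace (comb i k 1 (-C.A k i)) := by
  have h := R.adM_mem_rootSpace hk (R.e_mem_rootSpace i)
  rwa [← comb_one_zero (i := i) (k := k), reflection_comb_right (C.diag_even k hk), neg_zero,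
    mul_one, zero_sub] at h

omit hik hi in
theorem adM_adM_e :
    R.adM k (R.adM k (R.e i)) = (-1 : ℂ) ^ C.A k i • R.e i := by
  rw [R.adM_adM_apply hk (R.e_mem_rootSpace i)]
  simp [rootEval, Pi.single_apply]

omit hi in
theorem adM_e_of_zero (h : C.A k i = 0) : R.adM k (R.e i) = R.e i := by
  have := (R.isWeylTriple hk).T_lowest (n := 0) (R.br_f_e_of_ne hk hik)
    (by rw [R.br_coroot_e, h]; simp)
  simpa using this

/-- Type A₂: Ad(m_k) e_i = [e_k, e_i] = -[e_i, e_k] = -Ad(m_i) e_k, and Ad(m_i)² e_k = -e_k. -/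
theorem adWord_two_of_neg_one (h1 : C.A k i = -1) (h2 : C.A i k = -1) :
    R.adM i (R.adM k (R.e i)) = R.e k := by
  rw [R.adM_e_of_neg_one hik hk h1, R.br_e_e_comm hi hk, ← R.adM_e_of_neg_one hik.symm hi h2,
    map_neg, adM_adM_e hi, h2]
  simp

/-- Type B₂ with α_i long: Ad(m_k) e_i has degree α_i + 2α_k, on which h_i acts by 0, and 2α_k is
not a root, so Ad(m_i) fixes it. What remains is Ad(m_k)² e_i, with even exponent. -/
theorem adWord_three_of_long (h1 : C.A k i = -2) (h2 : C.A i k = -1) :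
    R.adM k (R.adM i (R.adM k (R.e i))) = R.e i := by
  have hu := adM_e_mem_comb (R := R) (i := i) hk
  rw [R.adM_eq_self hi hu, adM_adM_e hk, h1]
  · norm_num
  · rw [rootEval_comb_left (C.diag_even i hi), h1, h2]; norm_num
  · have : -Pi.single i 1 + comb i k 1 (-C.A k i) = Pi.single k 2 := by
      rw [h1]
      ext j
      by_cases hj : j = k
      · subst hj; simp [comb, hik.symm]
      · simp [comb, hj]
    rw [this]
    exact R.rootSpace_multiple hk le_rfl

/-- Type B₂ with α_i short: [e_i, e_k] is the zero weight vector of the string of weights -2, 0, 2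
generated by e_k, and Ad(m_i) acts on it by -1. This cancels the sign of Ad(m_k)² e_i. -/
theorem adWord_three_of_short (h1 : C.A k i = -1) (h2 : C.A i k = -2) :
    R.adM k (R.adM i (R.adM k (R.e i))) = R.e i := by
  have W := R.isWeylTriple hi
  have hF := R.br_f_e_of_ne hi hik.symm
  have hH : br (R.coroot i : g) (R.e k) = (-((2 : ℕ) : ℂ)) • R.e k := by
    rw [R.br_coroot_e, h2]; simp
  have hFE := (W.pow_succ_apply hF hH).2 1
  have h3 : R.adM i (br (R.e i) (R.e k)) = -br (R.e i) (R.e k) := by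
    have h4 := LinearMap.congr_fun W.T_E (R.e k)
    rw [Module.End.mul_apply, Module.End.mul_apply, W.T_lowest hF hH, LinearMap.neg_apply,
      map_smul, hFE] at h4
    rw [h4, smul_smul]
    norm_num
  have h5 : R.adM i (R.adM k (R.e i)) = -R.adM k (R.e i) := by
    rw [R.adM_e_of_neg_one hik hk h1, R.br_e_e_comm hi hk, map_neg, h3]
  rw [h5, map_neg, adM_adM_e hk, h1]
  simp

-- Type G₂: the word is a palindrome whose middle letter fixes its argument, a vector of weight
-- zero. The inner pair Ad(m_i)² and the outer pair Ad(m_k)² then contribute -1 each.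
omit hik in
theorem adWord_five (h3 : C.A k i * C.A i k = 3)
    (hbot : R.rootSpace (-Pi.single k 1 +
      comb i k (-1 - C.A i k * -C.A k i) (-C.A k i)) = ⊥) (hodd : Odd (C.A k i)) :
    R.adM k (R.adM i (R.adM k (R.adM i (R.adM k (R.e i))))) = R.e i := by
  have hu := adM_e_mem_comb (R := R) (i := i) hk
  have hu2 := R.adM_mem_rootSpace hi hu
  rw [reflection_comb_left (C.diag_even i hi)] at hu2
  rw [R.adM_eq_self hk hu2 _ hbot, R.adM_adM_apply hi hu, map_smul, adM_adM_e hk,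
    rootEval_comb_left (C.diag_even i hi), smul_smul, hodd.neg_one_zpow]
  · have : 2 * 1 + C.A i k * -C.A k i = -1 := by linear_combination -h3
    rw [this]
    norm_num
  · rw [rootEval_comb_right (C.diag_even k hk)]
    linear_combination C.A k i * h3

set_option maxHeartbeats 1000000 in
include R in
/-- If an alternating word, all of whose suffixes keep `α_i` positive, maps `α_i` to a simple root,
then its operator maps `e_i` to the corresponding simple root vector. -/
theorem adWord_alternatingWord {n : ℕ}
    (hpos : ∀ m ≤ n, 0 ≤ wordProd C.A.transpose (CoxeterSystem.alternatingWord i k m)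
      (Pi.single i 1)) {q : I} (hq : q = i ∨ q = k)
    (hval : wordProd C.A.transpose (CoxeterSystem.alternatingWord i k n) (Pi.single i 1) =
      Pi.single q 1) :
    R.adWord (CoxeterSystem.alternatingWord i k n) (R.e i) = R.e q := by
  have hAi := C.diag_even i hi
  have hAk := C.diag_even k hk
  set x : ℕ → I → ℤ := fun n =>
    wordProd C.A.transpose (CoxeterSystem.alternatingWord i k n) (Pi.single i 1) with hx
  have hx0 : x 0 = comb i k 1 0 := comb_one_zero.symm
  have hodd : ∀ m c d, Even m → x m = comb i k c d → x (m + 1) = comb i k c (-d - C.A k i * c) := by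
    intro m c d hm h
    change wordProd _ _ _ = _
    rw [wordProd_alternatingWord_succ, if_pos hm]
    rw [← reflection_comb_right hAk, ← h]
  have heven : ∀ m c d, ¬Even m → x m = comb i k c d → x (m + 1) = comb i k (-c - C.A i k * d) d := by
    intro m c d hm h
    change wordProd _ _ _ = _
    rw [wordProd_alternatingWord_succ, if_neg hm]
    rw [← reflection_comb_left hAi, ← h]
  have hneg : ∀ m c d, x m = comb i k c d → (c < 0 ∨ d < 0) → n < m := by
    intro m c d h hcd
    by_contra hle
    have h1 := hpos m (by omega)
    change 0 ≤ x m at h1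
    rw [h] at h1
    have h2 := h1 i
    have h3 := h1 k
    rw [comb_left hik] at h2
    rw [comb_right hik] at h3
    simp only [Pi.zero_apply] at h2 h3
    omega
  have hnot : ∀ c d, x n = comb i k c d → 1 ≤ c → 1 ≤ d → False := by
    intro c d h hc hd
    have h1 : x n = Pi.single q 1 := hval
    rw [h] at h1
    rcases hq with rfl | rfl
    · have := congrFun h1 k
      rw [comb_right hik, Pi.single_eq_of_ne hik.symm] at this
      omega
    · have := congrFun h1 i
      rw [comb_left hik, Pi.single_eq_of_ne hik] at this
      omega
  have hqi : x n = comb i k 1 0 → q = i := fun h => by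
    rcases hq with rfl | rfl
    · rfl
    · have h1 : x n = Pi.single q 1 := hval
      rw [h, comb_one_zero] at h1
      simpa [Pi.single_eq_of_ne hik] using congrFun h1 i
  have hqk : x n = comb i k 0 1 → q = k := fun h => by
    rcases hq with rfl | rfl
    · have h1 : x n = Pi.single q 1 := hval
      rw [h, comb_zero_one] at h1
      simpa [Pi.single_eq_of_ne hik] using congrFun h1 q
    · rfl
  have hzero : n = 0 → R.adWord (CoxeterSystem.alternatingWord i k n) (R.e i) = R.e q := by
    rintro rfl
    rw [hqi hx0]
    rfl
  -- `a` and `b` are the negatives of a_ki and a_ik. In the types of finite order the orbit is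
  -- followed until a coordinate becomes negative, which bounds `n`; `hnot` then discards every `n`
  -- whose root is not simple.
  obtain ⟨a, ha⟩ := R.exists_nat_of_ne hk hik
  obtain ⟨b, hb⟩ := R.exists_nat_of_ne hi hik.symm
  have hx1 : x 1 = comb i k 1 a := by
    rw [hodd 0 1 0 Even.zero hx0, ha]; norm_num
  have hx2 : x 2 = comb i k (-1 + b * a) a := by
    rw [heven 1 1 a (by decide) hx1, hb]; congr 1; ring
  have hx3 : x 3 = comb i k (-1 + b * a) (-a + a * (-1 + b * a)) := by
    rw [hodd 2 _ _ (by decide) hx2, ha]; congr 1; ring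
  have hzero_iff : a = 0 ↔ b = 0 := by
    have h := C.symm i k
    rw [ha, hb] at h
    constructor
    · rintro rfl
      have := (mul_eq_zero.1 (h.trans (by simp))).resolve_left (C.d_ne_zero i)
      omega
    · rintro rfl
      have := (mul_eq_zero.1 (h.symm.trans (by simp))).resolve_left (C.d_ne_zero k)
      omega
  have hcases := eq_or_four_le_mul hzero_iff
  rcases hcases with ⟨rfl, rfl⟩ | ⟨rfl, rfl⟩ | ⟨rfl, rfl⟩ | ⟨rfl, rfl⟩ | ⟨rfl, rfl⟩ | ⟨rfl, rfl⟩ |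
    ⟨ha0, hb0, h4⟩
  · have hn := hneg 2 _ _ hx2 (by simp)
    interval_cases n
    · exact hzero rfl
    · rw [hqi (by simpa using hx1)]
      exact adM_e_of_zero hik hk (by simpa using ha)
  · have hn := hneg 3 _ _ hx3 (by simp)
    interval_cases n
    · exact hzero rfl
    · exact (hnot _ _ hx1 (by simp) (by simp)).elim
    · rw [hqk (by simpa using hx2)]
      exact adWord_two_of_neg_one hik hi hk (by simpa using ha) (by simpa using hb)
  · have hx4 := heven 3 _ _ (by decide) hx3
    rw [hb] at hx4
    have hn := hneg 4 _ _ hx4 (by norm_num)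
    interval_cases n
    · exact hzero rfl
    · exact (hnot _ _ hx1 (by simp) (by simp)).elim
    · exact (hnot _ _ hx2 (by simp) (by simp)).elim
    · rw [hqi (by simpa using hx3)]
      exact adWord_three_of_short hik hi hk (by simpa using ha) (by simpa using hb)
  · have hx4 := heven 3 _ _ (by decide) hx3
    rw [hb] at hx4
    have hn := hneg 4 _ _ hx4 (by norm_num)
    interval_cases n
    · exact hzero rfl
    · exact (hnot _ _ hx1 (by simp) (by simp)).elim
    · exact (hnot _ _ hx2 (by simp) (by simp)).elim
    · rw [hqi (by simpa using hx3)]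
      exact adWord_three_of_long hik hi hk (by simpa using ha) (by simpa using hb)
  · have hx4 := heven 3 _ _ (by decide) hx3
    have hx5 := hodd 4 _ _ (by decide) hx4
    have hx6 := heven 5 _ _ (by decide) hx5
    rw [hb] at hx4 hx5 hx6
    rw [ha] at hx5 hx6
    have hn := hneg 6 _ _ hx6 (by norm_num)
    interval_cases n
    · exact hzero rfl
    · exact (hnot _ _ hx1 (by simp) (by simp)).elim
    · exact (hnot _ _ hx2 (by simp) (by simp)).elim
    · exact (hnot _ _ hx3 (by simp) (by simp)).elim
    · exact (hnot _ _ hx4 (by simp) (by simp)).elim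
    · rw [hqi (by simpa using hx5)]
      refine adWord_five hi hk (by rw [ha, hb]; norm_num) ?_ (by rw [ha]; decide)
      have : -Pi.single k 1 + comb i k (-1 - C.A i k * -C.A k i) (-C.A k i) = Pi.single i 2 := by
        rw [ha, hb]
        ext j
        by_cases hj : j = i
        · subst hj; simp [comb, hik]
        · simp [comb, hj]
      rw [this]
      exact R.rootSpace_multiple hi le_rfl
  · have hx4 := heven 3 _ _ (by decide) hx3
    have hx5 := hodd 4 _ _ (by decide) hx4
    have hx6 := heven 5 _ _ (by decide) hx5
    rw [hb] at hx4 hx5 hx6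
    rw [ha] at hx5 hx6
    have hn := hneg 6 _ _ hx6 (by norm_num)
    interval_cases n
    · exact hzero rfl
    · exact (hnot _ _ hx1 (by simp) (by simp)).elim
    · exact (hnot _ _ hx2 (by simp) (by simp)).elim
    · exact (hnot _ _ hx3 (by simp) (by simp)).elim
    · exact (hnot _ _ hx4 (by simp) (by simp)).elim
    · rw [hqi (by simpa using hx5)]
      refine adWord_five hi hk (by rw [ha, hb]; norm_num) ?_ (by rw [ha]; decide)
      -- In this orientation of G₂ the degree to exclude is 2α_i + 2α_k, which r_i carries to 2α_k.
      have h1 : -Pi.single k 1 + comb i k (-1 - C.A i k * -C.A k i) (-C.A k i) = comb i k 2 2 := by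
        rw [ha, hb]
        ext j
        simp only [comb, Pi.add_apply, Pi.neg_apply, Pi.smul_apply, smul_eq_mul]
        ring
      rw [h1]
      by_contra hne
      refine R.rootSpace_wordProd_ne_bot (B := {i}) (by simpa using hi) (l := [i]) (by simp) hne ?_
      rw [wordProd_singleton, reflection_comb_left hAi, hb]
      have h2 : comb i k (-2 - -((1 : ℕ) : ℤ) * 2) 2 = Pi.single k 2 := by
        ext j
        by_cases hj : j = k
        · subst hj; simp [comb]
        · simp [comb, hj]
      rw [h2]
      exact R.rootSpace_multiple hk le_rfl
  · cases n with
    | zero => exact hzero rfl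
    | succ n =>
      obtain ⟨c, d, hc, hd, h, -⟩ := exists_comb_of_four_le hAi hAk (by omega) (by omega)
        (by rw [ha, hb]; nlinarith) n
      exact (hnot c d h hc hd).elim

end

end Realization

end SuperSatake

/-! ### Independence of the reduced word -/

namespace SuperSatake

open LieSuperalgebra Matrix

theorem alternatingWord_eq_append {I : Type*} (i k : I) {m n : ℕ} (h : m ≤ n) :
    ∃ u, CoxeterSystem.alternatingWord i k n = u ++ CoxeterSystem.alternatingWord i k m := by
  induction n, h using Nat.le_induction with
  | base => exact ⟨[], rfl⟩
  | succ n _ ih =>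
    obtain ⟨u, hu⟩ := ih
    exact ⟨_ :: u, by rw [CoxeterSystem.alternatingWord_succ', hu, List.cons_append]⟩

theorem one_le_sum_of_nonneg {I : Type*} [Fintype I] {a : I → ℤ} (h : 0 ≤ a) (h0 : a ≠ 0) : 1 ≤ ∑ j, a j := by
  by_contra hlt
  have h1 : ∑ j, a j = 0 := le_antisymm (by omega) (Finset.sum_nonneg fun j _ => h j)
  exact h0 (funext fun j => (Finset.sum_eq_zero_iff_of_nonneg fun j _ => h j).1 h1 j
    (Finset.mem_univ j))

namespace Realization

variable {I : Type*} [Fintype I] [DecidableEq I] {C : CartanDatum I}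
  {g : Type*} [AddCommGroup g] [Module ℂ g] [LieSuperalgebra g] [FiniteDimensional ℂ g]
  (R : Realization C g) {B : Set I} (hB : ∀ i ∈ B, C.p i = 0)

include hB

/-- As `v` keeps α_i positive, `v ++ [i]` is still reduced, so `v` is the alternating word, which
ends in `k` if nonempty. Each suffix keeps α_i positive too, and the explicit computation applies.
-/
theorem adWord_apply_of_two_letters {i k : I} (hik : i ≠ k) (hi : i ∈ B) (hk : k ∈ B)
    {v : List I} (hv : ∀ j ∈ v, j = i ∨ j = k) (hred : IsReducedWord C.A.transpose B v) {q : I}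
    (hq : q = i ∨ q = k) (hval : wordProd C.A.transpose v (Pi.single i 1) = Pi.single q 1) :
    R.adWord v (R.e i) = R.e q := by
  have hred' : IsReducedWord C.A.transpose B (v ++ [i]) :=
    R.isReducedWord_append_singleton hB hi hred
      (by rw [hval]; exact Pi.single_nonneg.2 zero_le_one)
  have halt := hred'.eq_alternatingWord (A := C.A.transpose) (fun j hj => C.diag_even j (hB j hj)) hv
  rw [halt]
  refine adWord_alternatingWord (R := R) hik (hB i hi) (hB k hk) (fun m hm => ?_) hq (halt ▸ hval)
  obtain ⟨u, hu⟩ := alternatingWord_eq_append i k hm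
  rw [← halt] at hu
  rw [hu, List.append_assoc] at hred'
  exact R.nonneg_of_isReducedWord_append hB hred'.of_append_right

-- ω commutes with the operator and sends each e_i to -f_i.
omit hB in
theorem adWord_f_of_e {l : List I} (hl : ∀ i ∈ l, C.p i = 0) {i j : I}
    (h : R.adWord l (R.e i) = R.e j) : R.adWord l (R.f i) = R.f j := by
  obtain ⟨ω, hω⟩ := R.exists_isChevalley
  have h1 := LinearMap.congr_fun (hω.mul_adWord hl) (R.e i)
  rw [Module.End.mul_apply, Module.End.mul_apply, h, hω.map_e, hω.map_e, map_neg, neg_inj] at h1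
  exact h1.symm

include R in
/-- A reduced word ending in `k` whose Weyl group element maps `α_i` to a simple root is
equivalent to `u ++ v` with `v` a nonempty word in `i` and `k`, such that both `u` and `v` map
simple roots to simple roots. -/
theorem exists_factorization {l : List I} {i j k : I} (hi : i ∈ B)
    (hl : IsReducedWord C.A.transpose B (l ++ [k]))
    (h : wordProd C.A.transpose (l ++ [k]) (Pi.single i 1) = Pi.single j 1) :
    ∃ u v : List I, IsReducedWord C.A.transpose B (u ++ v) ∧ v ≠ [] ∧
      (∀ m ∈ v, m = i ∨ m = k) ∧
      wordProd C.A.transpose (u ++ v) = wordProd C.A.transpose (l ++ [k]) ∧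
      u.length + v.length = l.length + 1 ∧ ∃ q, (q = i ∨ q = k) ∧
      wordProd C.A.transpose v (Pi.single i 1) = Pi.single q 1 ∧
      wordProd C.A.transpose u (Pi.single q 1) = Pi.single j 1 := by
  classical
  have hk : k ∈ B := hl.1 k (by simp)
  -- A factorization with `u` shortest is chosen, so that `u` is a minimal coset representative; a
  -- letter that it makes negative could be moved from `u` to `v`.
  have hex : ∃ a, ∃ u v : List I, (∀ m ∈ u, m ∈ B) ∧ v ≠ [] ∧ (∀ m ∈ v, m = i ∨ m = k) ∧
      wordProd C.A.transpose (u ++ v) = wordProd C.A.transpose (l ++ [k]) ∧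
      u.length + v.length = l.length + 1 ∧ u.length = a :=
    ⟨_, l, [k], hl.of_append_left.1, by simp, by simp, rfl, by simp, rfl⟩
  obtain ⟨u, v, hu, hv0, hv, hw, hlen, ha⟩ := Nat.find_spec hex
  have hvB : ∀ m ∈ v, m ∈ B := fun m hm => by rcases hv m hm with rfl | rfl <;> assumption
  have hred : IsReducedWord C.A.transpose B (u ++ v) :=
    hl.of_length_le (fun m hm => (List.mem_append.1 hm).elim (hu m) (hvB m)) hw
      (by simp only [List.length_append, List.length_singleton]; omega)
  have hpos : ∀ m, (m = i ∨ m = k) → 0 ≤ wordProd C.A.transpose u (Pi.single m 1) := by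
    intro m hm
    have hmB : m ∈ B := by rcases hm with rfl | rfl <;> assumption
    refine (R.wordProd_single_nonneg_or hB hu m).resolve_right fun hneg => ?_
    obtain ⟨u', h1, h2, h3⟩ := R.exists_shorter_of_nonpos hB hu hmB hneg
    have := Nat.find_min' hex ⟨u', m :: v, h1, by simp, by
      rintro p hp
      rcases List.mem_cons.1 hp with rfl | hp
      · exact hm
      · exact hv p hp, by
      rw [← hw, ← List.singleton_append, ← List.append_assoc, wordProd_append, h3,
        ← wordProd_append], by simp; omega, rfl⟩
    omega
  refine ⟨u, v, hred, hv0, hv, hw, hlen, ?_⟩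
  set x := wordProd C.A.transpose v (Pi.single i 1) with hx
  have hux : wordProd C.A.transpose u x = Pi.single j 1 := by
    rw [hx, ← Module.End.mul_apply, ← wordProd_append, hw, h]
  by_cases hik : i = k
  · exfalso
    subst hik
    have h1 := R.nonneg_of_isReducedWord_append hB hl
    rw [wordProd_append, wordProd_singleton, Module.End.mul_apply,
      reflection_single (show C.A.transpose i i = 2 from C.diag_even i (hB i hi)), map_neg] at h
    have h2 := h1 j
    rw [neg_eq_iff_eq_neg.1 h] at h2
    simp at h2
  have hxc : x = comb i k (x i) (x k) := by
    ext m
    by_cases hmi : m = i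
    · subst hmi; rw [comb_left hik]
    by_cases hmk : m = k
    · subst hmk; rw [comb_right hik]
    rw [hx, wordProd_sub_apply (B := {i, k}) (l := v) hv _ (by simp [hmi, hmk])]
    simp [comb, hmi, hmk]
  have hsum : x i • wordProd C.A.transpose u (Pi.single i 1) +
      x k • wordProd C.A.transpose u (Pi.single k 1) = Pi.single j 1 := by
    rw [← hux]
    conv_rhs => rw [hxc]
    rw [comb, map_add, map_smul, map_smul]
  have hxpos : 0 ≤ x := by
    refine (R.wordProd_single_nonneg_or hB hvB i).resolve_right fun hneg => ?_
    have h1 := congrFun hsum j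
    simp only [Pi.add_apply, Pi.smul_apply, smul_eq_mul, Pi.single_eq_same] at h1
    have h2 := mul_nonneg (neg_nonneg.2 (hneg i)) (hpos i (Or.inl rfl) j)
    have h3 := mul_nonneg (neg_nonneg.2 (hneg k)) (hpos k (Or.inr rfl) j)
    rw [← hx] at h2 h3
    simp only at h2 h3
    linarith
  have hht : ∀ m, (m = i ∨ m = k) → 1 ≤ ∑ p, wordProd C.A.transpose u (Pi.single m 1) p :=
    fun m hm => one_le_sum_of_nonneg (hpos m hm) (wordProd_single_ne_zero hB hu m)
  -- Compare heights: the images of α_i and α_k under `u` have height at least 1, and their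
  -- combination with coefficients `x i`, `x k` is α_j, of height 1.
  have hle : x i + x k ≤ 1 := by
    have h1 := congrArg (fun y : I → ℤ => ∑ p, y p) hsum
    simp only [Pi.add_apply, Pi.smul_apply, smul_eq_mul, Finset.sum_add_distrib,
      ← Finset.mul_sum, Finset.sum_pi_single', Finset.mem_univ, if_true] at h1
    have h2 := mul_le_mul_of_nonneg_left (hht i (Or.inl rfl)) (hxpos i)
    have h3 := mul_le_mul_of_nonneg_left (hht k (Or.inr rfl)) (hxpos k)
    rw [mul_one] at h2 h3
    linarith
  have h0i := hxpos i
  have h0k := hxpos k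
  simp only [Pi.zero_apply] at h0i h0k
  have hne : ¬(x i = 0 ∧ x k = 0) := fun h0 => by
    rw [h0.1, h0.2] at hxc
    exact wordProd_single_ne_zero hB hvB i (hxc.trans (by simp [comb]))
  have hcase : (x i = 1 ∧ x k = 0) ∨ (x i = 0 ∧ x k = 1) := by omega
  rcases hcase with hc | hc
  · rw [hc.1, hc.2, comb_one_zero] at hxc
    exact ⟨i, Or.inl rfl, hxc, by rw [← hxc, hux]⟩
  · rw [hc.1, hc.2, comb_zero_one] at hxc
    exact ⟨k, Or.inr rfl, hxc, by rw [← hxc, hux]⟩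

/-- The operator of a reduced word depends only on its Weyl group element, and maps Chevalley
generators to Chevalley generators whenever the Weyl group element maps simple roots to simple
roots. -/
theorem adWord_reduced (n : ℕ) :
    (∀ l l' : List I, IsReducedWord C.A.transpose B l → IsReducedWord C.A.transpose B l' →
      wordProd C.A.transpose l = wordProd C.A.transpose l' → l.length ≤ n →
      R.adWord l = R.adWord l') ∧
    ∀ (l : List I) (i j : I), IsReducedWord C.A.transpose B l → i ∈ B →
      wordProd C.A.transpose l (Pi.single i 1) = Pi.single j 1 → l.length ≤ n →
      R.adWord l (R.e i) = R.e j := by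
  induction n with
  | zero =>
    refine ⟨fun l l' hl hl' h hn => ?_, fun l i j hl hi h hn => ?_⟩
    · have h1 := hl'.2 l hl.1 h
      rw [List.length_eq_zero_iff.1 (show l.length = 0 by omega),
        List.length_eq_zero_iff.1 (show l'.length = 0 by omega)]
    · rw [List.length_eq_zero_iff.1 (show l.length = 0 by omega)] at h ⊢
      have hij : i = j := by
        have := congrFun h i
        by_contra hne
        simp [wordProd_nil, Pi.single_eq_of_ne hne] at this
      rw [hij]; rfl
  | succ n ih =>
    obtain ⟨ih1, ih2⟩ := ih
    have hMat : ∀ l l' : List I, IsReducedWord C.A.transpose B l →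
        IsReducedWord C.A.transpose B l' → wordProd C.A.transpose l = wordProd C.A.transpose l' →
        l.length ≤ n + 1 → R.adWord l = R.adWord l' := by
      intro l l' hl hl' h hn
      have h1 := hl'.2 l hl.1 h
      have h2 := hl.2 l' hl'.1 h.symm
      rcases Nat.lt_or_ge l.length (n + 1) with hlt | hge
      · exact ih1 l l' hl hl' h (by omega)
      obtain ⟨m, j, rfl⟩ := (List.eq_nil_or_concat' l').resolve_left
        (fun h0 => by rw [h0, List.length_nil] at h2; omega)
      have hj : j ∈ B := hl'.1 j (by simp)
      have hAj : C.A.transpose j j = 2 := C.diag_even j (hB j hj)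
      have hneg : wordProd C.A.transpose l (Pi.single j 1) ≤ 0 := by
        rw [h, wordProd_append, wordProd_singleton, Module.End.mul_apply, reflection_single hAj,
          map_neg]
        exact neg_nonpos.2 (R.nonneg_of_isReducedWord_append hB hl')
      obtain ⟨l₁, q, l₂, rfl, hq⟩ := R.exists_split_of_nonpos hB hl.1 hneg
      have hl₂ : IsReducedWord C.A.transpose B l₂ :=
        IsReducedWord.of_append_right (l := l₁ ++ [q]) (by simpa using hl)
      simp only [List.length_append, List.length_cons, List.length_nil] at h1 h2 hn
      -- By induction the operator of `l₂` carries e_j to e_q, so it intertwines Ad(m_j) with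
      -- Ad(m_q). The exchanged letter `q` thus moves to the right end as `j`, leaving two shorter
      -- words to compare.
      have he := ih2 l₂ j q hl₂ hj hq (by omega)
      have hl₂' : ∀ i ∈ l₂, C.p i = 0 := fun i hi => hB i (hl₂.1 i hi)
      have hcomm := R.mul_adM_of_apply (R.isAut_adWord hl₂') he (R.adWord_f_of_e hl₂' he)
      have hq' : q ∈ B := hl.1 q (by simp)
      have hw : wordProd C.A.transpose (l₁ ++ l₂) = wordProd C.A.transpose m := by
        have h3 : wordProd C.A.transpose (l₁ ++ l₂) * reflection C.A.transpose j =
            wordProd C.A.transpose m * reflection C.A.transpose j := by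
          rw [← wordProd_singleton, ← wordProd_append m, ← h, wordProd_append, mul_assoc,
            wordProd_singleton, wordProd_mul_reflection hB hl₂.1 hj hq' hq, wordProd_append,
            wordProd_cons]
        have h4 := congrArg (· * reflection C.A.transpose j) h3
        simpa only [mul_assoc, reflection_mul_self hAj, mul_one] using h4
      have hm := hl'.of_append_left
      have hB' : ∀ i ∈ l₁ ++ l₂, i ∈ B := fun i hi => hl.1 i (by
        rcases List.mem_append.1 hi with h | h <;> simp [h])
      have := ih1 (l₁ ++ l₂) m (hm.of_length_le hB' hw (by simp; omega)) hm hw (by simp; omega)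
      rw [R.adWord_append m, ← this, R.adWord_append, R.adWord_append, R.adWord_cons,
        R.adWord_singleton, ← hcomm, mul_assoc]
    refine ⟨hMat, fun l i j hl hi h hn => ?_⟩
    rcases Nat.lt_or_ge l.length (n + 1) with hlt | hge
    · exact ih2 l i j hl hi h (by omega)
    obtain ⟨l, k, rfl⟩ := (List.eq_nil_or_concat' l).resolve_left
      (fun h0 => by rw [h0] at hge; simp at hge)
    -- Independence for this length allows replacing the word by `u ++ v`; `v` is the rank two case,
    -- and `u` is shorter because `v` is nonempty.
    obtain ⟨u, v, hred, hv0, hv, hw, hlen, q, hq, hvq, huq⟩ := R.exists_factorization hB hi hl h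
    have hv1 := List.length_pos_iff.2 hv0
    simp only [List.length_append, List.length_cons, List.length_nil] at hn
    have hk : k ∈ B := hl.1 k (by simp)
    have hik : i ≠ k := by
      rintro rfl
      have h1 := R.nonneg_of_isReducedWord_append hB hl
      rw [wordProd_append, wordProd_singleton, Module.End.mul_apply,
        reflection_single (show C.A.transpose i i = 2 from C.diag_even i (hB i hi)), map_neg] at h
      have h2 := h1 j
      rw [neg_eq_iff_eq_neg.1 h] at h2
      simp at h2
    have hqB : q ∈ B := by rcases hq with rfl | rfl <;> assumption
    rw [hMat (l ++ [k]) (u ++ v) hl hred hw.symm (by simp; omega), R.adWord_append,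
      Module.End.mul_apply,
      R.adWord_apply_of_two_letters hB hik hi hk hv hred.of_append_right hq hvq]
    exact ih2 u q j hred.of_append_left hqB huq (by omega)

theorem adWord_eq_of_wordProd_eq {l l' : List I} (hl : IsReducedWord C.A.transpose B l)
    (hl' : IsReducedWord C.A.transpose B l')
    (h : wordProd C.A.transpose l = wordProd C.A.transpose l') : R.adWord l = R.adWord l' :=
  (R.adWord_reduced hB l.length).1 l l' hl hl' h le_rfl

theorem adWord_e_of_wordProd {l : List I} (hl : IsReducedWord C.A.transpose B l) {i j : I}
    (hi : i ∈ B) (h : wordProd C.A.transpose l (Pi.single i 1) = Pi.single j 1) :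
    R.adWord l (R.e i) = R.e j :=
  (R.adWord_reduced hB l.length).2 l i j hl hi h le_rfl

end Realization

end SuperSatake

namespace SuperSatake

open LieSuperalgebra Matrix

/-! ### Inverted coroots -/

section Inversions

variable {I : Type*} [Fintype I] [DecidableEq I] {A : Matrix I I ℤ} {B : Set I}

theorem IsReducedWord.reverse (hA : ∀ i ∈ B, A i i = 2) {l : List I} (hl : IsReducedWord A B l) :
    IsReducedWord A B l.reverse := by
  refine ⟨fun i hi => hl.1 i (List.mem_reverse.1 hi), fun m hm h => ?_⟩
  have h1 : wordProd A m.reverse = wordProd A l := by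
    have h2 := wordProd_reverse_mul (A := A) (l := m) fun i hi => hA i (hm i hi)
    rw [h] at h2
    have h3 := congrArg (· * wordProd A l) h2
    simpa only [mul_assoc, wordProd_reverse_mul (A := A) (l := l) fun i hi => hA i (hl.1 i hi),
      mul_one, one_mul] using h3
  simpa using hl.2 m.reverse (fun i hi => hm i (List.mem_reverse.1 hi)) h1

variable (A) in
/-- The list of coroots inverted along a word. -/
def inversionList : List I → List (I → ℤ)
  | [] => []
  | i :: l => wordProd A l.reverse (Pi.single i 1) :: inversionList l

theorem sum_inversionList (l : List I) : (inversionList A l).sum = inversionSum A l := by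
  induction l with
  | nil => rfl
  | cons i l ih => rw [inversionList, List.sum_cons, ih, inversionSum, add_comm]

theorem coroot_ne_zero_of_word (hA : ∀ i ∈ B, A i i = 2) {l : List I} (hl : ∀ i ∈ l, i ∈ B)
    (i : I) : wordProd A l (Pi.single i 1) ≠ 0 := by
  intro h
  have := wordProd_injective (fun i hi => hA i (hl i hi)) (h.trans (map_zero _).symm)
  simpa using congrFun this i

end Inversions

namespace Realization

variable {I : Type*} [Fintype I] [DecidableEq I] {C : CartanDatum I}
  {g : Type*} [AddCommGroup g] [Module ℂ g] [LieSuperalgebra g] [FiniteDimensional ℂ g]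
  (R : Realization C g) {B : Set I} (hB : ∀ i ∈ B, C.p i = 0)

include hB R

/-- The symmetrizer has constant sign on the support of a coroot. -/
theorem d_mul_d_pos {l : List I} (hl : ∀ i ∈ l, i ∈ B) {i : I} (hi : i ∈ B) (j : I)
    (hj : wordProd C.A l (Pi.single i 1) j ≠ 0) : 0 < C.d i * C.d j := by
  induction l generalizing j with
  | nil =>
    have hij : j = i := by
      by_contra hne
      exact hj (by simp [wordProd_nil, Pi.single_eq_of_ne hne])
    rw [hij]
    exact mul_self_pos.2 (C.d_ne_zero i)
  | cons k l ih =>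
    have hl' : ∀ i ∈ l, i ∈ B := fun i hi => hl i (List.mem_cons_of_mem _ hi)
    by_cases h0 : wordProd C.A l (Pi.single i 1) j = 0
    · rw [wordProd_cons, Module.End.mul_apply, reflection_apply, Pi.sub_apply, h0] at hj
      by_cases hjk : j = k
      · subst hjk
        have h1 : rootEval C.A j (wordProd C.A l (Pi.single i 1)) ≠ 0 := fun h => by
          rw [h] at hj; simp at hj
        -- A coordinate `j` newly enters the support only through some `m` in it with a_mj ≠ 0. Then
        -- a_mj and a_jm are both negative, and d_m a_mj = d_j a_jm gives d_m and d_j the same sign.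
        obtain ⟨m, -, hm⟩ : ∃ m ∈ Finset.univ,
            C.A m j * wordProd C.A l (Pi.single i 1) m ≠ 0 := by
          refine Finset.exists_ne_zero_of_sum_ne_zero (fun h => h1 ?_)
          simpa [rootEval] using h
        have h2 := ih hl' m (right_ne_zero_of_mul hm)
        have hmB : m ∈ B := by
          by_contra hmB
          apply right_ne_zero_of_mul hm
          rw [wordProd_sub_apply hl' _ hmB, Pi.single_eq_of_ne]
          rintro rfl
          exact hmB hi
        have hmj : m ≠ j := fun h => right_ne_zero_of_mul hm (h ▸ h0)
        have hjB : j ∈ B := hl j List.mem_cons_self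
        obtain ⟨a, ha⟩ := R.exists_nat_of_ne (hB m hmB) hmj.symm
        obtain ⟨b, hb⟩ := R.exists_nat_of_ne (hB j hjB) hmj
        have ha0 : C.A m j ≠ 0 := left_ne_zero_of_mul hm
        have h3 := C.symm m j
        rw [ha] at ha0 h3
        rw [hb] at h3
        have hapos : (0 : ℤ) < a := by omega
        have hbpos : (0 : ℤ) < b := by
          rcases Nat.eq_zero_or_pos b with rfl | h
          · have := (mul_eq_zero.1 (h3.trans (by simp))).resolve_left (C.d_ne_zero m)
            omega
          · exact_mod_cast h
        have h4 : 0 < C.d m * C.d j := by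
          have h5 : C.d m * C.d j * b = a * (C.d m * C.d m) := by linear_combination C.d m * h3
          have h6 := mul_pos hapos (mul_self_pos.2 (C.d_ne_zero m))
          rw [← h5] at h6
          exact pos_of_mul_pos_left h6 hbpos.le
        have h7 := mul_pos h2 h4
        have h8 : C.d i * C.d m * (C.d m * C.d j) = C.d i * C.d j * (C.d m * C.d m) := by ring
        rw [h8] at h7
        exact pos_of_mul_pos_left h7 (mul_self_nonneg _)
      · simp [Pi.single_eq_of_ne hjk] at hj
    · exact ih hl' j h0

omit hB R [FiniteDimensional ℂ g] in
theorem d_mul_coroot (l : List I) (i j : I) :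
    C.d i * wordProd C.A l (Pi.single i 1) j =
      C.d j * wordProd C.A.transpose l (Pi.single i 1) j := by
  have := congrFun (scale_wordProd C l (Pi.single i 1)) j
  rw [scale_single, map_smul, scale_apply] at this
  simpa using this.symm

/-- The coordinates of the coroot are those of the root times d_j / d_i, and d_i, d_j have equal
signs on the support. -/
theorem coroot_nonneg {l : List I} (hl : ∀ i ∈ l, i ∈ B) {i : I} (hi : i ∈ B)
    (h : 0 ≤ wordProd C.A.transpose l (Pi.single i 1)) :
    0 ≤ wordProd C.A l (Pi.single i 1) := by
  intro j
  by_cases h0 : wordProd C.A l (Pi.single i 1) j = 0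
  · rw [h0]; rfl
  · have h1 := R.d_mul_d_pos hB hl hi j h0
    have h2 := d_mul_coroot (C := C) l i j
    have h3 := mul_nonneg h1.le (h j)
    have h4 : C.d i * C.d j * wordProd C.A.transpose l (Pi.single i 1) j =
      wordProd C.A l (Pi.single i 1) j * (C.d i * C.d i) := by linear_combination -C.d i * h2
    rw [h4] at h3
    exact nonneg_of_mul_nonneg_left h3 (mul_self_pos.2 (C.d_ne_zero i))

theorem coroot_nonpos {l : List I} (hl : ∀ i ∈ l, i ∈ B) {i : I} (hi : i ∈ B)
    (h : wordProd C.A.transpose l (Pi.single i 1) ≤ 0) :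
    wordProd C.A l (Pi.single i 1) ≤ 0 := by
  intro j
  by_cases h0 : wordProd C.A l (Pi.single i 1) j = 0
  · rw [h0]; rfl
  · have h1 := R.d_mul_d_pos hB hl hi j h0
    have h2 := d_mul_coroot (C := C) l i j
    have h3 := mul_nonneg h1.le (neg_nonneg.2 (h j))
    have h4 : C.d i * C.d j * -wordProd C.A.transpose l (Pi.single i 1) j =
      -wordProd C.A l (Pi.single i 1) j * (C.d i * C.d i) := by linear_combination C.d i * h2
    rw [h4] at h3
    exact neg_nonneg.1 (nonneg_of_mul_nonneg_left h3 (mul_self_pos.2 (C.d_ne_zero i)))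

theorem coroot_nonneg_or {l : List I} (hl : ∀ i ∈ l, i ∈ B) {i : I} (hi : i ∈ B) :
    0 ≤ wordProd C.A l (Pi.single i 1) ∨ wordProd C.A l (Pi.single i 1) ≤ 0 :=
  (R.wordProd_single_nonneg_or hB hl i).imp (R.coroot_nonneg hB hl hi) (R.coroot_nonpos hB hl hi)

theorem coroot_eq_single_of_reflection_nonpos {l : List I} (hl : ∀ i ∈ l, i ∈ B) {i q : I}
    (hi : i ∈ B) (hq : q ∈ B) (hpos : 0 ≤ wordProd C.A l (Pi.single i 1))
    (hneg : reflection C.A q (wordProd C.A l (Pi.single i 1)) ≤ 0) :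
    wordProd C.A l (Pi.single i 1) = Pi.single q 1 := by
  have hA : ∀ i ∈ B, C.A i i = 2 := fun i hi => C.diag_even i (hB i hi)
  have hql : ∀ j ∈ q :: l, j ∈ B := fun j hj => by
    rcases List.mem_cons.1 hj with rfl | hj
    · exact hq
    · exact hl j hj
  rw [← Module.End.mul_apply, ← wordProd_cons] at hneg
  have h1 : 0 ≤ wordProd C.A.transpose l (Pi.single i 1) :=
    (R.wordProd_single_nonneg_or hB hl i).resolve_right fun h =>
      coroot_ne_zero_of_word hA hl i (le_antisymm (R.coroot_nonpos hB hl hi h) hpos)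
  have h2 : wordProd C.A.transpose (q :: l) (Pi.single i 1) ≤ 0 :=
    (R.wordProd_single_nonneg_or hB hql i).resolve_left fun h =>
      coroot_ne_zero_of_word hA hql i (le_antisymm hneg (R.coroot_nonneg hB hql hi h))
  rw [wordProd_cons, Module.End.mul_apply] at h2
  exact wordProd_coroot_of_root hB hl hi hq
    (R.eq_single_of_reflection_nonpos hB hq (R.rootSpace_wordProd_single_ne_bot hB hl i)
      (wordProd_single_ne_zero hB hl i) h1 h2)

/-- The coroots inverted along a reduced word are distinct, and are the positive coroots which
the Weyl group element makes negative. -/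
theorem inversionList_spec {l : List I} (hl : IsReducedWord C.A B l) :
    (inversionList C.A l).Nodup ∧ ∀ y, y ∈ inversionList C.A l ↔
      y ∈ posCoroots C.A B ∧ wordProd C.A l y ≤ 0 := by
  have hA : ∀ i ∈ B, C.A i i = 2 := fun i hi => C.diag_even i (hB i hi)
  induction l with
  | nil =>
    refine ⟨List.nodup_nil, fun y => ⟨fun h => by simp [inversionList] at h, ?_⟩⟩
    rintro ⟨⟨⟨m, hm, j, -, rfl⟩, h1⟩, h2⟩
    exact (coroot_ne_zero_of_word hA hm j (le_antisymm h2 h1)).elim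
  | cons i l ih =>
    have hl' : IsReducedWord C.A B l := IsReducedWord.of_append_right (l := [i]) hl
    obtain ⟨ih1, ih2⟩ := ih hl'
    have hi : i ∈ B := hl.1 i List.mem_cons_self
    have hrev : ∀ j ∈ l.reverse, j ∈ B := fun j hj => hl'.1 j (List.mem_reverse.1 hj)
    have hAl : ∀ j ∈ l, C.A j j = 2 := fun j hj => hA j (hl'.1 j hj)
    have hcancel : wordProd C.A l (wordProd C.A l.reverse (Pi.single i 1)) = Pi.single i 1 := by
      rw [← Module.End.mul_apply, wordProd_mul_reverse hAl, Module.End.one_apply]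
    have hcancel' : ∀ y, wordProd C.A l.reverse (wordProd C.A l y) = y := fun y => by
      rw [← Module.End.mul_apply, wordProd_reverse_mul hAl, Module.End.one_apply]
    have hpos : 0 ≤ wordProd C.A l.reverse (Pi.single i 1) := by
      have h1 := hl.reverse hA
      rw [List.reverse_cons, ← isReducedWord_transpose_iff] at h1
      exact R.coroot_nonneg hB hrev hi (R.nonneg_of_isReducedWord_append hB h1)
    have hsingle : ¬(Pi.single i 1 : I → ℤ) ≤ 0 := fun h => by simpa using h i
    refine ⟨List.nodup_cons.2 ⟨fun h => hsingle ?_, ih1⟩, fun y => ?_⟩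
    · rw [← hcancel]; exact ((ih2 _).1 h).2
    -- Among positive coroots r_i negates only h_i, so prefixing `i` adds exactly the coroot that
    -- `l` sends to h_i.
    rw [inversionList, List.mem_cons, ih2, wordProd_cons, Module.End.mul_apply]
    constructor
    · rintro (rfl | ⟨⟨⟨m, hm, j, hj, rfl⟩, h1⟩, h2⟩)
      · refine ⟨⟨⟨l.reverse, hrev, i, hi, rfl⟩, hpos⟩, ?_⟩
        rw [hcancel, reflection_single (hA i hi)]
        exact neg_nonpos.2 (Pi.single_nonneg.2 zero_le_one)
      · refine ⟨⟨⟨m, hm, j, hj, rfl⟩, h1⟩, ?_⟩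
        have hlm : ∀ q ∈ l ++ (m ++ [j]), q ∈ B := fun q hq => by
          simp only [List.mem_append, List.mem_singleton] at hq
          rcases hq with hq | hq | rfl
          exacts [hl'.1 q hq, hm q hq, hj]
        -- Appending `j` presents the negative of a coroot again as a Weyl group image of a simple
        -- coroot.
        have hneg : wordProd C.A (l ++ (m ++ [j])) (Pi.single j 1) =
            -wordProd C.A l (wordProd C.A m (Pi.single j 1)) := by
          rw [wordProd_append, wordProd_append, wordProd_singleton, Module.End.mul_apply,
            Module.End.mul_apply, reflection_single (hA j hj), map_neg, map_neg]
        have h3 : ∀ q ∈ i :: (l ++ (m ++ [j])), q ∈ B := fun q hq => by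
          rcases List.mem_cons.1 hq with rfl | hq
          exacts [hi, hlm q hq]
        have h4 := R.coroot_nonneg_or hB h3 hj
        rw [wordProd_cons, Module.End.mul_apply, hneg, map_neg] at h4
        rcases h4 with h4 | h4
        · exact neg_nonneg.1 h4
        · exfalso
          have h5 := R.coroot_eq_single_of_reflection_nonpos hB hlm hj hi
            (by rw [hneg]; exact neg_nonneg.2 h2) (by rw [hneg, map_neg]; exact h4)
          rw [hneg, neg_eq_iff_eq_neg] at h5
          have h6 := hcancel' (wordProd C.A m (Pi.single j 1))
          rw [h5, map_neg] at h6
          exact coroot_ne_zero_of_word hA hm j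
            (le_antisymm (by rw [← h6]; exact neg_nonpos.2 hpos) h1)
    · rintro ⟨⟨⟨m, hm, j, hj, rfl⟩, h1⟩, h2⟩
      have hlm : ∀ q ∈ l ++ m, q ∈ B := fun q hq =>
        (List.mem_append.1 hq).elim (hl'.1 q) (hm q)
      have h3 := R.coroot_nonneg_or hB hlm hj
      rw [wordProd_append, Module.End.mul_apply] at h3
      rcases h3 with h3 | h3
      · left
        have h4 := R.coroot_eq_single_of_reflection_nonpos hB hlm hj hi
          (by rwa [wordProd_append]) (by rwa [wordProd_append])
        rw [wordProd_append, Module.End.mul_apply] at h4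
        rw [← h4, hcancel']
      · exact Or.inr ⟨⟨⟨m, hm, j, hj, rfl⟩, h1⟩, h3⟩

end Realization

end SuperSatake

namespace SuperSatake

open LieSuperalgebra Matrix

/-! ### The longest element -/

section

variable {I : Type*} [Fintype I] [DecidableEq I] (C : CartanDatum I) {B : Set I}

theorem isLongestWord_transpose_iff (l : List I) :
    IsLongestWord C.A.transpose B l ↔ IsLongestWord C.A B l := by
  simp only [IsLongestWord, isReducedWord_transpose_iff]

variable {C} {τ : Equiv.Perm I} (hadm : IsSuperAdmissible C B τ)

include hadm

theorem IsSuperAdmissible.map_mem {i : I} (hi : i ∈ B) : τ i ∈ B :=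
  hadm.stable ▸ Set.mem_image_of_mem τ hi

theorem IsSuperAdmissible.map_mem_iff {i : I} : τ i ∈ B ↔ i ∈ B :=
  ⟨fun h => hadm.invol i ▸ hadm.map_mem h, hadm.map_mem⟩

theorem IsSuperAdmissible.wordProd_transpose_single {l : List I} (hl : IsLongestWord C.A B l)
    {i : I} (hi : i ∈ B) :
    wordProd C.A.transpose l (Pi.single i 1) = -Pi.single (τ i) 1 := by
  refine scale_injective C ?_
  rw [scale_wordProd, scale_single, map_smul, hadm.neg_longest l hl i hi, map_neg, scale_single,
    hadm.d_of_even (hadm.black_even i hi), smul_neg]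

theorem IsSuperAdmissible.wordProd_nonpos {l : List I} (hl : IsLongestWord C.A B l)
    {y : I → ℤ} (hy : 0 ≤ y) (hyB : ∀ j ∉ B, y j = 0) : wordProd C.A l y ≤ 0 := by
  rw [pi_eq_sum_univ' y, map_sum]
  refine Finset.sum_nonpos fun j _ => ?_
  by_cases hj : j ∈ B
  · rw [map_smul, hadm.neg_longest l hl j hj, smul_neg]
    exact neg_nonpos.2 (smul_nonneg (hy j) (Pi.single_nonneg.2 zero_le_one))
  · rw [hyB j hj, zero_smul, map_zero]

end

namespace Realization

variable {I : Type*} [Fintype I] [DecidableEq I] {C : CartanDatum I}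
  {g : Type*} [AddCommGroup g] [Module ℂ g] [LieSuperalgebra g] [FiniteDimensional ℂ g]
  (R : Realization C g) {B : Set I} (hB : ∀ i ∈ B, C.p i = 0)

include R

include hB in
/-- The Weyl group of an even subdiagram is finite. -/
theorem finite_wordProd :
    (wordProd C.A.transpose '' {l : List I | ∀ i ∈ l, i ∈ B}).Finite := by
  have hfin : (Set.univ.pi fun _ : I => {a | R.rootSpace a ≠ ⊥}).Finite :=
    Set.Finite.pi fun _ => R.finite_ne_bot
  -- A Weyl group element is determined by the images of the simple roots, which lie in the finite
  -- set of roots.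
  refine Set.Finite.of_finite_image
    (f := fun w : Module.End ℤ (I → ℤ) => fun i => w (Pi.single i 1)) (hfin.subset ?_) ?_
  · rintro _ ⟨_, ⟨l, hl, rfl⟩, rfl⟩ i -
    exact R.rootSpace_wordProd_single_ne_bot hB hl i
  · rintro w - w' - h
    exact LinearMap.pi_ext' fun i => LinearMap.ext_ring (congrFun h i)

-- The length of a reduced word depends only on its element, and there are finitely many elements,
-- so lengths are bounded.
include hB in
theorem exists_isLongestWord : ∃ l, IsLongestWord C.A B l := by
  have hfin : {n | ∃ l, IsReducedWord C.A.transpose B l ∧ l.length = n}.Finite := by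
    refine ((R.finite_wordProd hB).image fun w =>
      sInf {n | ∃ l : List I, (∀ i ∈ l, i ∈ B) ∧ wordProd C.A.transpose l = w ∧
        l.length = n}).subset ?_
    rintro n ⟨l, hl, rfl⟩
    refine ⟨_, ⟨l, hl.1, rfl⟩, le_antisymm (Nat.sInf_le ⟨l, hl.1, rfl, rfl⟩) ?_⟩
    obtain ⟨m, hm, hml, hlen⟩ := Nat.sInf_mem (s := {n | ∃ m : List I, (∀ i ∈ m, i ∈ B) ∧
      wordProd C.A.transpose m = wordProd C.A.transpose l ∧ m.length = n})
      ⟨_, l, hl.1, rfl, rfl⟩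
    exact (hl.2 m hm hml).trans_eq hlen
  obtain ⟨n, ⟨l, hl, rfl⟩, hmax⟩ :=
    Set.exists_max_image _ id hfin ⟨0, [], isReducedWord_nil, rfl⟩
  exact ⟨l, (isLongestWord_transpose_iff C l).1 ⟨hl, fun l' hl' => hmax _ ⟨l', hl', rfl⟩⟩⟩

variable {τ : Equiv.Perm I} (hadm : IsSuperAdmissible C B τ) {l : List I}
  (hl : IsLongestWord C.A B l)

include hadm hl

/-- The longest element acts as -τ on black coroots, so it inverts all positive ones, each exactly
once along a reduced word. -/
theorem inversionSum_eq_twoRho : inversionSum C.A l = twoRho C.A B := by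
  obtain ⟨h1, h2⟩ := R.inversionList_spec hadm.black_even hl.1
  have hset : posCoroots C.A B = ((inversionList C.A l).toFinset : Set (I → ℤ)) := by
    ext y
    rw [Finset.mem_coe, List.mem_toFinset, h2, iff_self_and]
    rintro ⟨⟨m, hm, i, hi, rfl⟩, hpos⟩
    refine hadm.wordProd_nonpos hl hpos fun j hj => ?_
    rw [wordProd_sub_apply hm _ hj, Pi.single_eq_of_ne]
    rintro rfl
    exact hj hi
  rw [twoRho, hset, finsum_mem_coe_finset, ← sum_inversionList, List.sum_toFinset _ h1,
    List.map_id']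

/-- The square fixes all black simple roots, whereas the element of a nonempty reduced word negates
the simple root of its last letter. -/
theorem wordProd_mul_self : wordProd C.A.transpose (l ++ l) = 1 := by
  have hfix : ∀ i ∈ B, wordProd C.A.transpose (l ++ l) (Pi.single i 1) = Pi.single i 1 :=
    fun i hi => by
      rw [wordProd_append, Module.End.mul_apply, hadm.wordProd_transpose_single hl hi, map_neg,
        hadm.wordProd_transpose_single hl (hadm.map_mem hi), neg_neg, hadm.invol]
  obtain ⟨m, hm, hml, -⟩ := exists_isReducedWord (A := C.A.transpose) (B := B) (l := l ++ l)
    fun i hi => hl.1.1 i (by simpa using hi)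
  rw [← hml] at hfix ⊢
  rcases List.eq_nil_or_concat' m with rfl | ⟨m, k, rfl⟩
  · rfl
  · exfalso
    have hk : k ∈ B := hm.1 k (by simp)
    have h1 := R.nonneg_of_isReducedWord_append hadm.black_even hm
    have h2 := hfix k hk
    rw [wordProd_append, wordProd_singleton, Module.End.mul_apply, reflection_single
      (show C.A.transpose k k = 2 from C.diag_even k (hadm.black_even k hk)), map_neg,
      neg_eq_iff_eq_neg] at h2
    rw [h2] at h1
    simpa using h1 k

/-- The longest element is an involution, so the reversed word is another reduced expression of it
and gives the same operator. -/
theorem adWord_mul_self :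
    R.adWord l * R.adWord l = R.adTorus (signChar C.A (twoRho C.A B)) := by
  have hA : ∀ i ∈ B, C.A.transpose i i = 2 := fun i hi => C.diag_even i (hadm.black_even i hi)
  have hl' := (isReducedWord_transpose_iff C B l).2 hl.1
  have h1 : wordProd C.A.transpose l.reverse = wordProd C.A.transpose l := by
    have h2 := R.wordProd_mul_self hadm hl
    rw [wordProd_append] at h2
    have h3 := congrArg (wordProd C.A.transpose l.reverse * ·) h2
    simpa only [← mul_assoc, wordProd_reverse_mul (A := C.A.transpose) (l := l)
      fun i hi => hA i (hl.1.1 i hi), one_mul, mul_one] using h3.symm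
  rw [← R.inversionSum_eq_twoRho hadm hl,
    ← R.adWord_reverse_mul fun i hi => hadm.black_even i (hl.1.1 i hi),
    R.adWord_eq_of_wordProd_eq hadm.black_even (hl'.reverse hA) hl' h1]

/-- Since the longest element makes α_i negative, it has a reduced expression ending in any black
`i`; the part before it sends α_i to α_{τi}. -/
theorem exists_adWord_eq {i : I} (hi : i ∈ B) :
    ∃ m : List I, (∀ j ∈ m, C.p j = 0) ∧ R.adWord l = R.adWord m * R.adM i ∧
      R.adWord m (R.e i) = R.e (τ i) := by
  have hl' := (isReducedWord_transpose_iff C B l).2 hl.1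
  have hneg := hadm.wordProd_transpose_single hl hi
  obtain ⟨m, h1, h2, h3⟩ := R.exists_shorter_of_nonpos hadm.black_even hl'.1 hi
    (by rw [hneg]; exact neg_nonpos.2 (Pi.single_nonneg.2 zero_le_one))
  have hm : IsReducedWord C.A.transpose B (m ++ [i]) := hl'.of_length_le (fun j hj => by
    rcases List.mem_append.1 hj with hj | hj
    · exact h1 j hj
    · rwa [List.mem_singleton.1 hj]) h3 (by simp; omega)
  refine ⟨m, fun j hj => hadm.black_even j (h1 j hj), ?_, ?_⟩
  · rw [R.adWord_eq_of_wordProd_eq hadm.black_even hl' hm h3.symm, R.adWord_append,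
      R.adWord_singleton]
  · refine R.adWord_e_of_wordProd hadm.black_even hm.of_append_left hi ?_
    rw [← h3, wordProd_append, wordProd_singleton, Module.End.mul_apply, reflection_single
      (show C.A.transpose i i = 2 from C.diag_even i (hadm.black_even i hi)), map_neg,
      neg_inj] at hneg
    exact hneg

theorem adWord_longest_e {i : I} (hi : i ∈ B) : R.adWord l (R.e i) = -R.f (τ i) := by
  obtain ⟨m, h1, h2, h3⟩ := R.exists_adWord_eq hadm hl hi
  rw [h2, Module.End.mul_apply, R.adM_e (hadm.black_even i hi), map_neg, R.adWord_f_of_e h1 h3]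

theorem adWord_longest_f {i : I} (hi : i ∈ B) : R.adWord l (R.f i) = -R.e (τ i) := by
  obtain ⟨m, h1, h2, h3⟩ := R.exists_adWord_eq hadm hl hi
  rw [h2, Module.End.mul_apply, R.adM_f (hadm.black_even i hi), map_neg, h3]

end Realization

end SuperSatake

/-! ### Commutation relations and the square of θ -/

namespace SuperSatake

open LieSuperalgebra

/-- Reflections in `B` change the argument by multiples of black roots, on which `s` is trivial. -/
theorem addChar_wordProd {I : Type*} [Fintype I] [DecidableEq I] {A : Matrix I I ℤ}
    {B : Set I} {s : AddChar (I → ℤ) ℂ} (hs : ∀ i ∈ B, s (Pi.single i 1) = 1) {l : List I}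
    (hl : ∀ i ∈ l, i ∈ B) (a : I → ℤ) : s (wordProd A l a) = s a := by
  induction l with
  | nil => rfl
  | cons i l ih =>
    rw [wordProd_cons, Module.End.mul_apply, reflection_apply, sub_eq_add_neg,
      AddChar.map_add_eq_mul, ih fun j hj => hl j (List.mem_cons_of_mem _ hj), ← neg_smul,
      AddChar.map_zsmul_eq_zpow, hs i (hl i List.mem_cons_self), one_zpow, mul_one]

/-- The action of a permutation of the nodes on characters of the root lattice. -/
noncomputable def permChar {I : Type*} (τ : Equiv.Perm I) (s : AddChar (I → ℤ) ℂ) :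
    AddChar (I → ℤ) ℂ where
  toFun a := s (a ∘ τ)
  map_zero_eq_one' := s.map_zero_eq_one
  map_add_eq_mul' a b := s.map_add_eq_mul (a ∘ τ) (b ∘ τ)

theorem permChar_apply {I : Type*} (τ : Equiv.Perm I) (s : AddChar (I → ℤ) ℂ) (a : I → ℤ) :
    permChar τ s a = s (a ∘ τ) := rfl

theorem single_comp_perm {I : Type*} [DecidableEq I] {τ : Equiv.Perm I} (hτ : ∀ i, τ (τ i) = i)
    (i : I) : (Pi.single i 1 : I → ℤ) ∘ τ = Pi.single (τ i) 1 := by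
  ext j
  rw [Function.comp_apply, Pi.single_apply, Pi.single_apply]
  refine if_congr ⟨fun h => ?_, fun h => ?_⟩ rfl rfl
  · rw [← h, hτ]
  · rw [h, hτ]

namespace Realization

variable {I : Type*} [Fintype I] [DecidableEq I] {C : CartanDatum I}
  {g : Type*} [AddCommGroup g] [Module ℂ g] [LieSuperalgebra g]
  {R : Realization C g} {B : Set I}

theorem adTorus_e (s : AddChar (I → ℤ) ℂ) (i : I) :
    R.adTorus s (R.e i) = s (Pi.single i 1) • R.e i := R.adTorus_apply s (R.e_mem_rootSpace i)

theorem adTorus_f (s : AddChar (I → ℤ) ℂ) (i : I) :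
    R.adTorus s (R.f i) = s (-Pi.single i 1) • R.f i := R.adTorus_apply s (R.f_mem_rootSpace i)

theorem IsChevalley.mul_adTorus {ω : Module.End ℂ g} (hω : R.IsChevalley ω)
    (s : AddChar (I → ℤ) ℂ) : ω * R.adTorus s = R.adTorus s⁻¹ * ω := by
  refine R.aut_ext (hω.isAut.mul (R.isAut_adTorus s)) ((R.isAut_adTorus _).mul hω.isAut)
    (fun h => ?_) (fun i => ?_) (fun i => ?_)
  · rw [Module.End.mul_apply, Module.End.mul_apply, R.adTorus_cartan, hω.map_cartan, map_neg,
      R.adTorus_cartan]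
  · rw [Module.End.mul_apply, Module.End.mul_apply, adTorus_e, map_smul, hω.map_e, map_neg,
      adTorus_f, AddChar.inv_apply, neg_neg, smul_neg]
  · rw [Module.End.mul_apply, Module.End.mul_apply, adTorus_f, map_smul, hω.map_f,
      ← smul_neg, map_smul, map_neg (R.adTorus s⁻¹), adTorus_e, AddChar.inv_apply]
    module

section Diagram

variable {τ : Equiv.Perm I} {φ : Module.End ℂ g} (hφ : R.IsDiagramAut τ φ)

include hφ

theorem IsDiagramAut.map_e' (i : I) : φ (R.e i) = diagramSign C τ i • R.e (τ i) := by
  rw [hφ.map_e, diagramSign]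
  split_ifs with h
  · rw [h, one_smul]
  · rfl

theorem IsDiagramAut.mul_adTorus (hτ : ∀ i, τ (τ i) = i) (s : AddChar (I → ℤ) ℂ) :
    φ * R.adTorus s = R.adTorus (permChar τ s) * φ := by
  refine R.aut_ext (hφ.isAut.mul (R.isAut_adTorus s)) ((R.isAut_adTorus _).mul hφ.isAut)
    (fun h => ?_) (fun i => ?_) (fun i => ?_)
  · rw [Module.End.mul_apply, Module.End.mul_apply, R.adTorus_cartan,
      R.adTorus_cartan _ ⟨_, hφ.map_cartan h⟩]
  · rw [Module.End.mul_apply, Module.End.mul_apply, adTorus_e, map_smul, hφ.map_e', map_smul,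
      adTorus_e, permChar_apply, single_comp_perm hτ, hτ, smul_comm]
  · have h : (-Pi.single (τ i) 1 : I → ℤ) ∘ τ = -Pi.single i 1 := by
      have := congrArg Neg.neg (single_comp_perm hτ (τ i))
      rw [hτ] at this
      exact this
    rw [Module.End.mul_apply, Module.End.mul_apply, adTorus_f, map_smul, hφ.map_f,
      adTorus_f, permChar_apply, h]

variable {ω : Module.End ℂ g} (hω : R.IsChevalley ω)

include hω

theorem comp_e (i : I) : (φ * ω) (R.e i) = -R.f (τ i) := by
  rw [Module.End.mul_apply, hω.map_e, map_neg, hφ.map_f]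

theorem comp_f (i : I) :
    (φ * ω) (R.f i) = -(((-1 : ℂ) ^ (C.p i).val * diagramSign C τ i) • R.e (τ i)) := by
  rw [Module.End.mul_apply, hω.map_f, map_neg, map_smul, hφ.map_e', smul_smul]

theorem comp_comp_e (hadm : IsSuperAdmissible C B τ) (i : I) :
    (φ * ω) ((φ * ω) (R.e i)) = ((-1 : ℂ) ^ (C.p i).val * diagramSign C τ i) • R.e i := by
  rw [comp_e hφ hω, map_neg, comp_f hφ hω, hadm.invol, hadm.parity, hadm.diagramSign_apply,
    neg_neg]

theorem comp_comp_f (hadm : IsSuperAdmissible C B τ) (i : I) :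
    (φ * ω) ((φ * ω) (R.f i)) = ((-1 : ℂ) ^ (C.p i).val * diagramSign C τ i) • R.f i := by
  rw [comp_f hφ hω, map_neg, map_smul, comp_e hφ hω, hadm.invol, smul_neg, neg_neg]

theorem comp_comp_cartan (h : R.cartan) : (φ * ω) ((φ * ω) (h : g)) = h := by
  rw [Module.End.mul_apply, Module.End.mul_apply, hω.map_cartan, map_neg,
    hω.map_cartan ⟨_, Submodule.neg_mem _ (hφ.map_cartan h)⟩, neg_neg, hφ.invol_cartan]

end Diagram

variable [FiniteDimensional ℂ g]

theorem adWord_mul_adTorus (hB : ∀ i ∈ B, C.p i = 0) {l : List I} (hl : ∀ i ∈ l, i ∈ B)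
    {s : AddChar (I → ℤ) ℂ} (hs : ∀ i ∈ B, s (Pi.single i 1) = 1) :
    R.adWord l * R.adTorus s = R.adTorus s * R.adWord l := by
  refine R.end_ext fun a x hx => ?_
  rw [Module.End.mul_apply, Module.End.mul_apply, R.adTorus_apply s hx, map_smul,
    R.adTorus_apply s (R.adWord_mem_rootSpace (fun i hi => hB i (hl i hi)) hx),
    addChar_wordProd hs hl]

variable {τ : Equiv.Perm I} {φ ω : Module.End ℂ g} (hadm : IsSuperAdmissible C B τ) {l : List I}
  (hl : IsLongestWord C.A B l) (hφ : R.IsDiagramAut τ φ) (hω : R.IsChevalley ω)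

include hadm hl hφ hω

omit [AddCommGroup g] [Module ℂ g] [LieSuperalgebra g] [FiniteDimensional ℂ g] hl hφ hω in
theorem sign_of_black {i : I} (hi : i ∈ B) :
    (-1 : ℂ) ^ (C.p i).val * diagramSign C τ i = 1 := by
  rw [diagramSign, hadm.black_even i hi]; simp

/-- The automorphism `τ ∘ ω ∘ Ad(m_•)` fixes the Chevalley generators of the black nodes. -/
theorem comp_adWord_black {i : I} (hi : i ∈ B) :
    (φ * ω * R.adWord l) (R.e i) = R.e i ∧ (φ * ω * R.adWord l) (R.f i) = R.f i := by
  have hτi := hadm.map_mem hi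
  constructor
  · rw [Module.End.mul_apply, R.adWord_longest_e hadm hl hi, map_neg, comp_f hφ hω,
      sign_of_black hadm hτi, one_smul, neg_neg, hadm.invol]
  · rw [Module.End.mul_apply, R.adWord_longest_f hadm hl hi, map_neg, comp_e hφ hω,
      neg_neg, hadm.invol]

/-- The product of τω with Ad(m_•) fixes the black generators, so it commutes with every black
Ad(m_i) and hence with Ad(m_•) itself, which is then cancelled on the right. -/
theorem comp_mul_adWord : φ * ω * R.adWord l = R.adWord l * (φ * ω) := by
  have hlB : ∀ i ∈ l, C.p i = 0 := fun i hi => hadm.black_even i (hl.1.1 i hi)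
  have hT := R.isAut_adWord hlB
  have hX := (hφ.isAut.mul hω.isAut).mul hT
  have hcomm : ∀ m : List I, (∀ i ∈ m, i ∈ B) →
      φ * ω * R.adWord l * R.adWord m = R.adWord m * (φ * ω * R.adWord l) := by
    intro m hm
    induction m with
    | nil => rw [R.adWord_nil, mul_one, one_mul]
    | cons i m ih =>
      obtain ⟨h1, h2⟩ := comp_adWord_black hadm hl hφ hω (hm i List.mem_cons_self)
      rw [R.adWord_cons, ← mul_assoc, R.mul_adM_of_apply hX h1 h2, mul_assoc,
        ih fun j hj => hm j (List.mem_cons_of_mem _ hj), ← mul_assoc]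
  have h := hcomm l hl.1.1
  refine LinearMap.ext fun x => ?_
  obtain ⟨y, rfl⟩ := hT.bijective.2 x
  exact LinearMap.congr_fun h y

/-- The sign by which `Ad(m_•)²` acts is invariant under the diagram involution. -/
theorem sign_twoRho_apply (i : I) :
    (-1 : ℂ) ^ rootEval C.A (τ i) (twoRho C.A B) = (-1 : ℂ) ^ rootEval C.A i (twoRho C.A B) := by
  have hc := comp_mul_adWord hadm hl hφ hω
  have h1 : φ * ω * R.adTorus (signChar C.A (twoRho C.A B)) =
      R.adTorus (signChar C.A (twoRho C.A B)) * (φ * ω) := by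
    rw [← R.adWord_mul_self hadm hl, ← mul_assoc, hc, mul_assoc, hc, mul_assoc]
  -- Compare on e_i: τω carries it to -f_{τi}, whose torus sign is the inverse of the one for
  -- e_{τi}, and a sign is its own inverse.
  have h2 := LinearMap.congr_fun h1 (R.e i)
  rw [Module.End.mul_apply, Module.End.mul_apply (R.adTorus _), adTorus_e, map_smul,
    comp_e hφ hω, map_neg, adTorus_f, smul_neg, neg_inj] at h2
  have h3 := smul_left_injective ℂ (R.f_ne_zero (τ i)) h2
  rw [AddChar.map_neg_eq_inv, signChar_apply, signChar_apply, pairing_single_left,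
    pairing_single_left] at h3
  rw [h3, ← inv_zpow, inv_neg_one]

-- For black `i` the square of Ad(m_•) takes e_i through -f_{τi} back to e_i.
include R in
omit hφ hω in
theorem sign_twoRho_of_black {i : I} (hi : i ∈ B) :
    (-1 : ℂ) ^ rootEval C.A i (twoRho C.A B) = 1 := by
  have h := LinearMap.congr_fun (R.adWord_mul_self hadm hl) (R.e i)
  rw [Module.End.mul_apply, R.adWord_longest_e hadm hl hi, map_neg,
    R.adWord_longest_f hadm hl (hadm.map_mem hi), hadm.invol, neg_neg, adTorus_e,
    signChar_apply, pairing_single_left] at h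
  exact (smul_left_injective ℂ (R.e_ne_zero i) ((one_smul ℂ _).trans h)).symm

omit [FiniteDimensional ℂ g] hadm hl hφ hω in
theorem theta_eq (s : AddChar (I → ℤ) ℂ) :
    R.theta s φ ω l = R.adTorus s * (φ * ω * R.adWord l) := rfl

variable {s : AddChar (I → ℤ) ℂ} (hs : IsTwist C B τ s)

include hs

/-- Ad(s) is carried past Ad(m_•) unchanged, inverted by ω and permuted by τ; the rest squares as a
product of commuting factors. -/
theorem theta_mul_self :
    R.theta s φ ω l * R.theta s φ ω l =
      R.adTorus (s * permChar τ s⁻¹ * signChar C.A (twoRho C.A B)) * ((φ * ω) * (φ * ω)) := by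
  have hc := comp_mul_adWord hadm hl hφ hω
  have h1 : φ * ω * R.adWord l * R.adTorus s =
      R.adTorus (permChar τ s⁻¹) * (φ * ω * R.adWord l) := by
    rw [mul_assoc, adWord_mul_adTorus hadm.black_even hl.1.1 hs.one_of_black, mul_assoc,
      ← mul_assoc ω, hω.mul_adTorus, mul_assoc, ← mul_assoc φ, hφ.mul_adTorus hadm.invol]
    simp only [mul_assoc]
  have h2 : (φ * ω * R.adWord l) * (φ * ω * R.adWord l) =
      R.adTorus (signChar C.A (twoRho C.A B)) * ((φ * ω) * (φ * ω)) := by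
    rw [← R.adWord_mul_self hadm hl]
    conv_lhs => rw [hc, mul_assoc, ← mul_assoc (φ * ω), hc]
    simp only [mul_assoc]
  rw [theta_eq, mul_assoc, ← mul_assoc _ (R.adTorus s), h1, mul_assoc, h2, ← mul_assoc,
    ← mul_assoc, R.adTorus_mul, R.adTorus_mul]

theorem theta_theta_cartan (h : R.cartan) :
    (R.theta s φ ω l * R.theta s φ ω l) (h : g) = h := by
  rw [theta_mul_self hadm hl hφ hω hs, Module.End.mul_apply, Module.End.mul_apply (φ * ω),
    comp_comp_cartan hφ hω, R.adTorus_cartan]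

/-- The scalar by which `θ²` acts on the Chevalley generators of a node. -/
theorem exists_theta_theta (i : I) :
    ∃ c : ℂ, (R.theta s φ ω l * R.theta s φ ω l) (R.e i) = c • R.e i ∧
      (R.theta s φ ω l * R.theta s φ ω l) (R.f i) = c • R.f i ∧ c * c = 1 ∧
      (i ∈ B → c = 1) ∧ (τ i ≠ i → c = 1) ∧
      (i ∉ B → τ i = i →
        c = (-1 : ℂ) ^ (C.p i).val * (-1 : ℂ) ^ rootEval C.A i (twoRho C.A B)) := by
  classical
  set σ := (-1 : ℂ) ^ rootEval C.A i (twoRho C.A B) with hσ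
  have hσσ : σ * σ = 1 := by rw [hσ, ← mul_zpow]; norm_num
  have hσi : σ⁻¹ = σ := inv_eq_of_mul_eq_one_left hσσ
  set u := (-1 : ℂ) ^ (C.p i).val * diagramSign C τ i with hu
  -- At moved white nodes the ratio prescribed for the twist is `σ` itself and cancels; at black
  -- nodes `σ` is already 1.
  have hs0 : s (Pi.single i 1) / s (Pi.single (τ i) 1) * σ =
      if i ∈ B ∨ τ i ≠ i then 1 else σ := by
    by_cases hi : i ∈ B
    · rw [if_pos (Or.inl hi), hs.one_of_black i hi, hs.one_of_black _ (hadm.map_mem hi), hσ,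
        sign_twoRho_of_black (R := R) hadm hl hi]
      norm_num
    · by_cases hτ : τ i = i
      · rw [if_neg (by simp [hi, hτ]), hτ, hs.one_of_fixed i hi hτ]
        norm_num
      · rw [if_pos (Or.inr hτ), hs.ratio i hi hτ, hσσ]
  set t := s * permChar τ s⁻¹ * signChar C.A (twoRho C.A B) with ht
  have ht1 : t (Pi.single i 1) = if i ∈ B ∨ τ i ≠ i then 1 else σ := by
    rw [← hs0, ht, AddChar.mul_apply, AddChar.mul_apply, permChar_apply,
      single_comp_perm hadm.invol, AddChar.inv_apply, AddChar.map_neg_eq_inv, signChar_apply,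
      pairing_single_left, div_eq_mul_inv]
  have ht2 : t (-Pi.single i 1) = t (Pi.single i 1) := by
    rw [AddChar.map_neg_eq_inv, ht1]
    split_ifs
    · exact inv_one
    · exact hσi
  have huu : u * u = 1 := by
    have h1 := diagramSign_sq (C := C) (τ := τ) i
    have h2 : (-1 : ℂ) ^ (C.p i).val * (-1 : ℂ) ^ (C.p i).val = 1 := by
      rw [← mul_pow]; norm_num
    rw [hu]
    linear_combination (diagramSign C τ i * diagramSign C τ i) * h2 + h1
  refine ⟨t (Pi.single i 1) * u, ?_, ?_, ?_, fun hi => ?_, fun hi => ?_, fun hi hτ => ?_⟩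
  · rw [theta_mul_self hadm hl hφ hω hs, Module.End.mul_apply, Module.End.mul_apply (φ * ω),
      comp_comp_e hφ hω hadm, map_smul, adTorus_e, smul_smul, mul_comm]
  · rw [theta_mul_self hadm hl hφ hω hs, Module.End.mul_apply, Module.End.mul_apply (φ * ω),
      comp_comp_f hφ hω hadm, map_smul, adTorus_f, ← ht, ht2, smul_smul, mul_comm]
  · rw [mul_mul_mul_comm, huu, mul_one, ht1]
    split_ifs
    · exact one_mul 1
    · exact hσσ
  · rw [ht1, if_pos (Or.inl hi), hu, sign_of_black hadm hi, one_mul]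
  · rw [ht1, if_pos (Or.inr hi), one_mul, hu, diagramSign, if_neg hi, ← mul_pow]
    norm_num
  · rw [ht1, if_neg (by simp [hi, hτ]), hu, diagramSign, if_pos hτ, mul_one, mul_comm]

omit hs in
theorem isAut_theta : IsAut (R.theta s φ ω l) :=
  (R.isAut_adTorus s).mul ((hφ.isAut.mul hω.isAut).mul
    (R.isAut_adWord fun i hi => hadm.black_even i (hl.1.1 i hi)))

theorem theta_pow_four : R.theta s φ ω l ^ 4 = 1 := by
  have hθ := isAut_theta (s := s) hadm hl hφ hω
  have hsq := hθ.mul hθ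
  have h : R.theta s φ ω l ^ 4 = (R.theta s φ ω l * R.theta s φ ω l) *
      (R.theta s φ ω l * R.theta s φ ω l) := by
    rw [← pow_two, ← pow_two, ← pow_mul]
  rw [h]
  refine R.aut_ext (hsq.mul hsq) isAut_one (fun x => ?_) (fun i => ?_) (fun i => ?_)
  · rw [Module.End.mul_apply, theta_theta_cartan hadm hl hφ hω hs,
      theta_theta_cartan hadm hl hφ hω hs, Module.End.one_apply]
  · obtain ⟨c, h1, -, h2, -⟩ := exists_theta_theta hadm hl hφ hω hs i
    rw [Module.End.mul_apply, h1, map_smul, h1, smul_smul, h2, one_smul, Module.End.one_apply]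
  · obtain ⟨c, -, h1, h2, -⟩ := exists_theta_theta hadm hl hφ hω hs i
    rw [Module.End.mul_apply, h1, map_smul, h1, smul_smul, h2, one_smul, Module.End.one_apply]

theorem theta_pow_two_iff : R.theta s φ ω l ^ 2 = 1 ↔
    ∀ i, i ∉ B → C.p i = 1 → τ i = i → rootEval C.A i (twoRho C.A B) ≡ 1 [ZMOD 2] := by
  rw [pow_two]
  have hpar : ∀ m : ℤ, (-1 : ℂ) ^ m = -1 ↔ m ≡ 1 [ZMOD 2] := fun m => by
    rcases Int.even_or_odd m with h | h
    · rw [h.neg_one_zpow]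
      refine iff_of_false (by norm_num) fun h' => ?_
      rw [Int.even_iff] at h
      rw [Int.ModEq] at h'
      omega
    · rw [h.neg_one_zpow]
      exact iff_of_true rfl (Int.odd_iff.1 h)
  constructor
  · intro h i hi hp hτ
    obtain ⟨c, h1, -, -, -, -, h2⟩ := exists_theta_theta hadm hl hφ hω hs i
    rw [h, Module.End.one_apply] at h1
    have hc := smul_left_injective ℂ (R.e_ne_zero i) ((one_smul ℂ _).trans h1)
    have h3 := h2 hi hτ
    rw [← hc, hp, ZMod.val_one, pow_one] at h3
    rw [← hpar]
    linear_combination h3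
  · intro h
    have hθ := isAut_theta (s := s) hadm hl hφ hω
    have hone : ∀ i, (R.theta s φ ω l * R.theta s φ ω l) (R.e i) = R.e i ∧
        (R.theta s φ ω l * R.theta s φ ω l) (R.f i) = R.f i := by
      intro i
      obtain ⟨c, h1, h2, -, h3, h4, h5⟩ := exists_theta_theta hadm hl hφ hω hs i
      suffices hc : c = 1 by rw [h1, h2, hc, one_smul, one_smul]; exact ⟨rfl, rfl⟩
      by_cases hi : i ∈ B
      · exact h3 hi
      by_cases hτ : τ i = i
      · rw [h5 hi hτ]
        rcases parity_cases (C.p i) with hp | hp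
        -- Integrality for half the sum makes the value of α_i on the full sum even.
        · obtain ⟨n, hn⟩ := hadm.integral i hi (Or.inl hp) hτ
          have hn' : rootEval C.A i (twoRho C.A B) = 2 * n := by
            have : (rootEval C.A i (twoRho C.A B) : ℚ) = 2 * n := by linarith
            exact_mod_cast this
          rw [hp, hn', zpow_mul]
          norm_num
        · rw [(hpar _).2 (h i hi hp hτ), hp, ZMod.val_one]
          norm_num
      · exact h4 hτ
    exact R.aut_ext (hθ.mul hθ) isAut_one
      (fun x => by rw [theta_theta_cartan hadm hl hφ hω hs, Module.End.one_apply])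
      (fun i => (hone i).1) (fun i => (hone i).2)

-- The Weyl group of `B` does not change white coordinates, so for white `i` the image of e_i has
-- coefficient -1 at the white node τi and lies outside the root space of α_i.
omit hs in
theorem theta_ne_one (hwhite : ∃ i, i ∉ B) : R.theta s φ ω l ≠ 1 := by
  obtain ⟨i, hi⟩ := hwhite
  intro h
  have h1 := LinearMap.congr_fun h (R.e i)
  rw [theta_eq, comp_mul_adWord hadm hl hφ hω, Module.End.mul_apply,
    Module.End.mul_apply, comp_e hφ hω, map_neg, map_neg] at h1
  have h2 := R.adWord_mem_rootSpace (fun i hi => hadm.black_even i (hl.1.1 i hi))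
    (R.f_mem_rootSpace (τ i))
  rw [R.adTorus_apply s h2, Module.End.one_apply] at h1
  have h3 : R.e i ∈ R.rootSpace (wordProd C.A.transpose l (-Pi.single (τ i) 1)) := by
    rw [← h1]
    exact Submodule.neg_mem _ (Submodule.smul_mem _ _ h2)
  have hne : (Pi.single i 1 : I → ℤ) ≠ wordProd C.A.transpose l (-Pi.single (τ i) 1) := by
    intro h4
    have h5 := congrFun h4 (τ i)
    rw [wordProd_sub_apply hl.1.1 _ (mt hadm.map_mem_iff.1 hi), Pi.neg_apply,
      Pi.single_eq_same] at h5
    have h6 : (0 : ℤ) ≤ (Pi.single i 1 : I → ℤ) (τ i) :=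
      (Pi.single_nonneg.2 zero_le_one : (0 : I → ℤ) ≤ Pi.single i 1) (τ i)
    omega
  exact R.e_ne_zero i (Submodule.disjoint_def.1 (R.iSupIndep_rootSpace.pairwiseDisjoint hne) _
    (R.e_mem_rootSpace i) h3)

omit hs

omit [FiniteDimensional ℂ g] hadm hl hφ hω in
theorem exists_addChar (c : I → ℂ) (hc : ∀ i, c i ≠ 0) :
    ∃ s : AddChar (I → ℤ) ℂ, ∀ i, s (Pi.single i 1) = c i := by
  refine ⟨{ toFun := fun a => ∏ j, c j ^ a j
            map_zero_eq_one' := by simp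
            map_add_eq_mul' := fun a b => by
              rw [← Finset.prod_mul_distrib]
              exact Finset.prod_congr rfl fun j _ => zpow_add₀ (hc j) _ _ }, fun i => ?_⟩
  change ∏ j, c j ^ (Pi.single i 1 : I → ℤ) j = c i
  rw [Finset.prod_eq_single i (fun j _ hj => by rw [Pi.single_eq_of_ne hj, zpow_zero])
    (by simp), Pi.single_eq_same, zpow_one]

/-- An enumeration of the nodes selects one from each white pair exchanged by τ, and the sign of
2ρ_•^∨ is put there. Both ratios come out right because this sign is τ-invariant and self-inverse.
-/
theorem exists_isTwist : ∃ s, IsTwist C B τ s := by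
  classical
  set n := Fintype.equivFin I
  obtain ⟨s, hs⟩ := exists_addChar (fun i => if i ∉ B ∧ n i < n (τ i) then
    (-1 : ℂ) ^ rootEval C.A i (twoRho C.A B) else 1) fun i => by
      split_ifs
      · exact zpow_ne_zero _ (by norm_num)
      · exact one_ne_zero
  refine ⟨s, fun i hi => ?_, fun i hi hτ => ?_, fun i hi hτ => ?_⟩
  · rw [hs, if_neg (by simp [hi])]
  · rw [hs, hτ, if_neg (by simp)]
  · have hτi := mt hadm.map_mem_iff.1 hi
    rw [hs, hs, hadm.invol, sign_twoRho_apply hadm hl hφ hω]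
    rcases lt_trichotomy (n i) (n (τ i)) with h | h | h
    · rw [if_pos ⟨hi, h⟩, if_neg (by simp [h.le]), div_one]
    · exact (hτ (n.injective h).symm).elim
    · rw [if_neg (by simp [h.le]), if_pos ⟨hτi, h⟩, one_div, ← inv_zpow, inv_neg_one]

end Realization

end SuperSatake

theorem mainTheorem6 {I : Type*} [Fintype I] [DecidableEq I] (C : SuperSatake.CartanDatum I)
    {g : Type*} [AddCommGroup g] [Module ℂ g] [FiniteDimensional ℂ g] [LieSuperalgebra g]
    (R : SuperSatake.Realization C g) (B : Set I) (τ : Equiv.Perm I)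
    (hadm : SuperSatake.IsSuperAdmissible C B τ)
    (hwhite : ∃ i, i ∉ B)
    (hsign : ∀ i, C.p i = 1 → τ i ≠ i → C.d (τ i) = -C.d i) :
    (∃ l, SuperSatake.IsLongestWord C.A B l) ∧
    (∃ ω, R.IsChevalley ω) ∧
    (∃ φ, R.IsDiagramAut τ φ) ∧
    (∃ s, SuperSatake.IsTwist C B τ s) ∧
    ∀ (l : List I) (ω φ : Module.End ℂ g) (s : AddChar (I → ℤ) ℂ),
      SuperSatake.IsLongestWord C.A B l → R.IsChevalley ω → R.IsDiagramAut τ φ →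
      SuperSatake.IsTwist C B τ s →
      SuperSatake.IsAut (R.theta s φ ω l) ∧
      (orderOf (R.theta s φ ω l) = 2 ∨ orderOf (R.theta s φ ω l) = 4) ∧
      (orderOf (R.theta s φ ω l) = 2 ↔
        ∀ i, i ∉ B → C.p i = 1 → τ i = i →
          SuperSatake.rootEval C.A i (SuperSatake.twoRho C.A B) ≡ 1 [ZMOD 2]) := by
  obtain ⟨l₀, hl₀⟩ := R.exists_isLongestWord hadm.black_even
  obtain ⟨ω₀, hω₀⟩ := R.exists_isChevalley
  obtain ⟨φ₀, hφ₀⟩ := R.exists_isDiagramAut hadm hsign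
  refine ⟨⟨l₀, hl₀⟩, ⟨ω₀, hω₀⟩, ⟨φ₀, hφ₀⟩,
    SuperSatake.Realization.exists_isTwist hadm hl₀ hφ₀ hω₀, fun l ω φ s hl hω hφ hs => ?_⟩
  have h4 := SuperSatake.Realization.theta_pow_four hadm hl hφ hω hs
  have h1 := SuperSatake.Realization.theta_ne_one (s := s) hadm hl hφ hω hwhite
  rw [← SuperSatake.Realization.theta_pow_two_iff hadm hl hφ hω hs]
  refine ⟨SuperSatake.Realization.isAut_theta hadm hl hφ hω, ?_, fun h => ?_, fun h => ?_⟩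
  · by_cases h2 : R.theta s φ ω l ^ 2 = 1
    · exact Or.inl (orderOf_eq_prime h2 h1)
    -- With `n = 1`: θ² ≠ 1 and θ⁴ = 1 force the order to be 2^{1+1}.
    · exact Or.inr (orderOf_eq_prime_pow (p := 2) (n := 1) (by simpa using h2) h4)
  · rw [← h]; exact pow_orderOf_eq_one _
  · exact orderOf_eq_prime h h1
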